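/- Let $1\le h$ and $n$ be integers with $h<n-\frac12-\frac{\sqrt{8n+9}}2$. For $m\ge 0$ put $$F(m)=F_n^h(m)=\frac h{n+1}\cdot\frac{(n+1)!}{m!\,(m+h)!\,(n+1-h-2m)!}$$ (and $F(m)=0$ if $2m+h>n+1$), $F_n^h=\sum_m F(m)$, and let $M$ be the first value of $m$ that maximizes $F(m)$. A Motzkin left factor of size $n$ and final height $e$ is a path of $n$ steps $x=(1,1)$, $\bar x=(1,-1)$, $z=(1,0)$ that starts at height $0$, never goes below height $0$ and ends at height $e$. Put $$\tilde m=\frac{4n+4-3h-\sqrt{4n^2+20n+28-3h^2}}6,\qquad k=\Big\lceil\frac{n+1-h}{2\tilde m}\Big\rceil-1,\qquad \alpha=\min\big(k-1,\lfloor k-k(M-\tilde m)\rfloor\big),$$ $N=(k+1)M+\alpha$, $\underline B(m)=k^{N-m}\binom Nm$, $B(m)=\underline B(m)$ for $m\ne M$, $B(M)=\max(\underline B(M-1),\underline B(M+1))$, $\overline B(m)=B(m)F(M)/B(M)$, $G(m)=F(m)/B(m)$ and ${\cal R}G(m)=G(m+1)/G(m)$ (taken as $0$ when $F(m+1)=0$).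 Let $random(p)$ be uniform on $\{0,\dots,p-1\}$, and let $[p,q]$ be the test that succeeds iff $random(p)<q$. Say that we are in case $+$ if $(kM+\alpha+1)(kM+\alpha)\ge k^2M(M+1)$, and in case $-$ otherwise. Generator: repeat the following until a value is returned. Let $m$ be the number of zeros among $N$ draws of $random(k+1)$. If $m\neq M$, return $m$; if $m=M$, return $m$ iff the test $[k(M+1),\,kM+\alpha]$ (case $+$), respectively $[kM+\alpha+1,\,kM]$ (case $-$), succeeds. Acceptance of $m$: reject if $2m>n+1-h$; accept if $m=M$; otherwise accept iff all of the following tests, run in order and stopped at the first failure, succeed. Write $P_i=(n+1-h-2i)(n-h-2i)$ and $Q_i=(i+1+h)(N-i)$. * If $m<M$: in case $+$ the tests $[k(M+1),\,kM+\alpha+1]$ and $[kP_{M-1},\,(M+h)(kM+\alpha)]$, in case $-$ the test $[P_{M-1},\,M(M+h)]$; then $[kP_i,Q_i]$ for $m\le i\le M-2$. * If $m>M$: in case $-$ the tests $[kM+\alpha,\,kM]$ and $[(M+h+1)(kM+\alpha+1),\,kP_M]$, in case $+$ the test $[(M+1)(M+1+h),\,P_M]$; then $[Q_i,kP_i]$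 for $M+1\le i\le m-1$. Algorithm: fail if $h\ge n-\frac12-\frac{\sqrt{8n+9}}2$; compute $M$ as the first $m\ge0$ with $P_m\le(m+1)(m+1+h)$; compute $\tilde m$, $k$, $\alpha$ and the case; draw $m$ by the generator until it is accepted; form a uniform random word with $m+h$ letters $x$, $m$ letters $\bar x$ and $n+1-h-2m$ letters $z$; choose uniformly one of the $h$ cyclic rotations of this word all of whose nonempty prefixes have positive height; delete its first letter. Then: 1. $M=\lceil\tilde m\rceil\ge2$, $k\ge1$ and $0\le\alpha\le k-1$; for $0\le m\le\frac{n+1-h}2$, ${\cal R}G(m)>1$ if and only if $m<M$. 2. The generator returns $m$ with probability $B(m)/\sum_{i=0}^NB(i)$, and each $m\in\{0,\dots,N\}$ is accepted with probability $F(m)/\overline B(m)$ and rejected with probability $1-F(m)/\overline B(m)$. The value of $m$ that is finally accepted is drawn with probability $F_n^h(m)/F_n^h$, and the loop terminates almost surely. 3. $F_n^h(m)$ is the number of Motzkin left factors of size $n$ and final height $h-1$ with $m$ letters $\bar x$, and $F_n^h$ is the number of all those of size $n$ and final height $h-1$. The algorithm terminates almost surely and returns each of them with the same probability $1/F_n^h$.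 4. On a unit-cost random access machine (integer additions, subtractions, multiplications and comparisons, calls of $random$, array accesses, and, for the test of $h$ and the computation of $\tilde m,k,\alpha$ only, real arithmetic operations with square root and ceiling), the expected running time of the whole algorithm is at most $Cn$, with $C$ independent of $n$ and $h$. All integers that are computed have absolute value at most $2n^2$, and less than $n^2$ if $n\ge n_0$, with $n_0$ independent of $n$ and $h$ (the real numbers in the test of $h$ and the computation of $\tilde m,k,\alpha$ are not counted). -/

import Mathlib

open scoped ENNReal NNReal

namespace MotzkinGen

/-! ### Motzkin left factors -/

/-- The letters: `up` is the step `(1,1)`, `down` is `(1,-1)`, `level` is `(1,0)`. -/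
inductive Step
  | up
  | down
  | level
  deriving DecidableEq

/-- The vertical displacement of a letter. -/
def Step.rise : Step → ℤ
  | .up => 1
  | .down => -1
  | .level => 0

/-- The final height of a path that starts at height `0`. -/
def height (w : List Step) : ℤ := (w.map Step.rise).sum

/-- `w` is a Motzkin left factor of size `n` and final height `e`: a path of `n` steps that starts
at height `0`, never goes below height `0` and ends at height `e`. -/
def IsMotzkinLeftFactor (n : ℕ) (e : ℤ) (w : List Step) : Prop :=
  w.length = n ∧ (∀ p : List Step, p <+: w → 0 ≤ height p) ∧ height w = e

/-! ### The numbers `F`, `B`, `G` and the parameters -/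

/-- `F n h m` is `h / (n + 1)` times the trinomial coefficient
`(n+1)! / (m! (m+h)! (n+1-h-2m)!)`, which is `0` when `2m + h > n + 1`. -/
noncomputable def F (n h m : ℕ) : ℝ :=
  (h : ℝ) / (n + 1) * ((n + 1).choose m * (n + 1 - m).choose (m + h) : ℕ)

/-- The sum of all `F n h m`. -/
noncomputable def Ftot (n h : ℕ) : ℝ :=
  ∑ m ∈ Finset.range ((n + 1 - h) / 2 + 1), F n h m

/-- The first value of `m` that maximizes `F n h m`. -/
noncomputable def argM (n h : ℕ) : ℕ := sInf {m | ∀ j, F n h j ≤ F n h m}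

/-- The smaller root of `(n-h-2x)(n+1-h-2x) - (x+1)(x+1+h)`. -/
noncomputable def mTilde (n h : ℕ) : ℝ :=
  (4 * n + 4 - 3 * h - √(4 * n ^ 2 + 20 * n + 28 - 3 * h ^ 2)) / 6

noncomputable def parK (n h : ℕ) : ℤ := ⌈((n : ℝ) + 1 - h) / (2 * mTilde n h)⌉ - 1

noncomputable def parAlpha (n h : ℕ) : ℤ :=
  min (parK n h - 1) ⌊(parK n h : ℝ) - parK n h * (argM n h - mTilde n h)⌋

/-- The unmodified weight `k ^ ((k+1)M+α-m) * binom((k+1)M+α, m)`. -/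
noncomputable def Bund (M k α m : ℕ) : ℝ :=
  (k : ℝ) ^ ((k + 1) * M + α - m) * (((k + 1) * M + α).choose m : ℝ)

/-- The weight of the extended binomial generator, modified at `m = M`. -/
noncomputable def B (M k α m : ℕ) : ℝ :=
  if m = M then max (Bund M k α (M - 1)) (Bund M k α (M + 1)) else Bund M k α m

noncomputable def Btot (M k α : ℕ) : ℝ :=
  ∑ m ∈ Finset.range ((k + 1) * M + α + 1), B M k α m

/-- The weight `B` normalized so that its value at `M` is `F n h M`. -/
noncomputable def Bbar (n h M k α m : ℕ) : ℝ := B M k α m * (F n h M / B M k α M)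

noncomputable def G (n h M k α m : ℕ) : ℝ := F n h m / B M k α m

/-- The ratio of two consecutive terms of `G`. -/
noncomputable def RG (n h M k α m : ℕ) : ℝ := G n h M k α (m + 1) / G n h M k α m

/-! ### A probabilistic random access machine with unit cost

A computation started with the counters `c` ends with a given result and given counters with a
certain probability; the sum of these probabilities is the probability that it halts. The only
operations are the instructions below. Each of them costs one unit of time; each integer that is
computed is recorded in `maxInt`. -/

/-- The counters: the elapsed time, and the largest absolute value of an integer computed so far. -/
structure Counters where
  time : ℕ
  maxInt : ℕ

def RAM (β : Type) : Type := Counters → β × Counters → ℝ≥0∞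

open Classical in
noncomputable instance : Monad RAM where
  pure a := fun c o => if o = (a, c) then 1 else 0
  bind p g := fun c o => ∑' q, p c q * g q.1 q.2 o

/-- An undefined operation: the machine never delivers a result. -/
def crash {β : Type} : RAM β := fun _ _ => 0

/-- One unit of time; the result is not an integer. -/
noncomputable def unitOp {β : Type} (a : β) : RAM β :=
  fun c o => (pure a : RAM β) ⟨c.time + 1, c.maxInt⟩ o

/-- One unit of time; the result is the integer `z`. -/
noncomputable def intOp (z : ℤ) : RAM ℤ :=
  fun c o => (pure z : RAM ℤ) ⟨c.time + 1, max c.maxInt z.natAbs⟩ o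

/-! Integer instructions. -/

noncomputable def add (a b : ℤ) : RAM ℤ := intOp (a + b)
noncomputable def sub (a b : ℤ) : RAM ℤ := intOp (a - b)
noncomputable def mul (a b : ℤ) : RAM ℤ := intOp (a * b)
noncomputable def lt (a b : ℤ) : RAM Bool := unitOp (decide (a < b))
noncomputable def le (a b : ℤ) : RAM Bool := unitOp (decide (a ≤ b))
noncomputable def eq (a b : ℤ) : RAM Bool := unitOp (decide (a = b))

open Classical in
/-- A uniform random integer in `{0, …, k-1}`; undefined when `k ≤ 0`. -/
noncomputable def random (k : ℤ) : RAM ℤ := fun c o =>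
  if 0 ≤ o.1 ∧ o.1 < k ∧ o.2 = ⟨c.time + 1, max c.maxInt k.natAbs⟩ then (k.toNat : ℝ≥0∞)⁻¹ else 0

/-! Real (floating-point) instructions, used only before the main loop. -/

noncomputable def rofInt (a : ℤ) : RAM ℝ := unitOp (a : ℝ)
noncomputable def radd (x y : ℝ) : RAM ℝ := unitOp (x + y)
noncomputable def rsub (x y : ℝ) : RAM ℝ := unitOp (x - y)
noncomputable def rmul (x y : ℝ) : RAM ℝ := unitOp (x * y)
noncomputable def rdiv (x y : ℝ) : RAM ℝ := unitOp (x / y)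
noncomputable def rsqrt (x : ℝ) : RAM ℝ := unitOp √x
open Classical in
noncomputable def rle (x y : ℝ) : RAM Bool := unitOp (decide (x ≤ y))
noncomputable def rceil (x : ℝ) : RAM ℤ := intOp ⌈x⌉

/-! Arrays of letters, represented by the list of their entries: random access reading, and writing
at the first free place. -/

noncomputable def readAt (w : List Step) (i : ℤ) : RAM Step :=
  if 0 ≤ i then
    match w[i.toNat]? with
    | some s => unitOp s
    | none => crash
  else crash

noncomputable def push (w : List Step) (s : Step) : RAM (List Step) := unitOp (w ++ [s])

/-! Loops. -/

/-- At most `j` iterations of a loop; it delivers nothing when these do not suffice. -/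
noncomputable def loopN {σ β : Type} (body : σ → RAM (σ ⊕ β)) : ℕ → σ → RAM β
  | 0, _ => crash
  | j + 1, s => do
      unitOp ()
      let r ← body s
      match r with
      | .inl s' => loopN body j s'
      | .inr b => pure b

/-- Repeat `body`: with `inl s'` go on from the state `s'`, with `inr b` stop with result `b`. -/
noncomputable def loop {σ β : Type} (body : σ → RAM (σ ⊕ β)) (s : σ) : RAM β :=
  fun c o => ⨆ j, loopN body j s c o

noncomputable def forFrom {σ : Type} (body : ℤ → σ → RAM σ) : ℕ → ℤ → σ → RAM σ
  | 0, _, s => unitOp s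
  | j + 1, i, s => do
      unitOp ()
      let s' ← body i s
      let i' ← add i 1
      forFrom body j i' s'

/-- For all `i` in `[lo, hi]`, in increasing order, update the state by `body i`. -/
noncomputable def forLoop {σ : Type} (lo hi : ℤ) (s : σ) (body : ℤ → σ → RAM σ) : RAM σ :=
  forFrom body (hi + 1 - lo).toNat lo s

noncomputable def allFrom (test : ℤ → RAM Bool) : ℕ → ℤ → RAM Bool
  | 0, _ => unitOp true
  | j + 1, i => do
      unitOp ()
      let b ← test i
      if b then do
        let i' ← add i 1
        allFrom test j i'
      else pure false

/-- Run `test i` for all `i` in `[lo, hi]`, in increasing order; stop at the first failure. -/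
noncomputable def forAll (lo hi : ℤ) (test : ℤ → RAM Bool) : RAM Bool :=
  allFrom test (hi + 1 - lo).toNat lo

/-! Observables of a computation that starts with both counters at `0`. -/

/-- The probability that the computation halts with result `a`. -/
noncomputable def prob {β : Type} (p : RAM β) (a : β) : ℝ≥0∞ := ∑' c, p ⟨0, 0⟩ (a, c)

/-- The probability that the computation halts. -/
noncomputable def haltProb {β : Type} (p : RAM β) : ℝ≥0∞ := ∑' o, p ⟨0, 0⟩ o

/-- The expected running time, over the halting computations. -/
noncomputable def expTime {β : Type} (p : RAM β) : ℝ≥0∞ := ∑' o, p ⟨0, 0⟩ o * (o.2.time : ℝ≥0∞)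

/-- No computation that can occur computes an integer whose absolute value exceeds `W`. -/
def IntsAtMost {β : Type} (p : RAM β) (W : ℕ) : Prop := ∀ o, p ⟨0, 0⟩ o ≠ 0 → o.2.maxInt ≤ W

/-! ### The extended binomial generator -/

/-- Which of `B(M) = B(M+1)` (`plus`) and `B(M) = B(M-1)` (`minus`) is imposed. -/
inductive Which
  | plus
  | minus

def whichOf (M k α : ℤ) : Which :=
  if k ^ 2 * M * (M + 1) ≤ (k * M + α + 1) * (k * M + α) then .plus else .minus

noncomputable def extendedBin (M k α : ℤ) (which : Which) : RAM ℤ := do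
  let k1 ← add k 1
  let k1M ← mul k1 M
  let N ← add k1M α
  loop (fun _ : Unit => do
    let m ← forLoop 1 N (0 : ℤ) (fun _ m => do
      let v ← random k1
      let b ← eq v 0
      if b then add m 1 else pure m)
    let b ← eq m M
    if b then
      match which with
      | .plus => do
          let M1 ← add M 1
          let r ← mul k M1
          let v ← random r
          let kM ← mul k M
          let u ← add kM α
          let rej ← le u v
          pure (if rej then .inl () else .inr m)
      | .minus => do
          let kM ← mul k M
          let u ← add kM α
          let u1 ← add u 1
          let v ← random u1
          let rej ← le kM v
          pure (if rej then .inl () else .inr m)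
    else pure (.inr m)) ()

/-! ### The acceptance tests -/

/-- `random(p) < q`. -/
noncomputable def flip (p q : ℤ) : RAM Bool := do
  let v ← random p
  lt v q

/-- `(n+1-h-2i)(n-h-2i)`. -/
noncomputable def numF (n h i : ℤ) : RAM ℤ := do
  let t ← mul 2 i
  let d ← sub n h
  let e ← sub d t
  let e1 ← add e 1
  mul e1 e

/-- `(i+1)(i+1+h)`. -/
noncomputable def denF (h i : ℤ) : RAM ℤ := do
  let i1 ← add i 1
  let ih ← add i1 h
  mul i1 ih

/-- `(i+1+h)((k+1)M+α-i)`. -/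
noncomputable def denG (h M k α i : ℤ) : RAM ℤ := do
  let i1 ← add i 1
  let ih ← add i1 h
  let k1 ← add k 1
  let k1M ← mul k1 M
  let N ← add k1M α
  let r ← sub N i
  mul ih r

/-- The test for `i = M - 1`. -/
noncomputable def testBelow (n h M k α : ℤ) : Which → RAM Bool
  | .plus => do
      let M1 ← add M 1
      let p ← mul k M1
      let kM ← mul k M
      let u ← add kM α
      let u1 ← add u 1
      let b ← flip p u1
      if b then do
        let Mp ← sub M 1
        let nf ← numF n h Mp
        let p' ← mul k nf
        let Mh ← add M h
        let q' ← mul Mh u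
        flip p' q'
      else pure false
  | .minus => do
      let Mp ← sub M 1
      let p ← numF n h Mp
      let q ← denF h Mp
      flip p q

/-- The test for `i = M`. -/
noncomputable def testAbove (n h M k α : ℤ) : Which → RAM Bool
  | .minus => do
      let kM ← mul k M
      let u ← add kM α
      let b ← flip u kM
      if b then do
        let Mh ← add M h
        let Mh1 ← add Mh 1
        let u1 ← add u 1
        let p' ← mul Mh1 u1
        let nf ← numF n h M
        let q' ← mul k nf
        flip p' q'
      else pure false
  | .plus => do
      let p ← denF h M
      let q ← numF n h M
      flip p q

noncomputable def acceptM (n h M k α : ℤ) (which : Which) (m : ℤ) : RAM Bool := do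
  let t ← mul 2 m
  let d ← sub n h
  let d1 ← add d 1
  let big ← lt d1 t
  if big then pure false
  else do
    let below ← lt m M
    if below then do
      let b ← testBelow n h M k α which
      if b then do
        let hi ← sub M 2
        forAll m hi (fun i => do
          let nf ← numF n h i
          let p ← mul k nf
          let q ← denG h M k α i
          flip p q)
      else pure false
    else do
      let above ← lt M m
      if above then do
        let b ← testAbove n h M k α which
        if b then do
          let lo ← add M 1
          let hi ← sub m 1
          forAll lo hi (fun i => do
            let p ← denG h M k α i
            let nf ← numF n h i
            let q ← mul k nf
            flip p q)
        else pure false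
      else pure true

/-! ### The choice of `m` -/

/-- Scan `m = 0, 1, …` until the ratio of `F` at `m` is at most `1`. -/
noncomputable def computeM (n h : ℤ) : RAM ℤ :=
  loop (fun m => do
    let p ← numF n h m
    let q ← denF h m
    let done ← le p q
    if done then pure (.inr m)
    else do
      let m' ← add m 1
      pure (.inl m')) 0

/-- `(4n+4-3h-√(4n²+20n+28-3h²))/6`. -/
noncomputable def computeTilde (n h : ℤ) : RAM ℝ := do
  let x ← rofInt n
  let y ← rofInt h
  let fx ← rmul 4 x
  let ty ← rmul 3 y
  let fxx ← rmul fx x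
  let wx ← rmul 20 x
  let tyy ← rmul ty y
  let a ← radd fxx wx
  let b ← radd a 28
  let D ← rsub b tyy
  let s ← rsqrt D
  let u ← radd fx 4
  let v ← rsub u ty
  let z ← rsub v s
  rdiv z 6

/-- `⌈(n+1-h)/(2t)⌉ - 1`. -/
noncomputable def computeK (n h : ℤ) (t : ℝ) : RAM ℤ := do
  let x ← rofInt n
  let y ← rofInt h
  let x1 ← radd x 1
  let d ← rsub x1 y
  let tt ← rmul 2 t
  let q ← rdiv d tt
  let c ← rceil q
  sub c 1

/-- `min (k-1) (k-⌈k(M-t)⌉)`. -/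
noncomputable def computeAlpha (M k : ℤ) (t : ℝ) : RAM ℤ := do
  let kr ← rofInt k
  let Mr ← rofInt M
  let d ← rsub Mr t
  let e ← rmul kr d
  let c ← rceil e
  let a ← sub k c
  let k' ← sub k 1
  let b ← le a k'
  pure (if b then a else k')

noncomputable def computeWhich (M k α : ℤ) : RAM Which := do
  let kM ← mul k M
  let u ← add kM α
  let u1 ← add u 1
  let lhs ← mul u1 u
  let M1 ← add M 1
  let kM1 ← mul k M1
  let rhs ← mul kM kM1
  let b ← le rhs lhs
  pure (if b then .plus else .minus)

/-- Compute the parameters, then draw `m` and test it until it is accepted. -/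
noncomputable def chooseM (n h : ℤ) : RAM ℤ := do
  let M ← computeM n h
  let t ← computeTilde n h
  let k ← computeK n h t
  let α ← computeAlpha M k t
  let which ← computeWhich M k α
  loop (fun _ : Unit => do
    let m ← extendedBin M k α which
    let b ← acceptM n h M k α which m
    pure (if b then .inr m else .inl ())) ()

/-! ### From `m` to the path, by the cycle lemma -/

/-- A random word with `a` letters `up`, `b` letters `down` and `c` letters `level`. -/
noncomputable def mix (a b c : ℤ) : RAM (List Step) := do
  let ab ← add a b
  let L ← add ab c
  let r ← forLoop 1 L (([] : List Step), a, b, c) (fun _ s => do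
    let ab ← add s.2.1 s.2.2.1
    let abc ← add ab s.2.2.2
    let v ← random abc
    let isUp ← lt v s.2.1
    if isUp then do
      let w ← push s.1 .up
      let a' ← sub s.2.1 1
      pure (w, a', s.2.2.1, s.2.2.2)
    else do
      let isDown ← lt v ab
      if isDown then do
        let w ← push s.1 .down
        let b' ← sub s.2.2.1 1
        pure (w, s.2.1, b', s.2.2.2)
      else do
        let w ← push s.1 .level
        let c' ← sub s.2.2.2 1
        pure (w, s.2.1, s.2.2.1, c'))
  pure r.1

/-- The height after the letter `s` from the height `y`. -/
noncomputable def move (y : ℤ) : Step → RAM ℤ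
  | .up => add y 1
  | .down => sub y 1
  | .level => pure y

/-- The smallest height reached by the word `w` of length `n + 1`. -/
noncomputable def minHeight (n : ℤ) (w : List Step) : RAM ℤ := do
  let r ← forLoop 0 n ((0 : ℤ), (0 : ℤ)) (fun i s => do
    let x ← readAt w i
    let y ← move s.1 x
    let b ← lt y s.2
    pure (y, if b then y else s.2))
  pure r.2

/-- The last position where the word `w` of length `n + 1` has height `e`. -/
noncomputable def lastVisit (n : ℤ) (w : List Step) (e : ℤ) : RAM ℤ := do
  let r ← forLoop 0 n ((0 : ℤ), (0 : ℤ)) (fun i s => do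
    let x ← readAt w i
    let y ← move s.1 x
    let b ← eq y e
    let i' ← add i 1
    pure (y, if b then i' else s.2))
  pure r.2

/-- The `n` letters that follow, cyclically, the letter at position `p` of `w`. -/
noncomputable def cyclicTail (n : ℤ) (w : List Step) (p : ℤ) : RAM (List Step) :=
  forLoop 1 n ([] : List Step) (fun i out => do
    let j ← add p i
    let inside ← le j n
    if inside then do
      let x ← readAt w j
      push out x
    else do
      let n1 ← add n 1
      let j' ← sub j n1
      let x ← readAt w j'
      push out x)

/-- Mix `m + h` letters `up`, `m` letters `down` and `n+1-h-2m` letters `level`; choose uniformly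
one of the `h` cyclic rotations of this word all of whose nonempty prefixes have positive height;
remove its first letter. -/
noncomputable def finish (n h m : ℤ) : RAM (List Step) := do
  let a ← add m h
  let am ← add a m
  let n1 ← add n 1
  let c ← sub n1 am
  let w ← mix a m c
  let low ← minHeight n w
  let j ← random h
  let e ← add low j
  let p ← lastVisit n w e
  cyclicTail n w p

/-- `h ≥ n - 1/2 - √(8n+9)/2`. -/
noncomputable def tooBig (n h : ℤ) : RAM Bool := do
  let x ← rofInt n
  let y ← rofInt h
  let ex ← rmul 8 x
  let D ← radd ex 9
  let s ← rsqrt D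
  let s2 ← rdiv s 2
  let half ← rdiv 1 2
  let u ← rsub x half
  let v ← rsub u s2
  rle v y

/-- The whole algorithm; the result `none` means that it fails because `h` is too big. -/
noncomputable def motzkin (n h : ℤ) : RAM (Option (List Step)) := do
  let big ← tooBig n h
  if big then pure none
  else do
    let m ← chooseM n h
    let w ← finish n h m
    pure (some w)

end MotzkinGen

/-!
The proof rests on a small calculus for the machine. `Law p X` states that `X` is the law of the
result of `p`, as an expectation functional; it composes along `bind` (`Law.bind`), and for a loop
with independent, identically distributed iterations it is a geometric series (`law_loop`).
`Spec W p T Q` states that the results satisfy `Q`, that the integers are bounded by `W` and that the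
expected time is at most `T`; for such a loop the time is that of one iteration divided by the
probability of stopping (`Spec.loop`).

*Parameters.* Write `t` for `mTilde n h`, `P x = (n+1-h-2x) (n-h-2x)`, `N = (k+1) M + α` and
`Q x = (x+1+h) (N-x)`. The ratio `F (m+1) / F m` is `P m / ((m+1) (m+1+h))`, and `t` is the zero of
`P x - (x+1) (x+1+h)`, so `F` increases up to `M = ⌈t⌉` and decreases afterwards. The ratio of `F` to
the binomial weights has the ratio `k P m / Q m` of consecutive terms. The choice of `k` and `α` makes
`kM + α` differ from `k (t+1)` by at most `1`, and this forces the concave quadratic `Q - k P` to be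
negative at `M - 2` and nonnegative at `M + 1` and at the end of the support (`defect_below`,
`defect_above`, `defect_end`). By concavity it is negative on `[0, M-2]` and nonnegative from `M + 1`
on. With the modified weight at `M`, this says that `G` increases strictly up to `M` and decreases
afterwards (`G_lt_succ`, `G_succ_le`), so every acceptance test is a legitimate one, and their product
telescopes to `G m / G M` (`bern_acceptM`). Rejection sampling then turns the law `B` of the generator
(`law_extendedBin`) into a law proportional to `F` (`law_chooseM`).

*Paths.* For a word with `m + h` letters `up` and `m` letters `down`, the rotation at a position `p` is
positive iff `p` is the last visit to one of the `h` lowest heights `low, …, low + h - 1`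
(`isPositive_rotate_iff`). Hence the pairs of a word and one of these heights correspond to the pairs
of a positive word and a position (`sum_cycle`). Deleting the first letter of a positive word gives a
left factor, so the output is uniform and `F n h m` counts left factors (`law_finish`, `F_eq_card`).

*Time.* All loops have length `O(n)`, so it remains to bound from below the probability `accProb` that
one round yields an accepted value. By Chebyshev's inequality the mode of the binomial law has a mass
of order at least `1 / √M` (`pow_le_Bund`), while `F` stays above a quarter of its maximum on an
interval of length of order `√M` to the left of `M` (`quarter_le_F`). Together they bound `accProb`
below by a constant (`accProb_ge`).

*Integers.* With `d = n + 1 - h`, all integers are at most `n (n-1)`, `k P 0 = k d (d-1)` or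
`kM · k (M+1)` (`Fits`). As `k < d / (2t)`, the second is bounded through a polynomial inequality in `t`
and `d - 2 t` (`quintic_bound`, `quintic_bound_of_two_mul_lt`).
-/

namespace MotzkinGen

/-! ### Expectations over the outcomes of a computation -/

section Calculus

variable {β γ σ : Type}

/-- The expectation of `f` over the outcomes (result and final counters) of the computation `p`
started with the counters `c`; computations that do not halt contribute `0`. -/
noncomputable def ev (p : RAM β) (c : Counters) (f : β × Counters → ℝ≥0∞) : ℝ≥0∞ :=
  ∑' o, p c o * f o

theorem ev_bind (p : RAM β) (g : β → RAM γ) (c : Counters) (f : γ × Counters → ℝ≥0∞) :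
    ev (p >>= g) c f = ev p c fun q => ev (g q.1) q.2 f := by
  show ∑' o, (∑' q, p c q * g q.1 q.2 o) * f o = ∑' q, p c q * ∑' o, g q.1 q.2 o * f o
  simp_rw [← ENNReal.tsum_mul_right, ← ENNReal.tsum_mul_left]
  rw [ENNReal.tsum_comm]
  simp_rw [mul_assoc]

open Classical in
@[simp] theorem ev_pure (a : β) (c : Counters) (f : β × Counters → ℝ≥0∞) :
    ev (pure a : RAM β) c f = f (a, c) := by
  show ∑' o, (if o = (a, c) then (1 : ℝ≥0∞) else 0) * f o = f (a, c)
  rw [tsum_eq_single (a, c)]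
  · simp
  · intro o ho
    simp [ho]

@[simp] theorem ev_crash (c : Counters) (f : β × Counters → ℝ≥0∞) :
    ev (crash : RAM β) c f = 0 := by
  simp [ev, crash]

@[simp] theorem ev_unitOp (a : β) (c : Counters) (f : β × Counters → ℝ≥0∞) :
    ev (unitOp a) c f = f (a, ⟨c.time + 1, c.maxInt⟩) :=
  ev_pure a ⟨c.time + 1, c.maxInt⟩ f

@[simp] theorem ev_intOp (z : ℤ) (c : Counters) (f : ℤ × Counters → ℝ≥0∞) :
    ev (intOp z) c f = f (z, ⟨c.time + 1, max c.maxInt z.natAbs⟩) :=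
  ev_pure z ⟨c.time + 1, max c.maxInt z.natAbs⟩ f

theorem ev_random (k : ℕ) (c : Counters) (f : ℤ × Counters → ℝ≥0∞) :
    ev (random k) c f =
      (k : ℝ≥0∞)⁻¹ * ∑ v ∈ Finset.range k, f ((v : ℤ), ⟨c.time + 1, max c.maxInt k⟩) := by
  classical
  set d : Counters := ⟨c.time + 1, max c.maxInt k⟩
  have hinj : Function.Injective fun v : ℕ => (((v : ℤ), d) : ℤ × Counters) := by
    intro a b hab
    simpa using hab
  unfold ev
  rw [tsum_eq_sum (s := (Finset.range k).image fun v : ℕ => (((v : ℤ), d) : ℤ × Counters)),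
    Finset.sum_image (fun a _ b _ hab => hinj hab), Finset.mul_sum]
  · refine Finset.sum_congr rfl fun v hv => ?_
    have hv' : (v : ℤ) < k := by exact_mod_cast Finset.mem_range.1 hv
    simp [random, hv', d]
  · rintro ⟨z, e⟩ ho
    have : ¬(0 ≤ z ∧ z < k ∧ e = d) := by
      rintro ⟨h0, h1, rfl⟩
      exact ho (Finset.mem_image.2 ⟨z.toNat, Finset.mem_range.2 (by omega), by simp [h0]⟩)
    have h2 : random k c (z, e) = 0 := by
      simp only [random, Int.natAbs_natCast]
      exact if_neg this
    rw [h2, zero_mul]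

theorem ev_congr {p : RAM β} {c : Counters} {f g : β × Counters → ℝ≥0∞}
    (h : ∀ o, p c o ≠ 0 → f o = g o) : ev p c f = ev p c g := by
  refine tsum_congr fun o => ?_
  by_cases ho : p c o = 0
  · simp [ho]
  · rw [h o ho]

theorem ev_mono {p : RAM β} {c : Counters} {f g : β × Counters → ℝ≥0∞}
    (h : ∀ o, p c o ≠ 0 → f o ≤ g o) : ev p c f ≤ ev p c g := by
  refine ENNReal.tsum_le_tsum fun o => ?_
  by_cases ho : p c o = 0
  · simp [ho]
  · exact mul_le_mul_right (h o ho) _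

theorem ev_add (p : RAM β) (c : Counters) (f g : β × Counters → ℝ≥0∞) :
    ev p c (fun o => f o + g o) = ev p c f + ev p c g := by
  simp [ev, mul_add, ENNReal.tsum_add]

/-- An outcome of a sequential composition passes through an outcome of its first part. -/
theorem exists_of_bind_ne_zero {p : RAM β} {g : β → RAM γ} {c : Counters} {o : γ × Counters}
    (h : (p >>= g) c o ≠ 0) : ∃ q, p c q ≠ 0 ∧ g q.1 q.2 o ≠ 0 := by
  by_contra! hc
  refine h ?_
  show ∑' q, p c q * g q.1 q.2 o = 0
  rw [ENNReal.tsum_eq_zero]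
  intro q
  by_cases hq : p c q = 0
  · simp [hq]
  · simp [hc q hq]

theorem eq_of_pure_ne_zero {a : β} {c : Counters} {o : β × Counters}
    (h : (pure a : RAM β) c o ≠ 0) : o = (a, c) := by
  by_contra hc
  exact h (if_neg hc)

/-! ### The law of the result -/

/-- `X` is the law of the result of `p`, as an expectation functional; the law does not depend on
the initial counters. -/
def Law (p : RAM β) (X : (β → ℝ≥0∞) → ℝ≥0∞) : Prop :=
  ∀ c f, ev p c (fun o => f o.1) = X f

/-- The computation `p` halts almost surely with result `a`. -/
def Returns (p : RAM β) (a : β) : Prop := Law p fun f => f a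

theorem Law.congr {p : RAM β} {X Y : (β → ℝ≥0∞) → ℝ≥0∞} (h : Law p X) (hXY : ∀ f, X f = Y f) :
    Law p Y := fun c f => (h c f).trans (hXY f)

theorem Law.bind {p : RAM β} {g : β → RAM γ} {X : (β → ℝ≥0∞) → ℝ≥0∞}
    {Y : β → (γ → ℝ≥0∞) → ℝ≥0∞} (hp : Law p X) (hg : ∀ a, Law (g a) (Y a)) :
    Law (p >>= g) fun f => X fun a => Y a f := by
  intro c f
  rw [ev_bind]
  simp_rw [hg _ _ f]
  exact hp c fun a => Y a f

/-- An event that is null under the law does not occur. -/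
theorem Law.post {p : RAM β} {X : (β → ℝ≥0∞) → ℝ≥0∞} (h : Law p X) {Q : β → Prop}
    [DecidablePred Q] (hQ : X (fun b => if Q b then 0 else 1) = 0) (c : Counters)
    (o : β × Counters) (ho : p c o ≠ 0) : Q o.1 := by
  have h1 := h c fun b => if Q b then 0 else 1
  rw [hQ] at h1
  simp only [ev, ENNReal.tsum_eq_zero, mul_eq_zero] at h1
  by_contra hne
  rcases h1 o with h | h
  · exact ho h
  · simp [hne] at h

/-- Composition when the law of the first part is a finite weighted sum of point masses. -/
theorem Law.bind_sum {ι : Type} {s : Finset ι} {r : ι → ℝ≥0∞} {φ : ι → β} {p : RAM β}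
    {g : β → RAM γ} {Y : ι → (γ → ℝ≥0∞) → ℝ≥0∞}
    (hp : Law p fun f => ∑ i ∈ s, r i * f (φ i)) (hg : ∀ i ∈ s, Law (g (φ i)) (Y i)) :
    Law (p >>= g) fun f => ∑ i ∈ s, r i * Y i f := by
  classical
  intro c f
  rw [ev_bind]
  have hs : ∀ o, p c o ≠ 0 → ∃ i ∈ s, o.1 = φ i := by
    refine hp.post (Q := fun b => ∃ i ∈ s, b = φ i) ?_ c
    exact Finset.sum_eq_zero fun i hi => by
      simp only [if_pos (⟨i, hi, rfl⟩ : ∃ j ∈ s, φ i = φ j), mul_zero]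
  rw [ev_congr (g := fun o => ev (g o.1) ⟨0, 0⟩ fun o => f o.1), hp c fun b =>
    ev (g b) ⟨0, 0⟩ fun o => f o.1]
  · exact Finset.sum_congr rfl fun i hi => by simp only [hg i hi _ f]
  · intro o ho
    obtain ⟨i, hi, h⟩ := hs o ho
    rw [h, hg i hi _ f, hg i hi _ f]

theorem Returns.congr {p : RAM β} {a b : β} (h : Returns p a) (hab : a = b) :
    Returns p b := hab ▸ h

theorem Returns.bind {p : RAM β} {g : β → RAM γ} {a : β} {Y : (γ → ℝ≥0∞) → ℝ≥0∞}
    (hp : Returns p a) (hg : Law (g a) Y) : Law (p >>= g) Y := by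
  have hp' : Law p fun f => ∑ i ∈ ({a} : Finset β), 1 * f i :=
    Law.congr hp fun f => by simp
  refine (hp'.bind_sum (Y := fun _ => Y) fun i hi => ?_).congr fun f => by simp
  rwa [Finset.mem_singleton.1 hi]

theorem law_pure (a : β) : Returns (pure a : RAM β) a := fun c _ => ev_pure a c _

theorem law_unitOp (a : β) : Returns (unitOp a) a := fun c _ => ev_unitOp a c _

theorem law_intOp (z : ℤ) : Returns (intOp z) z := fun c _ => ev_intOp z c _

theorem law_add (a b : ℤ) : Returns (add a b) (a + b) := law_intOp _
theorem law_sub (a b : ℤ) : Returns (sub a b) (a - b) := law_intOp _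
theorem law_mul (a b : ℤ) : Returns (mul a b) (a * b) := law_intOp _
theorem law_lt (a b : ℤ) : Returns (lt a b) (decide (a < b)) := law_unitOp _
theorem law_le (a b : ℤ) : Returns (le a b) (decide (a ≤ b)) := law_unitOp _
theorem law_eq (a b : ℤ) : Returns (eq a b) (decide (a = b)) := law_unitOp _
theorem law_rofInt (a : ℤ) : Returns (rofInt a) (a : ℝ) := law_unitOp _
theorem law_radd (a b : ℝ) : Returns (radd a b) (a + b) := law_unitOp _
theorem law_rsub (a b : ℝ) : Returns (rsub a b) (a - b) := law_unitOp _
theorem law_rmul (a b : ℝ) : Returns (rmul a b) (a * b) := law_unitOp _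
theorem law_rdiv (a b : ℝ) : Returns (rdiv a b) (a / b) := law_unitOp _
theorem law_rsqrt (a : ℝ) : Returns (rsqrt a) √a := law_unitOp _
theorem law_rceil (a : ℝ) : Returns (rceil a) ⌈a⌉ := law_intOp _
open Classical in
theorem law_rle (a b : ℝ) : Returns (rle a b) (decide (a ≤ b)) := law_unitOp _
theorem law_push (w : List Step) (s : Step) : Returns (push w s) (w ++ [s]) := law_unitOp _

theorem law_random (k : ℕ) :
    Law (random k) fun f => (k : ℝ≥0∞)⁻¹ * ∑ v ∈ Finset.range k, f (v : ℤ) :=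
  fun c f => ev_random k c fun o => f o.1

theorem law_readAt (w : List Step) (i : ℕ) (hi : i < w.length) : Returns (readAt w i) w[i] := by
  unfold readAt
  simpa [hi] using law_unitOp _

/-- A `for` loop whose body is deterministic and runs through the states `S i`. -/
theorem law_forFrom {body : ℤ → σ → RAM σ} (S : ℕ → σ) :
    ∀ j i : ℕ, (∀ l, i ≤ l → l < i + j → Returns (body l (S l)) (S (l + 1))) →
      Returns (forFrom body j i (S i)) (S (i + j)) := by
  intro j
  induction j with
  | zero => exact fun i _ => law_unitOp _
  | succ j ih =>
    intro i h
    unfold forFrom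
    refine (law_unitOp ()).bind ((h i le_rfl (by omega)).bind ((law_add _ _).bind ?_))
    have := ih (i + 1) fun l h1 h2 => h l (by omega) (by omega)
    rw [show i + (j + 1) = i + 1 + j by ring]
    exact_mod_cast this

/-- The probability of a result, and the probability of halting, in terms of the law. -/
theorem Law.prob_eq [DecidableEq β] {p : RAM β} {X : (β → ℝ≥0∞) → ℝ≥0∞} (h : Law p X) (a : β) :
    prob p a = X fun b => if b = a then 1 else 0 := by
  rw [← h ⟨0, 0⟩]
  unfold prob ev
  rw [ENNReal.tsum_prod', tsum_eq_single a]
  · simp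
  · intro b hb
    simp [hb]

theorem Law.haltProb_eq {p : RAM β} {X : (β → ℝ≥0∞) → ℝ≥0∞} (h : Law p X) :
    haltProb p = X fun _ => 1 := by
  rw [← h ⟨0, 0⟩]
  simp [haltProb, ev]

/-! ### Loops -/

theorem loopN_mono (body : σ → RAM (σ ⊕ β)) (j : ℕ) :
    ∀ s c o, loopN body j s c o ≤ loopN body (j + 1) s c o := by
  induction j with
  | zero => intro s c o; simp [loopN, crash]
  | succ j ih =>
    intro s c o
    rw [loopN, loopN]
    refine ENNReal.tsum_le_tsum fun q => mul_le_mul_right ?_ _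
    refine ENNReal.tsum_le_tsum fun r => mul_le_mul_right ?_ _
    rcases r with ⟨r | r, d⟩
    · exact ih _ _ _
    · exact le_rfl

/-- Monotone convergence for loops. -/
theorem ev_loop (body : σ → RAM (σ ⊕ β)) (s : σ) (c : Counters) (f : β × Counters → ℝ≥0∞) :
    ev (loop body s) c f = ⨆ j, ev (loopN body j s) c f := by
  have hm : ∀ o, Monotone fun j => loopN body j s c o := fun o =>
    monotone_nat_of_le_succ fun j => loopN_mono body j s c o
  unfold ev loop
  simp_rw [ENNReal.iSup_mul]
  rw [ENNReal.tsum_eq_iSup_sum]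
  simp_rw [ENNReal.tsum_eq_iSup_sum]
  rw [iSup_comm]
  congr 1
  ext t
  rw [ENNReal.finsetSum_iSup_of_monotone]
  intro o i j hij
  exact mul_le_mul_left (hm o hij) _

theorem exists_of_loop_ne_zero {body : σ → RAM (σ ⊕ β)} {s : σ} {c : Counters}
    {o : β × Counters} (h : loop body s c o ≠ 0) : ∃ j, loopN body j s c o ≠ 0 := by
  by_contra! hc
  exact h (by simp [loop, hc])

theorem ev_loopN_succ (body : σ → RAM (σ ⊕ β)) (j : ℕ) (s : σ) (c : Counters)
    (f : β × Counters → ℝ≥0∞) :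
    ev (loopN body (j + 1) s) c f = ev (body s) ⟨c.time + 1, c.maxInt⟩ fun q =>
      Sum.elim (fun s' => ev (loopN body j s') q.2 f) (fun b => f (b, q.2)) q.1 := by
  rw [loopN, ev_bind, ev_unitOp, ev_bind]
  congr 1
  ext ⟨r | r, d⟩
  · rfl
  · exact ev_pure r d f

/-- A loop whose iterations are independent and identically distributed: `a` is the probability of
going on, and `Y` is the (unnormalized) law of the results of one iteration. -/
theorem law_loop {body : Unit → RAM (Unit ⊕ β)} {a : ℝ≥0∞} {Y : (β → ℝ≥0∞) → ℝ≥0∞}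
    (h : Law (body ()) fun f => a * f (.inl ()) + Y fun b => f (.inr b)) :
    Law (loop body ()) fun f => (1 - a)⁻¹ * Y f := by
  intro c f
  have key : ∀ j c, ev (loopN body j ()) c (fun o => f o.1) =
      (∑ i ∈ Finset.range j, a ^ i) * Y f := by
    intro j
    induction j with
    | zero => intro c; simp [loopN]
    | succ j ih =>
      intro c
      rw [ev_loopN_succ]
      have := h ⟨c.time + 1, c.maxInt⟩
        (Sum.elim (fun _ => (∑ i ∈ Finset.range j, a ^ i) * Y f) f)
      simp only [Sum.elim_inl, Sum.elim_inr] at this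
      rw [Finset.sum_range_succ', add_mul, pow_zero, one_mul]
      simp_rw [pow_succ, ← Finset.sum_mul]
      rw [mul_comm _ a, mul_assoc, ← this]
      congr 1
      ext ⟨r | r, d⟩
      · exact ih d
      · rfl
  rw [ev_loop]
  simp_rw [key]
  rw [← ENNReal.iSup_mul, ← ENNReal.tsum_eq_iSup_nat, ENNReal.tsum_geometric]

/-- A loop that runs deterministically through the states `i, i + 1, …` until `j`. -/
theorem law_loop_search {body : ℤ → RAM (ℤ ⊕ ℤ)} (j : ℕ)
    (hstep : ∀ i : ℕ, i < j → Returns (body i) (.inl ((i : ℤ) + 1)))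
    (hend : Returns (body j) (.inr (j : ℤ))) : Returns (loop body 0) (j : ℤ) := by
  have key : ∀ l i : ℕ, i + l = j → ∀ N c (f : ℤ → ℝ≥0∞),
      ev (loopN body N i) c (fun o => f o.1) = if l < N then f (j : ℤ) else 0 := by
    intro l
    induction l with
    | zero =>
      rintro i rfl N c f
      cases N with
      | zero => simp [loopN]
      | succ N =>
        rw [ev_loopN_succ]
        have := (hend.bind (g := fun r => (Sum.elim (fun s' => loopN body N s')
          (fun b => pure b) r)) (law_pure _)) ⟨c.time + 1, c.maxInt⟩ f
        rw [ev_bind] at this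
        simp only [Nat.add_zero, Nat.zero_lt_succ, if_true]
        refine Eq.trans ?_ this
        congr 1
        ext ⟨r | r, d⟩
        · rfl
        · simp
    | succ l ih =>
      intro i hi N c f
      cases N with
      | zero => simp [loopN]
      | succ N =>
        rw [ev_loopN_succ]
        have h2 : Law (loopN body N ((i : ℤ) + 1)) fun f => if l < N then f (j : ℤ) else 0 := by
          intro c f
          exact_mod_cast ih (i + 1) (by omega) N c f
        have := ((hstep i (by omega)).bind (g := fun r => (Sum.elim (fun s' => loopN body N s')
          (fun b => pure b) r)) h2) ⟨c.time + 1, c.maxInt⟩ f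
        rw [ev_bind] at this
        simp only [Nat.add_lt_add_iff_right]
        refine Eq.trans ?_ this
        congr 1
        ext ⟨r | r, d⟩
        · rfl
        · simp
  intro c f
  rw [ev_loop]
  have h0 := key j 0 (by omega)
  simp only [Nat.cast_zero] at h0
  simp_rw [h0]
  refine le_antisymm (iSup_le fun N => by split_ifs <;> simp) ?_
  exact le_iSup_of_le (j + 1) (by simp)

/-! ### Expected time and size of the integers -/

/-- Every outcome of `p` satisfies `Q`, the integers computed by `p` are bounded by `W`, and the
expected running time of `p` is at most `T`. The offset `x` makes the last clause compositional: the
time spent before `p` counts only on the computations that halt, and these may have a total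
probability less than one. -/
structure Spec (W : ℕ) (p : RAM β) (T : ℝ≥0∞) (Q : β → Prop) : Prop where
  post : ∀ c o, p c o ≠ 0 → Q o.1
  ints : ∀ c o, p c o ≠ 0 → c.maxInt ≤ W → o.2.maxInt ≤ W
  cost : ∀ c (x : ℝ≥0∞), ev p c (fun o => o.2.time + x) ≤ c.time + x + T

variable {W : ℕ} {T T' : ℝ≥0∞}

theorem Spec.mono {p : RAM β} {Q Q' : β → Prop} (h : Spec W p T Q) (hT : T ≤ T')
    (hQ : ∀ a, Q a → Q' a) : Spec W p T' Q' where
  post c o ho := hQ _ (h.post c o ho)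
  ints := h.ints
  cost c x := (h.cost c x).trans (by gcongr)

theorem Spec.bind {p : RAM β} {g : β → RAM γ} {Q : β → Prop} {R : γ → Prop}
    (hp : Spec W p T Q) (hg : ∀ a, Q a → Spec W (g a) T' R) :
    Spec W (p >>= g) (T + T') R where
  post c o ho := by
    obtain ⟨q, h1, h2⟩ := exists_of_bind_ne_zero ho
    exact (hg q.1 (hp.post c q h1)).post _ _ h2
  ints c o ho hc := by
    obtain ⟨q, h1, h2⟩ := exists_of_bind_ne_zero ho
    exact (hg q.1 (hp.post c q h1)).ints _ _ h2 (hp.ints c q h1 hc)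
  cost c x := by
    rw [ev_bind]
    calc _ ≤ ev p c (fun q => q.2.time + (x + T')) := by
          refine ev_mono fun q hq => ?_
          rw [← add_assoc]
          exact (hg q.1 (hp.post c q hq)).cost _ _
      _ ≤ c.time + (x + T') + T := hp.cost c _
      _ = c.time + x + (T + T') := by ring

theorem Spec.pure {a : β} {Q : β → Prop} (h : Q a) : Spec W (pure a : RAM β) 0 Q where
  post c o ho := by rw [eq_of_pure_ne_zero ho]; exact h
  ints c o ho hc := by rw [eq_of_pure_ne_zero ho]; exact hc
  cost c x := by simp

theorem Spec.unitOp (a : β) : Spec W (unitOp a) 1 (· = a) where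
  post c o ho := by rw [eq_of_pure_ne_zero (c := ⟨_, _⟩) ho]
  ints c o ho hc := by rw [eq_of_pure_ne_zero (c := ⟨_, _⟩) ho]; exact hc
  cost c x := by
    simp only [ev_unitOp, Nat.cast_add, Nat.cast_one]
    exact le_of_eq (by ring)

theorem Spec.intOp {z : ℤ} (hz : |z| ≤ W) : Spec W (intOp z) 1 (· = z) where
  post c o ho := by rw [eq_of_pure_ne_zero (c := ⟨_, _⟩) ho]
  ints c o ho hc := by
    rw [eq_of_pure_ne_zero (c := ⟨_, _⟩) ho]
    rw [Int.abs_eq_natAbs] at hz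
    exact max_le hc (by omega)
  cost c x := by
    simp only [ev_intOp, Nat.cast_add, Nat.cast_one]
    exact le_of_eq (by ring)

theorem Spec.crash {Q : β → Prop} : Spec W (crash : RAM β) 0 Q where
  post _ _ ho := absurd rfl ho
  ints _ _ ho := absurd rfl ho
  cost c x := by simp

theorem Spec.random {k : ℤ} (hk : |k| ≤ W) :
    Spec W (random k) 1 (fun v => 0 ≤ v ∧ v < k) where
  post c o ho := by
    by_contra hc
    exact ho (if_neg fun h => hc ⟨h.1, h.2.1⟩)
  ints c o ho hc := by
    have : o.2 = ⟨c.time + 1, max c.maxInt k.natAbs⟩ := by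
      by_contra hne
      exact ho (if_neg fun h => hne h.2.2)
    rw [this]
    rw [Int.abs_eq_natAbs] at hk
    exact max_le hc (by omega)
  cost c x := by
    rcases lt_or_ge 0 k with h | h
    · lift k to ℕ using h.le
      have h0 : (k : ℝ≥0∞) ≠ 0 := by
        have : k ≠ 0 := by omega
        exact_mod_cast this
      rw [ev_random]
      simp only [Nat.cast_add, Nat.cast_one, Finset.sum_const, Finset.card_range, nsmul_eq_mul]
      rw [← mul_assoc, ENNReal.inv_mul_cancel h0 (ENNReal.natCast_ne_top k), one_mul]
      exact le_of_eq (by ring)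
    · have : ∀ o, MotzkinGen.random k c o = 0 := fun o => if_neg fun h' => by omega
      simp [ev, this]

theorem Spec.readAt (w : List Step) (i : ℤ) : Spec W (readAt w i) 1 (fun _ => True) := by
  unfold MotzkinGen.readAt
  split_ifs
  · split
    · exact (Spec.unitOp _).mono le_rfl fun _ _ => trivial
    · exact (Spec.crash (Q := fun _ => True)).mono zero_le_one fun _ _ => trivial
  · exact (Spec.crash (Q := fun _ => True)).mono zero_le_one fun _ _ => trivial

/-- The rule for `for` loops with an invariant `I`: every iteration costs the time `T` of the body,
one unit for the loop and one for the counter. -/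
theorem Spec.forFrom {body : ℤ → σ → RAM σ} (I : ℤ → σ → Prop) :
    ∀ (j : ℕ) (i : ℤ) (s : σ), I i s →
      (∀ l s, i ≤ l → l < i + j → I l s → Spec W (body l s) T (I (l + 1))) →
      (∀ l, i < l → l ≤ i + j → |l| ≤ W) →
      Spec W (forFrom body j i s) (j * (T + 2) + 1) (I (i + j)) := by
  intro j
  induction j with
  | zero =>
    intro i s hs _ _
    refine (Spec.unitOp s).mono (by simp) ?_
    rintro _ rfl
    simpa using hs
  | succ j ih =>
    intro i s hs hb hW
    rw [MotzkinGen.forFrom]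
    have h1 : Spec W (MotzkinGen.forFrom body (j + 1) i s) (1 + (T + (1 + (j * (T + 2) + 1))))
        (I (i + (j + 1 : ℕ))) := by
      refine (Spec.unitOp ()).bind fun _ _ => ?_
      refine (hb i s le_rfl (by push_cast; omega) hs).bind fun s' hs' => ?_
      refine (Spec.intOp (hW (i + 1) (by omega) (by push_cast; omega))).bind ?_
      rintro _ rfl
      have := ih (i + 1) s' hs' (fun l s h1 h2 => hb l s (by omega) (by push_cast; omega))
        (fun l h1 h2 => hW l (by omega) (by push_cast; omega))
      rwa [show i + 1 + (j : ℤ) = i + (j + 1 : ℕ) by push_cast; ring] at this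
    refine h1.mono (le_of_eq ?_) fun _ h => h
    push_cast
    ring

theorem Spec.allFrom {test : ℤ → RAM Bool} :
    ∀ (j : ℕ) (i : ℤ),
      (∀ l, i ≤ l → l < i + j → Spec W (test l) T fun _ => True) →
      (∀ l, i < l → l ≤ i + j → |l| ≤ W) →
      Spec W (allFrom test j i) (j * (T + 2) + 1) fun _ => True := by
  intro j
  induction j with
  | zero => exact fun i _ _ => (Spec.unitOp _).mono (by simp) fun _ _ => trivial
  | succ j ih =>
    intro i hb hW
    rw [MotzkinGen.allFrom]
    have h1 : Spec W (MotzkinGen.allFrom test (j + 1) i) (1 + (T + (1 + (j * (T + 2) + 1))))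
        fun _ => True := by
      refine (Spec.unitOp ()).bind fun _ _ => ?_
      refine (hb i le_rfl (by push_cast; omega)).bind fun b _ => ?_
      split_ifs
      · refine (Spec.intOp (hW (i + 1) (by omega) (by push_cast; omega))).bind ?_
        rintro _ rfl
        exact ih (i + 1) (fun l h1 h2 => hb l (by omega) (by push_cast; omega))
          (fun l h1 h2 => hW l (by omega) (by push_cast; omega))
      · exact (Spec.pure (Q := fun _ => True) trivial).mono zero_le (fun _ _ => trivial)
    refine h1.mono (le_of_eq ?_) fun _ h => h
    push_cast
    ring

/-- A loop with independent, identically distributed iterations: the expected number of iterations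
is the reciprocal of the probability `1 - a` of stopping. -/
theorem Spec.loop {body : Unit → RAM (Unit ⊕ β)} {a : ℝ≥0∞} {Y : (β → ℝ≥0∞) → ℝ≥0∞}
    {Q : β → Prop} (hl : Law (body ()) fun f => a * f (.inl ()) + Y fun b => f (.inr b))
    (hs : Spec W (body ()) T fun r => ∀ b, r = .inr b → Q b) :
    Spec W (loop body ()) ((T + 1) * (1 - a)⁻¹) Q := by
  have hN : ∀ j c o, loopN body j () c o ≠ 0 →
      Q o.1 ∧ (c.maxInt ≤ W → o.2.maxInt ≤ W) := by
    intro j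
    induction j with
    | zero => exact fun c o ho => absurd rfl ho
    | succ j ih =>
      intro c o ho
      rw [loopN] at ho
      obtain ⟨q, h1, h2⟩ := exists_of_bind_ne_zero ho
      have hq := (Spec.unitOp (W := W) ()).ints _ _ h1
      obtain ⟨r, h3, h4⟩ := exists_of_bind_ne_zero h2
      have hr := hs.ints _ _ h3
      have hr' := hs.post _ _ h3
      obtain ⟨r | r, d⟩ := r
      · have := ih _ _ h4
        exact ⟨this.1, fun hc => this.2 (hr (hq hc))⟩
      · rw [eq_of_pure_ne_zero h4]
        exact ⟨hr' r rfl, fun hc => hr (hq hc)⟩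
  refine ⟨fun c o ho => ?_, fun c o ho => ?_, fun c x => ?_⟩
  · obtain ⟨j, hj⟩ := exists_of_loop_ne_zero ho
    exact (hN j c o hj).1
  · obtain ⟨j, hj⟩ := exists_of_loop_ne_zero ho
    exact (hN j c o hj).2
  · rw [ev_loop]
    refine iSup_le fun j => ?_
    have key : ∀ j c, ev (loopN body j ()) c (fun o => o.2.time + x) ≤
        c.time + x + (T + 1) * ∑ i ∈ Finset.range j, a ^ i := by
      intro j
      induction j with
      | zero => intro c; simp [loopN]
      | succ j ih =>
        intro c
        rw [ev_loopN_succ]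
        set A := (T + 1) * ∑ i ∈ Finset.range j, a ^ i
        calc _ ≤ ev (body ()) ⟨c.time + 1, c.maxInt⟩ (fun q => (q.2.time + x) +
              Sum.elim (fun _ => A) (fun _ => 0) q.1) := by
              refine ev_mono fun q _ => ?_
              obtain ⟨r | r, d⟩ := q
              · exact ih d
              · simp
          _ ≤ (((c.time + 1 : ℕ) : ℝ≥0∞) + x + T) + a * A := by
              rw [ev_add]
              refine add_le_add (hs.cost _ _) ?_
              rw [hl _ (Sum.elim (fun _ => A) fun _ => 0)]
              have hY : Y (fun _ => 0) = 0 := by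
                have := hl c fun _ => 0
                simpa [ev] using this.symm
              simp [hY]
          _ = _ := by
              simp only [A, Finset.sum_range_succ', pow_succ, ← Finset.sum_mul, pow_zero]
              push_cast
              ring
    refine (key j c).trans ?_
    gcongr
    rw [← ENNReal.tsum_geometric]
    exact ENNReal.sum_le_tsum _

theorem Spec.expTime_le {p : RAM β} {Q : β → Prop} (h : Spec W p T Q) : expTime p ≤ T := by
  have := h.cost ⟨0, 0⟩ 0
  simpa [expTime, ev] using this

theorem Spec.intsAtMost {p : RAM β} {Q : β → Prop} (h : Spec W p T Q) : IntsAtMost p W :=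
  fun o ho => h.ints ⟨0, 0⟩ o ho (Nat.zero_le _)

end Calculus

/-! ### Inequalities between the parameters -/

/-- The real relations between `n`, `h`, the root `t` of `P x = (x+1) (x+1+h)`, where
`P x = (n+1-h-2x) (n-h-2x)`, its ceiling `M`, and the integers `k` and `α`, on which the comparison of
`F` and `B` rests. The last two fields say that `kM + α` is `k (t+1)` up to an error in `[-1, 0]`. -/
structure Params (n h M k α : ℕ) (t : ℝ) : Prop where
  h_pos : 1 ≤ h
  root : ((n : ℝ) + 1 - h - 2 * t) * (n - h - 2 * t) = (t + 1) * (t + 1 + h)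
  one_lt : 1 < t
  two_mul_lt : 2 * t < n + 1 - h
  le_M : t ≤ M
  M_lt : (M : ℝ) < t + 1
  one_le_k : 1 ≤ k
  k_lt : 2 * t * k < n + 1 - h
  le_k : (n : ℝ) + 1 - h ≤ 2 * t * (k + 1)
  α_lt : α + 1 ≤ k
  lower : (k : ℝ) * (t + 1) ≤ k * M + α + 1
  upper : (k : ℝ) * M + α ≤ k * (t + 1)

/-- The difference `Q x - k P x`, where `Q x = (x+1+h) (N-x)` with `N = (k+1) M + α`. It is a concave
quadratic function of `x`; where it is negative, `F` grows faster than the binomial weights. -/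
def defect (n h M k α x : ℝ) : ℝ :=
  (x + 1 + h) * ((k + 1) * M + α - x) - k * ((n + 1 - h - 2 * x) * (n - h - 2 * x))

theorem defect_concave {n h M k α x y z : ℝ} (hk : 0 ≤ k) (hxy : x ≤ y) (hyz : y ≤ z) (hxz : x < z)
    (hx : 0 ≤ defect n h M k α x) (hz : 0 ≤ defect n h M k α z) : 0 ≤ defect n h M k α y := by
  have key : defect n h M k α y * (z - x) = defect n h M k α x * (z - y) +
      defect n h M k α z * (y - x) + (4 * k + 1) * ((y - x) * (z - y) * (z - x)) := by
    unfold defect; ring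
  have h1 : 0 ≤ y - x := by linarith
  have h2 : 0 ≤ z - y := by linarith
  have h3 : 0 < z - x := by linarith
  have : 0 ≤ defect n h M k α y * (z - x) := by rw [key]; positivity
  exact nonneg_of_mul_nonneg_left this h3

namespace Params

variable {n h M k α : ℕ} {t : ℝ}

/-- The root `t` stays away from the end `(n + 1 - h) / 2` of the support of `F`. -/
theorem three_lt (p : Params n h M k α t) : 3 < (n : ℝ) + 1 - h - 2 * t := by
  have h1 : (1 : ℝ) ≤ h := by exact_mod_cast p.h_pos
  have := p.root
  have := p.two_mul_lt
  have := p.one_lt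
  nlinarith

theorem k_pos (p : Params n h M k α t) : (1 : ℝ) ≤ k := by exact_mod_cast p.one_le_k

/-- `2 t k ≥ u` with `u = n + 1 - h - 2 t`. -/
theorem le_two_mul (p : Params n h M k α t) : (n : ℝ) + 1 - h - 2 * t ≤ 2 * t * k := by
  have := p.le_k
  linarith

/-- Expansion of the defect around the root `t`. -/
theorem defect_expand (p : Params n h M k α t) (y : ℝ) :
    defect n h M k α (t + y) = (t + 1 + h) * ((k + 1) * M + α - t - k * (t + 1)) +
      y * (k * (t + 1) + ((k + 1) * M + α - t - k * (t + 1)) - (t + 1 + h) +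
        2 * k * (2 * ((n : ℝ) + 1 - h - 2 * t) - 1)) - (4 * k + 1) * y ^ 2 := by
  unfold defect
  linear_combination (-(k : ℝ)) * p.root

theorem defect_above (p : Params n h M k α t) : 0 ≤ defect n h M k α (M + 1) := by
  have hh : (1 : ℝ) ≤ h := by exact_mod_cast p.h_pos
  have ht := p.one_lt
  have hk := p.k_pos
  have hu := p.three_lt
  have hku := p.le_two_mul
  have hr := p.root
  have e := p.defect_expand (M + 1 - t)
  rw [show t + ((M : ℝ) + 1 - t) = M + 1 by ring] at e
  rw [e]
  set u := (n : ℝ) + 1 - h - 2 * t with hudef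
  set y := (M : ℝ) + 1 - t with hy
  set H := t + 1 + h with hH
  have hr' : u * (u - 1) = (t + 1) * H := by rw [← hr]; ring
  set δ := ((k : ℝ) + 1) * M + α - t - k * (t + 1) with hδ
  have hy1 : 1 ≤ y := by have := p.le_M; linarith
  have hy2 : y ≤ 2 := by have := p.M_lt; linarith
  have hδ1 : y - 2 ≤ δ := by have := p.lower; rw [hδ, hy]; linarith
  have hHt : t + 2 ≤ H := by linarith
  -- the coefficients of `2 - y` and `y - 1` below, which settle the endpoints `y = 1` and `y = 2`
  have e1 : 0 ≤ (k : ℝ) * (t + 1 + 4 * u - 6) - 2 - 2 * H := by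
    have a1 : 0 ≤ (2 * t * k - u) * (t + 1 + 4 * u - 6) :=
      mul_nonneg (by linarith) (by linarith)
    have a2 : 0 ≤ (u - 3) * (t - 1) := mul_nonneg (by linarith) (by linarith)
    have : 0 ≤ 2 * t * ((k : ℝ) * (t + 1 + 4 * u - 6) - 2 - 2 * H) := by nlinarith
    exact nonneg_of_mul_nonneg_right this (by linarith)
  have e2 : 0 ≤ 2 * (k : ℝ) * (t + 1 + 4 * u - 10) - 4 - 2 * H := by
    have a1 : 0 ≤ (2 * t * k - u) * (t + 1 + 4 * u - 10) :=
      mul_nonneg (by linarith) (by linarith)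
    have a2 : 0 ≤ (u - 3) * (t - 1) := mul_nonneg (by linarith) (by linarith)
    have : 0 ≤ t * (2 * (k : ℝ) * (t + 1 + 4 * u - 10) - 4 - 2 * H) := by nlinarith
    exact nonneg_of_mul_nonneg_right this (by linarith)
  have h1 : 0 ≤ (H + y) * (δ - (y - 2)) := mul_nonneg (by linarith) (by linarith)
  have h2 : 0 ≤ (y - 1) * (2 - y) := mul_nonneg (by linarith) (by linarith)
  have h3 := mul_nonneg (by linarith : (0 : ℝ) ≤ k) h2
  have h4 := mul_nonneg (by linarith : (0 : ℝ) ≤ y - 1) e2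
  have h5 := mul_nonneg (by linarith : (0 : ℝ) ≤ 2 - y) e1
  have : H * δ + y * (k * (t + 1) + δ - H + 2 * k * (2 * u - 1)) - (4 * k + 1) * y ^ 2 =
      (H + y) * (δ - (y - 2)) + 4 * (k * ((y - 1) * (2 - y))) +
      (y - 1) * (2 * (k : ℝ) * (t + 1 + 4 * u - 10) - 4 - 2 * H) +
      (2 - y) * ((k : ℝ) * (t + 1 + 4 * u - 6) - 2 - 2 * H) := by ring
  rw [this]
  linarith

theorem defect_below (p : Params n h M k α t) : defect n h M k α (M - 2) < 0 := by
  have hh : (1 : ℝ) ≤ h := by exact_mod_cast p.h_pos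
  have ht := p.one_lt
  have hk := p.k_pos
  have hu := p.three_lt
  have hku := p.le_two_mul
  have hr := p.root
  have e := p.defect_expand (M - 2 - t)
  rw [show t + ((M : ℝ) - 2 - t) = M - 2 by ring] at e
  rw [e]
  set u := (n : ℝ) + 1 - h - 2 * t with hudef
  obtain ⟨z, hz⟩ : ∃ z, (M : ℝ) - 2 - t = -z := ⟨_, (neg_neg _).symm⟩
  rw [hz]
  set H := t + 1 + h with hH
  have hr' : u * (u - 1) = (t + 1) * H := by rw [← hr]; ring
  set δ := ((k : ℝ) + 1) * M + α - t - k * (t + 1) with hδ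
  have hz1 : 1 ≤ z := by have := p.M_lt; linarith
  have hz2 : z ≤ 2 := by have := p.le_M; linarith
  have hδ1 : δ ≤ 2 - z := by have := p.upper; rw [hδ]; linarith
  have hHt : t + 2 ≤ H := by linarith
  have h1 : 0 ≤ (H - z) * (2 - z - δ) := mul_nonneg (by linarith) (by linarith)
  have h2 : H < 2 * (k * u) := by
    have a1 : 0 ≤ (2 * t * k - u) * u := mul_nonneg (by linarith) (by linarith)
    have a2 : (t + 1) * H < (t + 1) * (2 * (k * u)) := by
      have : 0 ≤ k * u := by positivity
      nlinarith
    exact lt_of_mul_lt_mul_left a2 (by linarith)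
  have h3 : 0 ≤ (z - 1) * (2 + k * (t - 1 + 4 * u)) :=
    mul_nonneg (by linarith) (add_nonneg zero_le_two (mul_nonneg (by linarith) (by linarith)))
  have h4 : 0 ≤ (k : ℝ) * ((z - 1) * (z + 1)) :=
    mul_nonneg (by linarith) (mul_nonneg (by linarith) (by linarith))
  have h5 : 0 ≤ (k : ℝ) * t := mul_nonneg (by linarith) (by linarith)
  have : H * δ + -z * (k * (t + 1) + δ - H + 2 * k * (2 * u - 1)) - (4 * k + 1) * (-z) ^ 2 =
      2 * (H - 2 * (k * u)) - k * t - 3 * k - 2 - (H - z) * (2 - z - δ) -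
        (z - 1) * (2 + k * (t - 1 + 4 * u)) - 4 * (k * ((z - 1) * (z + 1))) := by ring
  rw [this]
  linarith

theorem N_ge (p : Params n h M k α t) : (n : ℝ) + 1 - h ≤ 2 * ((k + 1) * M + α) := by
  have h1 := p.le_k
  have h2 : t * (k + 1) ≤ M * (k + 1) :=
    mul_le_mul_of_nonneg_right p.le_M (by have := p.k_pos; linarith)
  have : (0 : ℝ) ≤ α := α.cast_nonneg
  linarith

/-- At the end of the support of `F`, the defect is nonnegative as `P` vanishes there. -/
theorem defect_end (p : Params n h M k α t) : 0 ≤ defect n h M k α (((n : ℝ) + 1 - h) / 2) := by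
  have h1 := p.N_ge
  have h2 := p.two_mul_lt
  have h3 := p.one_lt
  have : 0 ≤ (((n : ℝ) + 1 - h) / 2 + 1 + h) * (((k : ℝ) + 1) * M + α - ((n : ℝ) + 1 - h) / 2) :=
    mul_nonneg (by linarith [(Nat.cast_nonneg h : (0 : ℝ) ≤ h)]) (by linarith)
  unfold defect
  rw [show (n : ℝ) + 1 - h - 2 * (((n : ℝ) + 1 - h) / 2) = 0 by ring]
  linarith

/-- The difference `P x - (x+1) (x+1+h)`, whose sign tells whether `F` increases, vanishes at `t`. -/
theorem ratio_factor (p : Params n h M k α t) (x : ℝ) :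
    ((n : ℝ) + 1 - h - 2 * x) * (n - h - 2 * x) - (x + 1) * (x + 1 + h) =
      (t - x) * (2 * (2 * ((n : ℝ) + 1 - h - 2 * t) - 1) + (t + 1) + (t + 1 + h) - 3 * (x - t)) := by
  linear_combination p.root

theorem ratio_factor_pos (p : Params n h M k α t) {x : ℝ} (hx : 2 * x ≤ n + 1 - h) :
    0 < 2 * (2 * ((n : ℝ) + 1 - h - 2 * t) - 1) + (t + 1) + (t + 1 + h) - 3 * (x - t) := by
  have := p.three_lt
  have := p.one_lt
  have : (0 : ℝ) ≤ h := h.cast_nonneg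
  linarith

theorem lt_P (p : Params n h M k α t) {i : ℕ} (hi : i < M) :
    ((i : ℝ) + 1) * (i + 1 + h) < ((n : ℝ) + 1 - h - 2 * i) * (n - h - 2 * i) := by
  have h1 : (i : ℝ) < t := by
    have : (i : ℝ) + 1 ≤ M := by exact_mod_cast hi
    have := p.M_lt
    linarith
  have h2 := p.ratio_factor i
  have h3 := p.ratio_factor_pos (x := i) (by have := p.two_mul_lt; linarith)
  have := mul_pos (sub_pos.2 h1) h3
  linarith

theorem P_le (p : Params n h M k α t) {i : ℕ} (hi : M ≤ i) (hi' : 2 * i + h ≤ n + 1) :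
    ((n : ℝ) + 1 - h - 2 * i) * (n - h - 2 * i) ≤ ((i : ℝ) + 1) * (i + 1 + h) := by
  have h1 : t ≤ i := by
    have : (M : ℝ) ≤ i := by exact_mod_cast hi
    have := p.le_M
    linarith
  have h0 : 2 * (i : ℝ) + h ≤ n + 1 := by exact_mod_cast hi'
  have h2 := p.ratio_factor i
  have h3 := p.ratio_factor_pos (x := i) (by linarith)
  have := mul_nonneg (sub_nonneg.2 h1) h3.le
  linarith

theorem two_mul_M_le (p : Params n h M k α t) : 2 * M + h ≤ n + 1 := by
  have h1 : (2 : ℝ) * M + h < n + 1 := by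
    have := p.M_lt
    have := p.three_lt
    linarith
  exact_mod_cast h1.le

theorem two_le_M (p : Params n h M k α t) : 2 ≤ M := by
  have h1 : (1 : ℝ) < M := by have := p.le_M; have := p.one_lt; linarith
  exact_mod_cast h1

theorem N_nat_ge (p : Params n h M k α t) {m : ℕ} (hm : 2 * m + h ≤ n + 1) :
    m ≤ (k + 1) * M + α := by
  have h1 := p.N_ge
  have h2 : 2 * (m : ℝ) + h ≤ n + 1 := by exact_mod_cast hm
  have h3 : (m : ℝ) ≤ (k + 1) * M + α := by linarith
  exact_mod_cast h3

/-- Below `M - 1`, the ratio of `F` exceeds the ratio of the binomial weights. -/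
theorem Q_lt (p : Params n h M k α t) {i : ℕ} (hi : i + 2 ≤ M) :
    ((i : ℝ) + 1 + h) * ((k + 1) * M + α - i) <
      k * (((n : ℝ) + 1 - h - 2 * i) * (n - h - 2 * i)) := by
  have h1 : (i : ℝ) ≤ M - 2 := by
    have : (i : ℝ) + 2 ≤ M := by exact_mod_cast hi
    linarith
  by_contra! hc
  have h2 : 0 ≤ defect n h M k α i := by unfold defect; linarith
  have h3 : (M : ℝ) - 2 < (n + 1 - h) / 2 := by
    have := p.two_mul_lt
    have := p.M_lt
    linarith
  have := defect_concave (Nat.cast_nonneg k) h1 h3.le (by linarith) h2 p.defect_end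
  have := p.defect_below
  linarith

/-- Above `M`, the ratio of `F` is at most the ratio of the binomial weights. -/
theorem le_Q (p : Params n h M k α t) {i : ℕ} (hi : M + 1 ≤ i) (hi' : 2 * i + h ≤ n + 1) :
    k * (((n : ℝ) + 1 - h - 2 * i) * (n - h - 2 * i)) ≤
      ((i : ℝ) + 1 + h) * ((k + 1) * M + α - i) := by
  have h1 : (M : ℝ) + 1 ≤ i := by exact_mod_cast hi
  have h0 : 2 * (i : ℝ) + h ≤ n + 1 := by exact_mod_cast hi'
  have h2 : (i : ℝ) ≤ (n + 1 - h) / 2 := by linarith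
  have : 0 ≤ defect n h M k α i := by
    rcases eq_or_lt_of_le h2 with h3 | h3
    · rw [h3]; exact p.defect_end
    · exact defect_concave (Nat.cast_nonneg k) h1 h2 (by linarith) p.defect_above p.defect_end
  unfold defect at this
  linarith

/-- The comparison of the last pair of numbers below `M` in case `+`. -/
theorem below_lt (p : Params n h M k α t) :
    ((M : ℝ) + h) * (k * M + α) <
      k * (((n : ℝ) + 1 - h - 2 * (M - 1 : ℝ)) * (n - h - 2 * (M - 1 : ℝ))) := by
  have hk := p.k_pos
  have hu := p.three_lt
  have ht := p.one_lt
  have hMt := p.M_lt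
  have hh : (0 : ℝ) ≤ h := h.cast_nonneg
  have h1 : ((M : ℝ) + h) * (k * M + α) ≤ (M + h) * (k * (t + 1)) :=
    mul_le_mul_of_nonneg_left p.upper (by positivity)
  have h2 : (t + 1) * (t + 1 + h) <
      (((n : ℝ) + 1 - h - 2 * (M - 1 : ℝ)) * (n - h - 2 * (M - 1 : ℝ))) := by
    rw [← p.root]
    apply mul_lt_mul'' <;> linarith
  have h3 : ((M : ℝ) + h) * (k * (t + 1)) ≤ k * ((t + 1) * (t + 1 + h)) := by
    have : 0 ≤ (k : ℝ) * (t + 1) * (t + 1 - M) :=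
      mul_nonneg (by positivity) (by linarith)
    nlinarith
  have h4 := mul_lt_mul_of_pos_left h2 (by linarith : (0 : ℝ) < k)
  linarith

/-- The comparison of the first pair of numbers above `M` in case `-`. -/
theorem le_above (p : Params n h M k α t) :
    k * (((n : ℝ) + 1 - h - 2 * M) * (n - h - 2 * M)) ≤
      ((M : ℝ) + h + 1) * (k * M + α + 1) := by
  have hk := p.k_pos
  have hu := p.three_lt
  have ht := p.one_lt
  have hMt := p.le_M
  have hMt' := p.M_lt
  have hh : (0 : ℝ) ≤ h := h.cast_nonneg
  have h1 : ((M : ℝ) + h + 1) * (k * (t + 1)) ≤ (M + h + 1) * (k * M + α + 1) :=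
    mul_le_mul_of_nonneg_left p.lower (by positivity)
  have h2 : (((n : ℝ) + 1 - h - 2 * M) * (n - h - 2 * M)) ≤ (t + 1) * (t + 1 + h) := by
    rw [← p.root]
    apply mul_le_mul <;> linarith
  have h3 : k * ((t + 1) * (t + 1 + h)) ≤ ((M : ℝ) + h + 1) * (k * (t + 1)) := by
    have : 0 ≤ (k : ℝ) * (t + 1) * (M - t) :=
      mul_nonneg (by positivity) (by linarith)
    nlinarith
  have h4 := mul_le_mul_of_nonneg_left h2 (by linarith : (0 : ℝ) ≤ k)
  linarith

end Params

/-! ### The numbers `F` -/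

theorem F_pos {n h m : ℕ} (hh : 1 ≤ h) (hm : 2 * m + h ≤ n + 1) : 0 < F n h m := by
  unfold F
  have h1 : 0 < (n + 1).choose m := Nat.choose_pos (by omega)
  have h2 : 0 < (n + 1 - m).choose (m + h) := Nat.choose_pos (by omega)
  have h3 : (0 : ℝ) < h := by exact_mod_cast hh
  have h4 : (0 : ℝ) < ((n + 1).choose m * (n + 1 - m).choose (m + h) : ℕ) := by
    exact_mod_cast Nat.mul_pos h1 h2
  positivity

theorem F_eq_zero {n h m : ℕ} (hm : n + 1 < 2 * m + h) : F n h m = 0 := by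
  unfold F
  rw [Nat.choose_eq_zero_of_lt (show n + 1 - m < m + h by omega)]
  simp

theorem F_nonneg (n h m : ℕ) : 0 ≤ F n h m := by
  unfold F
  positivity

/-- The ratio of two consecutive values of `F`. -/
theorem F_succ {n h m : ℕ} (hh : 1 ≤ h) (hm : 2 * m + h ≤ n + 1) :
    F n h (m + 1) * (((m : ℝ) + 1) * (m + 1 + h)) =
      F n h m * (((n : ℝ) + 1 - h - 2 * m) * (n - h - 2 * m)) := by
  have e1 := Nat.choose_succ_right_eq (n + 1) m
  have e2 := Nat.choose_succ_right_eq (n - m) (m + h)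
  have e3 := Nat.choose_mul_succ_eq (n - m) (m + h)
  rw [show n - m + 1 = n + 1 - m by omega] at e3
  rw [show m + h + 1 = m + 1 + h by ring] at e2
  rw [← Nat.cast_inj (R := ℝ)] at e1 e2 e3
  push_cast [Nat.cast_sub (show m ≤ n + 1 by omega)] at e1 e3
  rw [Nat.cast_sub (show m + h ≤ n + 1 - m by omega),
    Nat.cast_sub (show m ≤ n + 1 by omega)] at e3
  push_cast at e3
  have e2' : ((n - m).choose (m + 1 + h) : ℝ) * (m + 1 + h) =
      ((n - m).choose (m + h) : ℝ) * (n - h - 2 * m) := by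
    rcases Nat.lt_or_ge n (2 * m + h) with hlt | hge
    · have : (n : ℝ) + 1 = 2 * m + h := by exact_mod_cast (by omega : n + 1 = 2 * m + h)
      rw [Nat.choose_eq_zero_of_lt (show n - m < m + 1 + h by omega),
        Nat.choose_eq_zero_of_lt (show n - m < m + h by omega)]
      simp
    · push_cast [Nat.cast_sub (show m ≤ n by omega),
        Nat.cast_sub (show m + h ≤ n - m by omega)] at e2
      rw [e2]
      ring
  unfold F
  rw [show n + 1 - (m + 1) = n - m by omega]
  push_cast
  linear_combination ((h : ℝ) / (n + 1)) * (((n - m).choose (m + 1 + h) : ℝ) * (m + 1 + h) * e1 +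
    ((n + 1).choose m : ℝ) * ((n : ℝ) + 1 - m) * e2' +
    ((n + 1).choose m : ℝ) * (n - h - 2 * m) * e3)

namespace Params

variable {n h M k α : ℕ} {t : ℝ}

theorem F_lt_succ (p : Params n h M k α t) {m : ℕ} (hm : m < M) : F n h m < F n h (m + 1) := by
  have h2 := p.two_mul_M_le
  have hF := F_pos p.h_pos (show 2 * m + h ≤ n + 1 by omega)
  have h1 := mul_lt_mul_of_pos_left (p.lt_P hm) hF
  rw [← F_succ p.h_pos (by omega)] at h1
  exact lt_of_mul_lt_mul_right h1 (by positivity)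

theorem F_succ_le (p : Params n h M k α t) {m : ℕ} (hm : M ≤ m) : F n h (m + 1) ≤ F n h m := by
  rcases Nat.lt_or_ge (n + 1) (2 * m + h) with h1 | h1
  · rw [F_eq_zero h1, F_eq_zero (by omega)]
  · have h1' := mul_le_mul_of_nonneg_left (p.P_le hm h1) (F_nonneg n h m)
    rw [← F_succ p.h_pos h1] at h1'
    exact le_of_mul_le_mul_right h1' (by positivity)

theorem F_le (p : Params n h M k α t) (j : ℕ) : F n h j ≤ F n h M := by
  rcases le_total j M with hj | hj
  · exact Nat.decreasingInduction (motive := fun i _ => F n h i ≤ F n h M)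
      (fun i hi ih => (p.F_lt_succ hi).le.trans ih) le_rfl hj
  · exact Nat.le_induction (m := M) (P := fun i _ => F n h i ≤ F n h M) le_rfl
      (fun i hi ih => (p.F_succ_le hi).trans ih) j hj

theorem argM_eq (p : Params n h M k α t) : argM n h = M := by
  refine le_antisymm (Nat.sInf_le p.F_le) (le_csInf ⟨M, p.F_le⟩ ?_)
  intro m hm
  by_contra! hlt
  exact absurd (hm (m + 1)) (not_le.2 (p.F_lt_succ hlt))

theorem ceil_eq (p : Params n h M k α t) : ⌈t⌉ = M := by
  rw [Int.ceil_eq_iff]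
  have := p.le_M
  have := p.M_lt
  push_cast
  constructor <;> linarith

end Params

/-! ### Existence of the parameters -/

/-- The hypothesis on `h` in polynomial form, with `g = n - h`: it says that `P 1 > 2 (2 + h)`. -/
theorem hyp_poly {n h : ℕ} (hyp : (h : ℝ) < n - 1 / 2 - √(8 * n + 9) / 2) :
    0 < (n : ℝ) - h ∧ 2 * n + 2 < ((n : ℝ) - h) ^ 2 - (n - h) := by
  have h0 : (0 : ℝ) ≤ 8 * n + 9 := by positivity
  have hs := Real.sq_sqrt h0
  have hs0 := Real.sqrt_nonneg (8 * (n : ℝ) + 9)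
  constructor
  · linarith
  · nlinarith

/-- `mTilde` is the smaller root of a quadratic polynomial; the hypothesis on `h` gives
`1 < mTilde`. -/
theorem mTilde_spec {n h : ℕ} (hyp : (h : ℝ) < n - 1 / 2 - √(8 * n + 9) / 2) :
    ((n : ℝ) + 1 - h - 2 * mTilde n h) * (n - h - 2 * mTilde n h) =
      (mTilde n h + 1) * (mTilde n h + 1 + h) ∧ 1 < mTilde n h ∧
    2 * mTilde n h < n + 1 - h := by
  obtain ⟨hg, hg2⟩ := hyp_poly hyp
  have hh : (0 : ℝ) ≤ h := h.cast_nonneg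
  have hD : (0 : ℝ) ≤ 4 * n ^ 2 + 20 * n + 28 - 3 * h ^ 2 := by nlinarith
  have hs := Real.sq_sqrt hD
  have hs0 := Real.sqrt_nonneg (4 * (n : ℝ) ^ 2 + 20 * n + 28 - 3 * h ^ 2)
  set s := √(4 * (n : ℝ) ^ 2 + 20 * n + 28 - 3 * h ^ 2) with hsdef
  have ht : mTilde n h = (4 * n + 4 - 3 * h - s) / 6 := rfl
  rw [ht]
  have hn : (3 : ℝ) < n - h := by nlinarith
  refine ⟨by linear_combination (1 / 12 : ℝ) * hs, ?_, ?_⟩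
  · have : s < 4 * n - 2 - 3 * h := by
      apply lt_of_pow_lt_pow_left₀ 2 (by linarith)
      rw [hs]
      nlinarith
    linarith
  · have : (n : ℝ) + 1 < s := by
      apply lt_of_pow_lt_pow_left₀ 2 hs0
      rw [hs]
      nlinarith
    linarith

theorem exists_params {n h : ℕ} (hh : 1 ≤ h) (hyp : (h : ℝ) < n - 1 / 2 - √(8 * n + 9) / 2) :
    ∃ k α : ℕ, (k : ℤ) = parK n h ∧ (α : ℤ) = parAlpha n h ∧
      Params n h (argM n h) k α (mTilde n h) := by
  obtain ⟨hroot, ht, htd⟩ := mTilde_spec hyp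
  set t := mTilde n h with ht_def
  set M := ⌈t⌉₊ with hM
  have hM1 : t ≤ M := Nat.le_ceil t
  have hM2 : (M : ℝ) < t + 1 := Nat.ceil_lt_add_one (by linarith)
  have hk2 : 1 < ((n : ℝ) + 1 - h) / (2 * t) := by
    rw [lt_div_iff₀ (by linarith)]
    linarith
  have hkpos : 1 ≤ parK n h := by
    have : (1 : ℤ) < ⌈((n : ℝ) + 1 - h) / (2 * t)⌉ := by
      rw [Int.lt_ceil]
      exact_mod_cast hk2
    unfold parK
    rw [← ht_def]
    omega
  obtain ⟨k, hk⟩ := Int.eq_ofNat_of_zero_le (by omega : 0 ≤ parK n h)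
  have hkc : (k : ℝ) + 1 = ⌈((n : ℝ) + 1 - h) / (2 * t)⌉ := by
    have : (k : ℤ) + 1 = ⌈((n : ℝ) + 1 - h) / (2 * t)⌉ := by
      have : (k : ℤ) = ⌈((n : ℝ) + 1 - h) / (2 * t)⌉ - 1 := hk.symm
      omega
    exact_mod_cast this
  have hk1 : 1 ≤ k := by omega
  have hk1' : (1 : ℝ) ≤ k := by exact_mod_cast hk1
  set a : ℤ := min ((k : ℤ) - 1) ⌊(k : ℝ) - k * (M - t)⌋ with ha
  have ha0 : 0 ≤ a := by
    refine le_min (by omega) (Int.floor_nonneg.2 ?_)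
    nlinarith
  obtain ⟨α, hα⟩ := Int.eq_ofNat_of_zero_le ha0
  have hα1 : (α : ℤ) ≤ k - 1 := hα ▸ min_le_left _ _
  have hα2 : (α : ℤ) ≤ ⌊(k : ℝ) - k * (M - t)⌋ := hα ▸ min_le_right _ _
  have hp : Params n h M k α t :=
    { h_pos := hh
      root := hroot
      one_lt := ht
      two_mul_lt := htd
      le_M := hM1
      M_lt := hM2
      one_le_k := hk1
      k_lt := by
        have := Int.ceil_lt_add_one (((n : ℝ) + 1 - h) / (2 * t))
        have h2 : (k : ℝ) < ((n : ℝ) + 1 - h) / (2 * t) := by linarith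
        rw [lt_div_iff₀ (by linarith)] at h2
        linarith
      le_k := by
        have := Int.le_ceil (((n : ℝ) + 1 - h) / (2 * t))
        rw [← hkc, div_le_iff₀ (by linarith)] at this
        linarith
      α_lt := by omega
      lower := by
        rcases min_choice ((k : ℤ) - 1) ⌊(k : ℝ) - k * (M - t)⌋ with h1 | h1
        · have : (α : ℤ) = k - 1 := by rw [← h1, ← ha, hα]
          have h2 : (α : ℝ) = k - 1 := by exact_mod_cast this
          nlinarith
        · have h2 : (α : ℤ) = ⌊(k : ℝ) - k * (M - t)⌋ := by rw [← h1, ← ha, hα]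
          have h3 := Int.lt_floor_add_one ((k : ℝ) - k * (M - t))
          rw [← h2] at h3
          push_cast at h3
          linarith
      upper := by
        have h2 : (α : ℝ) ≤ (k : ℝ) - k * (M - t) := by exact_mod_cast Int.le_floor.1 hα2
        linarith }
  have hA := hp.argM_eq
  refine ⟨k, α, hk.symm, ?_, hA ▸ hp⟩
  rw [show (α : ℤ) = a from hα.symm, ha, parAlpha, hA, hk]
  rfl

/-! ### The binomial weights and the ratio `G` -/

theorem Bund_nonneg (M k α m : ℕ) : 0 ≤ Bund M k α m := by
  unfold Bund
  positivity

theorem Bund_pos {M k α m : ℕ} (hk : 1 ≤ k) (hm : m ≤ (k + 1) * M + α) : 0 < Bund M k α m := by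
  unfold Bund
  have h1 : 0 < ((k + 1) * M + α).choose m := Nat.choose_pos hm
  have h2 : (0 : ℝ) < k := by exact_mod_cast hk
  have h3 : (0 : ℝ) < (((k + 1) * M + α).choose m : ℕ) := by exact_mod_cast h1
  positivity

theorem Bund_succ {M k α m : ℕ} (hm : m ≤ (k + 1) * M + α) :
    Bund M k α (m + 1) * (k * (m + 1)) = Bund M k α m * ((k + 1) * M + α - m) := by
  unfold Bund
  have hN : ((k : ℝ) + 1) * M + α = (((k + 1) * M + α : ℕ) : ℝ) := by push_cast; ring
  rw [hN]
  set N := (k + 1) * M + α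
  have e := Nat.choose_succ_right_eq N m
  rw [← Nat.cast_inj (R := ℝ)] at e
  push_cast [Nat.cast_sub hm] at e
  rcases eq_or_lt_of_le hm with rfl | hlt
  · simp
  · rw [show N - m = N - (m + 1) + 1 by omega, pow_succ]
    linear_combination (k : ℝ) ^ (N - (m + 1)) * k * e

theorem B_of_ne {M k α m : ℕ} (hm : m ≠ M) : B M k α m = Bund M k α m := if_neg hm

theorem B_self (M k α : ℕ) : B M k α M = max (Bund M k α (M - 1)) (Bund M k α (M + 1)) := if_pos rfl

theorem whichOf_plus {M k α : ℕ} (h : k ^ 2 * M * (M + 1) ≤ (k * M + α + 1) * (k * M + α)) :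
    whichOf M k α = .plus := if_pos (by exact_mod_cast h)

theorem whichOf_minus {M k α : ℕ} (h : ¬k ^ 2 * M * (M + 1) ≤ (k * M + α + 1) * (k * M + α)) :
    whichOf M k α = .minus := if_neg (by exact_mod_cast h)

namespace Params

variable {n h M k α : ℕ} {t : ℝ}

theorem M_real (p : Params n h M k α t) : (2 : ℝ) ≤ M := by exact_mod_cast p.two_le_M

theorem cast_pred (p : Params n h M k α t) : ((M - 1 : ℕ) : ℝ) = M - 1 := by
  have := p.two_le_M
  push_cast [Nat.cast_sub (show 1 ≤ M by omega)]
  ring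

/-- Both neighbours of `M` are values of the binomial variable. -/
theorem M_lt_N (p : Params n h M k α t) : M + 2 ≤ (k + 1) * M + α := by
  have := p.two_le_M
  have := p.one_le_k
  nlinarith

theorem Bund_above (p : Params n h M k α t) :
    Bund M k α (M + 1) * (k * (M + 1)) = Bund M k α M * (k * M + α) := by
  rw [Bund_succ (by have := p.M_lt_N; omega)]
  ring

theorem Bund_below (p : Params n h M k α t) :
    Bund M k α M * (k * M) = Bund M k α (M - 1) * (k * M + α + 1) := by
  have h2 := p.two_le_M
  have := Bund_succ (M := M) (k := k) (α := α) (m := M - 1) (by have := p.M_lt_N; omega)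
  rw [show M - 1 + 1 = M by omega, p.cast_pred] at this
  linear_combination this

/-- The two neighbours of `M` compare as `k² M (M+1)` and `(kM + α + 1) (kM + α)`. -/
theorem Bund_neighbours (p : Params n h M k α t) :
    Bund M k α (M + 1) * ((k : ℝ) ^ 2 * M * (M + 1)) =
      Bund M k α (M - 1) * (((k : ℝ) * M + α + 1) * (k * M + α)) := by
  linear_combination ((k : ℝ) * M) * p.Bund_above + ((k : ℝ) * M + α) * p.Bund_below

theorem B_plus (p : Params n h M k α t)
    (hw : k ^ 2 * M * (M + 1) ≤ (k * M + α + 1) * (k * M + α)) :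
    B M k α M = Bund M k α (M + 1) := by
  rw [B_self]
  refine max_eq_right ?_
  have hM := p.M_real
  have hk := p.k_pos
  have hw' : (k : ℝ) ^ 2 * M * (M + 1) ≤ (k * M + α + 1) * (k * M + α) := by exact_mod_cast hw
  have h1 := mul_le_mul_of_nonneg_left hw' (Bund_nonneg M k α (M - 1))
  rw [← p.Bund_neighbours] at h1
  exact le_of_mul_le_mul_right h1 (by positivity)

theorem B_minus (p : Params n h M k α t)
    (hw : ¬k ^ 2 * M * (M + 1) ≤ (k * M + α + 1) * (k * M + α)) :
    B M k α M = Bund M k α (M - 1) := by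
  rw [B_self]
  refine max_eq_left ?_
  have hM := p.M_real
  have hk := p.k_pos
  have hw' : (k * M + α + 1) * (k * M + α) ≤ (k : ℝ) ^ 2 * M * (M + 1) := by
    exact_mod_cast (not_le.1 hw).le
  have h1 := mul_le_mul_of_nonneg_left hw' (Bund_nonneg M k α (M - 1))
  rw [← p.Bund_neighbours] at h1
  exact le_of_mul_le_mul_right h1 (by positivity)

theorem B_pos (p : Params n h M k α t) {m : ℕ} (hm : m ≤ (k + 1) * M + α) : 0 < B M k α m := by
  by_cases hmM : m = M
  · subst hmM
    rw [B_self]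
    exact lt_max_of_lt_right (Bund_pos p.one_le_k (by have := p.M_lt_N; omega))
  · rw [B_of_ne hmM]
    exact Bund_pos p.one_le_k hm

theorem G_pos (p : Params n h M k α t) {m : ℕ} (hm : 2 * m + h ≤ n + 1) : 0 < G n h M k α m :=
  div_pos (F_pos p.h_pos hm) (p.B_pos (p.N_nat_ge hm))

theorem G_eq_zero {m : ℕ} (hm : n + 1 < 2 * m + h) : G n h M k α m = 0 := by
  unfold G
  rw [F_eq_zero hm, zero_div]

/-- The ratio of consecutive values of `G` away from `M`. -/
theorem G_succ (p : Params n h M k α t) {i : ℕ} (h1 : i ≠ M) (h2 : i + 1 ≠ M)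
    (hi : 2 * (i + 1) + h ≤ n + 1) :
    G n h M k α (i + 1) * (((i : ℝ) + 1 + h) * ((k + 1) * M + α - i)) =
      G n h M k α i * (k * (((n : ℝ) + 1 - h - 2 * i) * (n - h - 2 * i))) := by
  have hN := p.N_nat_ge hi
  have b1 := p.B_pos (show i ≤ _ by omega)
  have b2 := p.B_pos hN
  have e1 := F_succ p.h_pos (show 2 * i + h ≤ n + 1 by omega)
  have e2 := Bund_succ (show i ≤ (k + 1) * M + α by omega)
  rw [← B_of_ne h1, ← B_of_ne h2] at e2
  have hi0 : (0 : ℝ) < (i : ℝ) + 1 := by positivity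
  unfold G
  rw [div_mul_eq_mul_div, div_mul_eq_mul_div, div_eq_div_iff b2.ne' b1.ne']
  apply mul_right_cancel₀ hi0.ne'
  linear_combination (B M k α i * ((k + 1) * M + α - i)) * e1 -
    (F n h i * (((n : ℝ) + 1 - h - 2 * i) * (n - h - 2 * i))) * e2

/-! The four ratios of `G` next to `M`, in the two cases. In each case the imposed equality of `B M`
with one neighbour reduces one of the ratios to a ratio of `F`. -/

theorem G_below_plus (p : Params n h M k α t)
    (hw : k ^ 2 * M * (M + 1) ≤ (k * M + α + 1) * (k * M + α)) :
    G n h M k α M * (((k : ℝ) * M + α + 1) * ((M + h) * (k * M + α))) =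
      G n h M k α (M - 1) * ((k * (M + 1)) *
        (k * (((n : ℝ) + 1 - h - 2 * (M - 1 : ℝ)) * (n - h - 2 * (M - 1 : ℝ))))) := by
  have h2 := p.two_le_M
  have hN := p.M_lt_N
  have b1 : 0 < Bund M k α (M - 1) := Bund_pos p.one_le_k (by omega)
  have b2 : 0 < Bund M k α (M + 1) := Bund_pos p.one_le_k (by omega)
  have e1 := F_succ p.h_pos (show 2 * (M - 1) + h ≤ n + 1 by have := p.two_mul_M_le; omega)
  rw [show M - 1 + 1 = M by omega, p.cast_pred] at e1
  have e2 := p.Bund_neighbours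
  have hM := p.M_real
  unfold G
  rw [p.B_plus hw, B_of_ne (show M - 1 ≠ M by omega), div_mul_eq_mul_div, div_mul_eq_mul_div,
    div_eq_div_iff b2.ne' b1.ne']
  apply mul_right_cancel₀ (show (M : ℝ) ≠ 0 by linarith)
  linear_combination (Bund M k α (M - 1) * (((k : ℝ) * M + α + 1) * (k * M + α))) * e1 -
    (F n h (M - 1) * (((n : ℝ) + 1 - h - 2 * (M - 1 : ℝ)) * (n - h - 2 * (M - 1 : ℝ)))) * e2

theorem G_above_plus (p : Params n h M k α t) (hM : 2 * (M + 1) + h ≤ n + 1)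
    (hw : k ^ 2 * M * (M + 1) ≤ (k * M + α + 1) * (k * M + α)) :
    G n h M k α (M + 1) * (((M : ℝ) + 1) * (M + 1 + h)) =
      G n h M k α M * (((n : ℝ) + 1 - h - 2 * M) * (n - h - 2 * M)) := by
  have e1 := F_succ p.h_pos (show 2 * M + h ≤ n + 1 by omega)
  unfold G
  rw [p.B_plus hw, B_of_ne (show M + 1 ≠ M by omega), div_mul_eq_mul_div, div_mul_eq_mul_div, e1]

theorem G_below_minus (p : Params n h M k α t)
    (hw : ¬k ^ 2 * M * (M + 1) ≤ (k * M + α + 1) * (k * M + α)) :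
    G n h M k α M * ((M : ℝ) * (M + h)) = G n h M k α (M - 1) *
      (((n : ℝ) + 1 - h - 2 * (M - 1 : ℝ)) * (n - h - 2 * (M - 1 : ℝ))) := by
  have h2 := p.two_le_M
  have e1 := F_succ p.h_pos (show 2 * (M - 1) + h ≤ n + 1 by have := p.two_mul_M_le; omega)
  rw [show M - 1 + 1 = M by omega, p.cast_pred] at e1
  unfold G
  rw [p.B_minus hw, B_of_ne (show M - 1 ≠ M by omega), div_mul_eq_mul_div, div_mul_eq_mul_div, ← e1]
  ring

theorem G_above_minus (p : Params n h M k α t) (hM : 2 * (M + 1) + h ≤ n + 1)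
    (hw : ¬k ^ 2 * M * (M + 1) ≤ (k * M + α + 1) * (k * M + α)) :
    G n h M k α (M + 1) * (((k : ℝ) * M + α) * ((M + h + 1) * (k * M + α + 1))) =
      G n h M k α M * ((k * M) * (k * (((n : ℝ) + 1 - h - 2 * M) * (n - h - 2 * M)))) := by
  have hN := p.M_lt_N
  have b1 : 0 < Bund M k α (M - 1) := Bund_pos p.one_le_k (by omega)
  have b2 : 0 < Bund M k α (M + 1) := Bund_pos p.one_le_k (by omega)
  have e1 := F_succ p.h_pos (show 2 * M + h ≤ n + 1 by omega)
  have e2 := p.Bund_neighbours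
  have hM := p.M_real
  unfold G
  rw [p.B_minus hw, B_of_ne (show M + 1 ≠ M by omega), div_mul_eq_mul_div, div_mul_eq_mul_div,
    div_eq_div_iff b2.ne' b1.ne']
  apply mul_right_cancel₀ (show (M : ℝ) + 1 ≠ 0 by linarith)
  linear_combination (Bund M k α (M - 1) * (((k : ℝ) * M + α + 1) * (k * M + α))) * e1 -
    (F n h M * (((n : ℝ) + 1 - h - 2 * M) * (n - h - 2 * M))) * e2

/-- `G` increases strictly up to `M`: the tests below `M` have success probabilities less than `1`. -/
theorem G_lt_succ (p : Params n h M k α t) {m : ℕ} (hm : m < M) :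
    G n h M k α m < G n h M k α (m + 1) := by
  have h2M := p.two_mul_M_le
  have hG := p.G_pos (show 2 * m + h ≤ n + 1 by omega)
  have hk := p.k_pos
  have hMr := p.M_real
  have hh : (0 : ℝ) ≤ h := h.cast_nonneg
  have hα : (0 : ℝ) ≤ α := α.cast_nonneg
  rcases Nat.lt_or_ge (m + 1) M with h1 | h1
  · have e := p.G_succ (i := m) (by omega) (by omega) (by omega)
    have hQ := mul_lt_mul_of_pos_left (p.Q_lt (i := m) (by omega)) hG
    rw [← e] at hQ
    refine lt_of_mul_lt_mul_right hQ (mul_nonneg (by positivity) ?_)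
    have : (m : ℝ) ≤ M := by exact_mod_cast hm.le
    nlinarith
  · obtain rfl : m = M - 1 := by omega
    rw [show M - 1 + 1 = M by omega]
    by_cases hw : k ^ 2 * M * (M + 1) ≤ (k * M + α + 1) * (k * M + α)
    · have e := p.G_below_plus hw
      have h3 := p.below_lt
      have h4 : (k : ℝ) * M + α + 1 ≤ k * (M + 1) := by
        have : (α : ℝ) + 1 ≤ k := by exact_mod_cast p.α_lt
        linarith
      have h5 : ((k : ℝ) * M + α + 1) * ((M + h) * (k * M + α)) < (k * (M + 1)) *
          (k * (((n : ℝ) + 1 - h - 2 * (M - 1 : ℝ)) * (n - h - 2 * (M - 1 : ℝ)))) :=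
        mul_lt_mul_of_le_of_lt_of_nonneg_of_pos h4 h3 (by positivity) (by positivity)
      have h6 := mul_lt_mul_of_pos_left h5 hG
      rw [← e] at h6
      exact lt_of_mul_lt_mul_right h6 (by positivity)
    · have e := p.G_below_minus hw
      have h3 := p.lt_P (i := M - 1) (by omega)
      rw [p.cast_pred] at h3
      have h6 := mul_lt_mul_of_pos_left h3 hG
      rw [← e] at h6
      refine lt_of_mul_lt_mul_right (a := (M : ℝ) * (M + h)) ?_ (by positivity)
      convert h6 using 2
      ring

/-- `G` decreases from `M` on. -/
theorem G_succ_le (p : Params n h M k α t) {m : ℕ} (hm : M ≤ m) :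
    G n h M k α (m + 1) ≤ G n h M k α m := by
  have hk := p.k_pos
  have hMr := p.M_real
  have hh : (0 : ℝ) ≤ h := h.cast_nonneg
  have hα : (0 : ℝ) ≤ α := α.cast_nonneg
  have hG0 : 0 ≤ G n h M k α m := by
    rcases Nat.lt_or_ge (n + 1) (2 * m + h) with h1 | h1
    · rw [G_eq_zero h1]
    · exact (p.G_pos h1).le
  rcases Nat.lt_or_ge (n + 1) (2 * (m + 1) + h) with h1 | h1
  · rwa [G_eq_zero h1]
  rcases eq_or_lt_of_le hm with rfl | hlt
  · by_cases hw : k ^ 2 * M * (M + 1) ≤ (k * M + α + 1) * (k * M + α)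
    · have e := p.G_above_plus h1 hw
      have h6 := mul_le_mul_of_nonneg_left (p.P_le le_rfl (by omega)) hG0
      rw [← e] at h6
      exact le_of_mul_le_mul_right h6 (by positivity)
    · have e := p.G_above_minus h1 hw
      have h4 : (k : ℝ) * M ≤ k * M + α := by linarith
      have h7 : (0 : ℝ) ≤ ((n : ℝ) + 1 - h - 2 * M) * (n - h - 2 * M) := by
        have : 2 * ((M : ℝ) + 1) + h ≤ n + 1 := by exact_mod_cast h1
        exact mul_nonneg (by linarith) (by linarith)
      have h6 := mul_le_mul_of_nonneg_left (mul_le_mul h4 p.le_above (by positivity)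
        (by positivity)) hG0
      rw [← e] at h6
      exact le_of_mul_le_mul_right h6 (by positivity)
  · have e := p.G_succ (i := m) (by omega) (by omega) h1
    have h6 := mul_le_mul_of_nonneg_left (p.le_Q hlt (by omega)) hG0
    rw [← e] at h6
    refine le_of_mul_le_mul_right h6 ?_
    have hN := p.N_nat_ge h1
    have : (m : ℝ) + 1 ≤ (k + 1) * M + α := by exact_mod_cast hN
    exact mul_pos (by positivity) (by linarith)

theorem one_lt_RG_iff (p : Params n h M k α t) {m : ℕ} (hm : 2 * m + h ≤ n + 1) :
    1 < RG n h M k α m ↔ m < M := by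
  unfold RG
  rw [one_lt_div (p.G_pos hm)]
  constructor
  · intro h1
    by_contra! h2
    exact absurd (p.G_succ_le h2) (not_le.2 h1)
  · exact p.G_lt_succ

end Params

/-! ### Random tests -/

/-- The test `p` succeeds with probability `a` and fails with probability `1 - a`. -/
structure Bern (p : RAM Bool) (a : ℝ) : Prop where
  nonneg : 0 ≤ a
  le_one : a ≤ 1
  law : Law p fun f => ENNReal.ofReal a * f true + ENNReal.ofReal (1 - a) * f false

/-- A uniform variable on `{0, …, p-1}` is less than `q` with probability `q / p`. -/
theorem mean_lt {p q : ℕ} (hp : 0 < p) (hq : q ≤ p) (A B : ℝ≥0∞) :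
    (p : ℝ≥0∞)⁻¹ * ∑ v ∈ Finset.range p, (if (v : ℤ) < (q : ℤ) then A else B) =
      ENNReal.ofReal ((q : ℝ) / p) * A + ENNReal.ofReal (1 - (q : ℝ) / p) * B := by
  have hp' : (0 : ℝ) < p := by exact_mod_cast hp
  have h1 : ENNReal.ofReal ((q : ℝ) / p) = (p : ℝ≥0∞)⁻¹ * q := by
    rw [ENNReal.ofReal_div_of_pos hp', ENNReal.ofReal_natCast, ENNReal.ofReal_natCast,
      ENNReal.div_eq_inv_mul]
  have h2 : ENNReal.ofReal (1 - (q : ℝ) / p) = (p : ℝ≥0∞)⁻¹ * (p - q : ℕ) := by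
    rw [show 1 - (q : ℝ) / p = ((p - q : ℕ) : ℝ) / p by
      rw [Nat.cast_sub hq]; field_simp, ENNReal.ofReal_div_of_pos hp', ENNReal.ofReal_natCast,
      ENNReal.ofReal_natCast, ENNReal.div_eq_inv_mul]
  rw [h1, h2, mul_assoc, mul_assoc, ← mul_add]
  congr 1
  obtain ⟨r, rfl⟩ := Nat.exists_eq_add_of_le hq
  rw [Finset.sum_range_add]
  have e1 : ∑ x ∈ Finset.range q, (if (x : ℤ) < (q : ℤ) then A else B) = q * A := by
    rw [Finset.sum_congr rfl fun x hx => if_pos (by exact_mod_cast Finset.mem_range.1 hx)]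
    simp
  have e2 : ∑ x ∈ Finset.range r, (if ((q + x : ℕ) : ℤ) < (q : ℤ) then A else B) = r * B := by
    rw [Finset.sum_congr rfl fun x _ => if_neg (by push_cast; omega)]
    simp
  rw [e1, e2, Nat.add_sub_cancel_left]

theorem law_random_lt {β : Type} {P Q : ℤ} {g : ℤ → RAM β} {X Y : (β → ℝ≥0∞) → ℝ≥0∞}
    (hP : 0 < P) (hQ : 0 ≤ Q) (hQP : Q ≤ P)
    (h1 : ∀ v < Q, Law (g v) X) (h2 : ∀ v, Q ≤ v → Law (g v) Y) :
    Law (random P >>= g) fun f =>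
      ENNReal.ofReal ((Q : ℝ) / P) * X f + ENNReal.ofReal (1 - (Q : ℝ) / P) * Y f := by
  lift P to ℕ using hP.le
  lift Q to ℕ using hQ
  have := (law_random P).bind (g := g) (Y := fun v f => if v < Q then X f else Y f) fun v => by
    by_cases hv : v < Q
    · simpa only [hv, if_true] using h1 v hv
    · simpa only [hv, if_false] using h2 v (by omega)
  refine this.congr fun f => ?_
  simpa using mean_lt (by exact_mod_cast hP) (by exact_mod_cast hQP) (X f) (Y f)

theorem Bern.congr {p : RAM Bool} {a b : ℝ} (h : Bern p a) (hab : a = b) : Bern p b := hab ▸ h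

theorem Returns.bern {β : Type} {p : RAM β} {v : β} {g : β → RAM Bool} {a : ℝ} (hp : Returns p v)
    (hg : Bern (g v) a) : Bern (p >>= g) a := ⟨hg.nonneg, hg.le_one, hp.bind hg.law⟩

theorem bern_false : Bern (pure false) 0 := by
  refine ⟨le_rfl, zero_le_one, Law.congr (law_pure false) fun f => by simp⟩

theorem bern_true : Bern (pure true) 1 := by
  refine ⟨zero_le_one, le_rfl, Law.congr (law_pure true) fun f => by simp⟩

theorem Bern.and {p q : RAM Bool} {a b : ℝ} (hp : Bern p a) (hq : Bern q b) :
    Bern (p >>= fun x => if x then q else pure false) (a * b) := by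
  refine ⟨mul_nonneg hp.nonneg hq.nonneg, mul_le_one₀ hp.le_one hq.nonneg hq.le_one, ?_⟩
  refine (hp.law.bind (Y := fun x f => if x then ENNReal.ofReal b * f true +
    ENNReal.ofReal (1 - b) * f false else f false) fun x => ?_).congr fun f => ?_
  · cases x
    · exact law_pure false
    · exact hq.law
  · simp only [if_true, Bool.false_eq_true, if_false]
    have e : ENNReal.ofReal (1 - a * b) =
        ENNReal.ofReal a * ENNReal.ofReal (1 - b) + ENNReal.ofReal (1 - a) := by
      rw [← ENNReal.ofReal_mul hp.nonneg, ← ENNReal.ofReal_add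
        (mul_nonneg hp.nonneg (by linarith [hq.le_one])) (by linarith [hp.le_one])]
      congr 1
      ring
    rw [e, ENNReal.ofReal_mul hp.nonneg]
    ring

theorem Bern.prob_true {p : RAM Bool} {a : ℝ} (h : Bern p a) : prob p true = ENNReal.ofReal a := by
  rw [h.law.prob_eq]
  simp

theorem Bern.prob_false {p : RAM Bool} {a : ℝ} (h : Bern p a) :
    prob p false = ENNReal.ofReal (1 - a) := by
  rw [h.law.prob_eq]
  simp

/-- The test `[P, Q]` has the success probability `x / y = Q / P`. -/
theorem bern_flip {P Q : ℤ} {x y : ℝ} (hP : (0 : ℝ) < P) (hQ : (0 : ℝ) ≤ Q) (hQP : (Q : ℝ) ≤ P)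
    (hy : 0 < y) (h : y * Q = x * P) : Bern (flip P Q) (x / y) := by
  have hxy : x / y = (Q : ℝ) / P := by
    rw [div_eq_div_iff hy.ne' hP.ne', ← h, mul_comm]
  rw [hxy]
  refine ⟨by positivity, (div_le_one hP).2 hQP, ?_⟩
  refine law_random_lt (by exact_mod_cast hP) (by exact_mod_cast hQ) (by exact_mod_cast hQP)
    (fun v hv => ?_) fun v hv => ?_
  · have := law_lt v Q
    rwa [decide_eq_true hv] at this
  · have := law_lt v Q
    rwa [decide_eq_false (by omega)] at this

/-- Consecutive tests whose success probabilities are quotients of consecutive terms of `g`. -/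
theorem bern_allFrom {test : ℤ → RAM Bool} (g : ℕ → ℝ) :
    ∀ j i : ℕ, (∀ l, i ≤ l → l ≤ i + j → g l ≠ 0) →
      (∀ l, i ≤ l → l < i + j → Bern (test l) (g l / g (l + 1))) →
      Bern (allFrom test j i) (g i / g (i + j)) := by
  intro j
  induction j with
  | zero =>
    intro i h0 _
    rw [Nat.add_zero, div_self (h0 i le_rfl (by omega))]
    exact ⟨zero_le_one, le_rfl, Law.congr (law_unitOp true) fun f => by simp⟩
  | succ j ih =>
    intro i h0 h
    have h1 := ih (i + 1) (fun l a b => h0 l (by omega) (by omega))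
      fun l a b => h l (by omega) (by omega)
    refine ((law_unitOp ()).bern ((h i le_rfl (by omega)).and
      ((law_add _ _).bern (g := fun i' => allFrom test j i') h1))).congr ?_
    have := h0 (i + 1) (by omega) (by omega)
    rw [show i + 1 + j = i + (j + 1) by ring, div_mul_div_cancel₀ this]

/-! ### The law of the extended binomial generator -/

/-- The law of the count after `j` draws, starting from the count `m`. -/
theorem law_binomial (k : ℕ) : ∀ (j : ℕ) (i m : ℤ),
    Law (forFrom (fun _ m => do
      let v ← random ((k : ℤ) + 1)
      let b ← eq v 0
      if b then add m 1 else pure m) j i m) fun f =>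
      ((k : ℝ≥0∞) + 1)⁻¹ ^ j * ∑ l ∈ Finset.HasAntidiagonal.antidiagonal j,
        (j.choose l.1 : ℝ≥0∞) * ((k : ℝ≥0∞) ^ l.2 * f (m + l.1)) := by
  intro j
  induction j with
  | zero => 
    intro i m
    exact Law.congr (law_unitOp m) fun f => by simp
  | succ j ih =>
    intro i m
    have hbody : ∀ m : ℤ, Law (do
        let v ← random ((k : ℤ) + 1)
        let b ← eq v 0
        if b then add m 1 else pure m) fun f =>
        ((k : ℝ≥0∞) + 1)⁻¹ * (f (m + 1) + k * f m) := by
      intro m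
      refine ((law_random (k + 1)).bind (Y := fun v f => if v = 0 then f (m + 1) else f m)
        fun v => ?_).congr fun f => ?_
      · by_cases hv : v = 0
        · have := (law_eq v 0).bind (g := fun b => if b then add m 1 else pure m)
            (Y := fun f => f (m + 1)) (by simp only [hv, decide_true, if_true]; exact law_add m 1)
          simpa [hv] using this
        · have := (law_eq v 0).bind (g := fun b => if b then add m 1 else pure m)
            (Y := fun f => f m) (by simp only [hv, decide_false]; exact law_pure m)
          simpa [hv] using this
      · rw [Finset.sum_range_succ']
        simp only [Nat.cast_add, Nat.cast_one, Nat.cast_zero, if_true]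
        rw [Finset.sum_congr rfl fun x _ => if_neg (by omega)]
        simp [add_comm]
    refine ((law_unitOp ()).bind ((hbody m).bind fun m' =>
      (law_add i 1).bind (ih (i + 1) m'))).congr fun f => ?_
    rw [Finset.sum_antidiagonal_choose_succ_mul
      (fun a b => (k : ℝ≥0∞) ^ b * f (m + (a : ℤ))) j, pow_succ, mul_comm (_ ^ j), mul_assoc]
    congr 1
    rw [mul_left_comm, ← mul_add]
    congr 1
    rw [add_comm]
    congr 1
    · rw [Finset.mul_sum]
      refine Finset.sum_congr rfl fun l _ => ?_
      ring
    · refine Finset.sum_congr rfl fun l hl => ?_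
      rw [Finset.HasAntidiagonal.mem_antidiagonal] at hl
      rw [Nat.choose_symm_of_eq_add hl.symm]
      congr 3
      push_cast
      ring

/-- The binomial theorem. -/
theorem sum_Bund (M k α : ℕ) :
    ∑ m ∈ Finset.range ((k + 1) * M + α + 1), Bund M k α m = ((k : ℝ) + 1) ^ ((k + 1) * M + α) := by
  rw [add_comm (k : ℝ) 1, add_pow]
  refine Finset.sum_congr rfl fun m _ => ?_
  simp [Bund]

/-- The number of zeros among `N` draws is distributed according to the binomial weights. -/
theorem law_count (M k α : ℕ) :
    Law (forLoop 1 ((k + 1 : ℤ) * M + α) (0 : ℤ) (fun _ m => do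
      let v ← random ((k : ℤ) + 1)
      let b ← eq v 0
      if b then add m 1 else pure m)) fun f =>
      ∑ m ∈ Finset.range ((k + 1) * M + α + 1),
        ENNReal.ofReal (Bund M k α m / ((k : ℝ) + 1) ^ ((k + 1) * M + α)) * f m := by
  have hN : ((k + 1 : ℤ) * M + α + 1 - 1).toNat = (k + 1) * M + α := by
    rw [show (k + 1 : ℤ) * M + α + 1 - 1 = (((k + 1) * M + α : ℕ) : ℤ) by push_cast; ring]
    exact Int.toNat_natCast _
  unfold forLoop
  rw [hN]
  refine (law_binomial k _ 1 0).congr fun f => ?_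
  set N := (k + 1) * M + α
  rw [Finset.mul_sum, Finset.Nat.sum_antidiagonal_eq_sum_range_succ_mk]
  refine Finset.sum_congr rfl fun m _ => ?_
  have hpos : (0 : ℝ) < ((k : ℝ) + 1) ^ N := by positivity
  have : ENNReal.ofReal (Bund M k α m / ((k : ℝ) + 1) ^ N) =
      ((k : ℝ≥0∞) + 1)⁻¹ ^ N * ((N.choose m : ℝ≥0∞) * (k : ℝ≥0∞) ^ (N - m)) := by
    rw [ENNReal.ofReal_div_of_pos hpos, ENNReal.div_eq_inv_mul, ENNReal.ofReal_pow (by positivity),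
      ENNReal.inv_pow, ENNReal.ofReal_add (by positivity) zero_le_one]
    unfold Bund
    rw [ENNReal.ofReal_mul (by positivity), ENNReal.ofReal_pow (by positivity)]
    simp only [ENNReal.ofReal_natCast, ENNReal.ofReal_one]
    rw [mul_comm (_ ^ (N - m))]
  rw [this]
  simp only [zero_add, mul_assoc]

/-- One iteration of the extended binomial generator. -/
noncomputable def genBody (M k α k1 N : ℤ) (which : Which) : RAM (Unit ⊕ ℤ) := do
  let m ← forLoop 1 N (0 : ℤ) (fun _ m => do
    let v ← random k1
    let b ← eq v 0
    if b then add m 1 else pure m)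
  let b ← eq m M
  if b then
    match which with
    | .plus => do
        let M1 ← add M 1
        let r ← mul k M1
        let v ← random r
        let kM ← mul k M
        let u ← add kM α
        let rej ← le u v
        pure (if rej then .inl () else .inr m)
    | .minus => do
        let kM ← mul k M
        let u ← add kM α
        let u1 ← add u 1
        let v ← random u1
        let rej ← le kM v
        pure (if rej then .inl () else .inr m)
  else pure (.inr m)

theorem extendedBin_eq (M k α : ℤ) (which : Which) : extendedBin M k α which = (do
    let k1 ← add k 1
    let k1M ← mul k1 M
    let N ← add k1M α
    loop (fun _ => genBody M k α k1 N which) ()) := rfl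

namespace Params

variable {n h M k α : ℕ} {t : ℝ}

theorem α_real (p : Params n h M k α t) : (α : ℝ) + 1 ≤ k := by exact_mod_cast p.α_lt

theorem B_self_le (p : Params n h M k α t) : B M k α M ≤ Bund M k α M := by
  have hk := p.k_pos
  have hM := p.M_real
  have hα := p.α_real
  have h0 : (0 : ℝ) ≤ α := α.cast_nonneg
  have h1 := Bund_nonneg M k α M
  rw [B_self]
  refine max_le ?_ ?_
  · have e : Bund M k α (M - 1) * (k * M + α + 1) ≤ Bund M k α M * (k * M + α + 1) := by
      rw [← p.Bund_below]
      exact mul_le_mul_of_nonneg_left (by linarith) h1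
    exact le_of_mul_le_mul_right e (by positivity)
  · have e : Bund M k α (M + 1) * (k * (M + 1)) ≤ Bund M k α M * (k * (M + 1)) := by
      rw [p.Bund_above]
      exact mul_le_mul_of_nonneg_left (by linarith) h1
    exact le_of_mul_le_mul_right e (by positivity)

/-- The modification at `M` keeps a fixed proportion of the weight, so that the generator needs a
bounded expected number of iterations. -/
theorem B_self_ge (p : Params n h M k α t) : 2 / 3 * Bund M k α M ≤ B M k α M := by
  have hk := p.k_pos
  have hM := p.M_real
  have h0 : (0 : ℝ) ≤ α := α.cast_nonneg
  have h1 := Bund_nonneg M k α M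
  rw [B_self]
  refine le_max_of_le_right ?_
  have e : (2 / 3 * Bund M k α M) * (k * (M + 1)) ≤ Bund M k α (M + 1) * (k * (M + 1)) := by
    rw [p.Bund_above, mul_comm (2 / 3 : ℝ), mul_assoc]
    exact mul_le_mul_of_nonneg_left (by nlinarith) h1
  exact le_of_mul_le_mul_right e (by positivity)

/-- The law of one iteration of the generator: it is repeated with the probability that is missing
from the total mass of `B`. -/
theorem law_genBody (p : Params n h M k α t) :
    Law (genBody M k α (k + 1) ((k + 1 : ℤ) * M + α) (whichOf M k α)) fun f =>
      ENNReal.ofReal ((Bund M k α M - B M k α M) / ((k : ℝ) + 1) ^ ((k + 1) * M + α)) *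
        f (.inl ()) +
      ∑ m ∈ Finset.range ((k + 1) * M + α + 1),
        ENNReal.ofReal (B M k α m / ((k : ℝ) + 1) ^ ((k + 1) * M + α)) * f (.inr m) := by
  have hk := p.k_pos
  have hM := p.M_real
  have hα := p.α_real
  have h0 : (0 : ℝ) ≤ α := α.cast_nonneg
  have hN := p.M_lt_N
  have hb : 0 < Bund M k α M := Bund_pos p.one_le_k (by omega)
  have hBle := p.B_self_le
  have hBge := p.B_self_ge
  set K := ((k : ℝ) + 1) ^ ((k + 1) * M + α) with hK
  have hKpos : 0 < K := by positivity
  set θ := B M k α M / Bund M k α M with hθ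
  unfold genBody
  refine ((law_count M k α).bind (Y := fun m f => if m = (M : ℤ) then
    ENNReal.ofReal θ * f (.inr m) + ENNReal.ofReal (1 - θ) * f (.inl ()) else f (.inr m))
    fun m => ?_).congr fun f => ?_
  · by_cases hm : m = M
    · subst hm
      simp only [if_true]
      refine (law_eq _ _).bind ?_
      simp only [decide_true, if_true]
      by_cases hw : k ^ 2 * M * (M + 1) ≤ (k * M + α + 1) * (k * M + α)
      · rw [whichOf_plus hw]
        have hθ' : θ = (((k : ℤ) * M + α : ℤ) : ℝ) / (((k : ℤ) * (M + 1) : ℤ) : ℝ) := by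
          push_cast
          rw [hθ, p.B_plus hw, div_eq_div_iff hb.ne' (by positivity), p.Bund_above]
          ring
        rw [hθ']
        refine (law_add _ _).bind ((law_mul _ _).bind (law_random_lt ?_ ?_ ?_ ?_ ?_))
        · exact_mod_cast (by positivity : (0 : ℝ) < k * (M + 1))
        · positivity
        · exact_mod_cast (by linarith : (k : ℝ) * M + α ≤ k * (M + 1))
        · intro v hv
          refine (law_mul _ _).bind ((law_add _ _).bind ((law_le _ _).bind ?_))
          rw [decide_eq_false (by omega)]
          exact law_pure _
        · intro v hv
          refine (law_mul _ _).bind ((law_add _ _).bind ((law_le _ _).bind ?_))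
          rw [decide_eq_true hv]
          exact law_pure _
      · rw [whichOf_minus hw]
        have hθ' : θ = (((k : ℤ) * M : ℤ) : ℝ) / (((k : ℤ) * M + α + 1 : ℤ) : ℝ) := by
          push_cast
          rw [hθ, p.B_minus hw, div_eq_div_iff hb.ne' (by positivity), ← p.Bund_below]
          ring
        rw [hθ']
        refine (law_mul _ _).bind ((law_add _ _).bind ((law_add _ _).bind
          (law_random_lt ?_ ?_ ?_ ?_ ?_)))
        · positivity
        · positivity
        · linarith [(Nat.cast_nonneg α : (0 : ℤ) ≤ α)]
        · intro v hv
          refine (law_le _ _).bind ?_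
          rw [decide_eq_false (by omega)]
          exact law_pure _
        · intro v hv
          refine (law_le _ _).bind ?_
          rw [decide_eq_true hv]
          exact law_pure _
    · simp only [hm, if_false]
      refine (law_eq _ _).bind ?_
      rw [decide_eq_false hm]
      exact law_pure _
  · have hmem : M ∈ Finset.range ((k + 1) * M + α + 1) := Finset.mem_range.2 (by omega)
    rw [← Finset.add_sum_erase _ _ hmem, ← Finset.add_sum_erase _ _ hmem, ← add_assoc]
    congr 1
    · simp only [if_true]
      rw [mul_add, ← mul_assoc, ← mul_assoc,
        ← ENNReal.ofReal_mul (by positivity), ← ENNReal.ofReal_mul (by positivity), add_comm]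
      congr 3
      · rw [hθ, hK]; field_simp
      · rw [hθ, hK]; field_simp
    · refine Finset.sum_congr rfl fun m hm => ?_
      have hne := Finset.ne_of_mem_erase hm
      simp only [Nat.cast_inj, hne, if_false, B_of_ne hne, hK]

theorem Btot_eq (p : Params n h M k α t) :
    Btot M k α = ((k : ℝ) + 1) ^ ((k + 1) * M + α) - (Bund M k α M - B M k α M) := by
  have hN := p.M_lt_N
  have hmem : M ∈ Finset.range ((k + 1) * M + α + 1) := Finset.mem_range.2 (by omega)
  rw [← sum_Bund, Btot, ← Finset.add_sum_erase _ _ hmem, ← Finset.add_sum_erase _ _ hmem,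
    Finset.sum_congr rfl fun m hm => B_of_ne (Finset.ne_of_mem_erase hm)]
  ring

theorem Btot_pos (p : Params n h M k α t) : 0 < Btot M k α := by
  refine Finset.sum_pos (fun m hm => p.B_pos ?_) ⟨0, by simp⟩
  have := Finset.mem_range.1 hm
  omega

/-- The probability that one iteration of the generator returns a value. -/
theorem one_sub_genBody (p : Params n h M k α t) :
    1 - ENNReal.ofReal ((Bund M k α M - B M k α M) / ((k : ℝ) + 1) ^ ((k + 1) * M + α)) =
      ENNReal.ofReal (Btot M k α / ((k : ℝ) + 1) ^ ((k + 1) * M + α)) := by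
  have hK : (0 : ℝ) < ((k : ℝ) + 1) ^ ((k + 1) * M + α) := by positivity
  rw [← ENNReal.ofReal_one, ← ENNReal.ofReal_sub _ (div_nonneg (sub_nonneg.2 p.B_self_le) hK.le),
    p.Btot_eq]
  congr 1
  field_simp

theorem law_extendedBin (p : Params n h M k α t) :
    Law (extendedBin M k α (whichOf M k α)) fun f =>
      ∑ m ∈ Finset.range ((k + 1) * M + α + 1),
        ENNReal.ofReal (B M k α m / Btot M k α) * f m := by
  rw [extendedBin_eq]
  refine (law_add _ _).bind ((law_mul _ _).bind ((law_add _ _).bind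
    ((law_loop (Y := fun f => ∑ m ∈ Finset.range ((k + 1) * M + α + 1),
        ENNReal.ofReal (B M k α m / ((k : ℝ) + 1) ^ ((k + 1) * M + α)) * f (m : ℤ))
      p.law_genBody).congr fun f => ?_)))
  have hK : (0 : ℝ) < ((k : ℝ) + 1) ^ ((k + 1) * M + α) := by positivity
  have hB := p.Btot_pos
  rw [p.one_sub_genBody, ← ENNReal.ofReal_inv_of_pos (by positivity), Finset.mul_sum]
  refine Finset.sum_congr rfl fun m _ => ?_
  rw [← mul_assoc, ← ENNReal.ofReal_mul (by positivity)]
  congr 2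
  field_simp

theorem prob_extendedBin (p : Params n h M k α t) (m : ℕ) :
    prob (extendedBin M k α (whichOf M k α)) (m : ℤ) =
      ENNReal.ofReal (B M k α m / Btot M k α) := by
  rw [p.law_extendedBin.prob_eq]
  simp only [Nat.cast_inj, mul_ite, mul_one, mul_zero, Finset.sum_ite_eq', Finset.mem_range]
  split_ifs with hm
  · rfl
  · have hN := p.M_lt_N
    rw [B_of_ne (by omega), Bund, Nat.choose_eq_zero_of_lt (by omega)]
    simp

end Params

/-! ### The acceptance tests -/

theorem law_numF (n h i : ℤ) : Returns (numF n h i) ((n - h - 2 * i + 1) * (n - h - 2 * i)) :=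
  (law_mul _ _).bind ((law_sub _ _).bind ((law_sub _ _).bind ((law_add _ _).bind (law_mul _ _))))

theorem law_denF (h i : ℤ) : Returns (denF h i) ((i + 1) * (i + 1 + h)) :=
  (law_add _ _).bind ((law_add _ _).bind (law_mul _ _))

theorem law_denG (h M k α i : ℤ) :
    Returns (denG h M k α i) ((i + 1 + h) * ((k + 1) * M + α - i)) :=
  (law_add _ _).bind ((law_add _ _).bind ((law_add _ _).bind ((law_mul _ _).bind
    ((law_add _ _).bind ((law_sub _ _).bind (law_mul _ _))))))

namespace Params

variable {n h M k α : ℕ} {t : ℝ}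

/-- The tests for `i = M - 1` succeed with the probability given by the ratio of `G` there; in case `+`
this ratio is a product of two quotients, each of which is tested separately. -/
theorem bern_testBelow (p : Params n h M k α t) :
    Bern (testBelow n h M k α (whichOf M k α)) (G n h M k α (M - 1) / G n h M k α M) := by
  have hk := p.k_pos
  have hM := p.M_real
  have hα := p.α_real
  have h0 : (0 : ℝ) ≤ α := α.cast_nonneg
  have hh : (0 : ℝ) ≤ h := h.cast_nonneg
  have hG := p.G_pos p.two_mul_M_le
  by_cases hw : k ^ 2 * M * (M + 1) ≤ (k * M + α + 1) * (k * M + α)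
  · rw [whichOf_plus hw]
    have hb := p.below_lt
    set P := ((n : ℝ) + 1 - h - 2 * (M - 1 : ℝ)) * (n - h - 2 * (M - 1 : ℝ)) with hP
    have hPpos : 0 < (k : ℝ) * P := lt_of_le_of_lt (by positivity) hb
    have b1 : Bern (flip ((k : ℤ) * (M + 1)) ((k : ℤ) * M + α + 1))
        (((k : ℝ) * M + α + 1) / (k * (M + 1))) := by
      apply bern_flip
      · push_cast; positivity
      · push_cast; positivity
      · push_cast; linarith
      · positivity
      · push_cast; ring
    have b2 : Bern (flip ((k : ℤ) * (((n : ℤ) - h - 2 * (M - 1) + 1) * (n - h - 2 * (M - 1))))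
        (((M : ℤ) + h) * (k * M + α))) ((((M : ℝ) + h) * (k * M + α)) / (k * P)) := by
      have e : (((k : ℤ) * (((n : ℤ) - h - 2 * (M - 1) + 1) * (n - h - 2 * (M - 1))) : ℤ) : ℝ) =
          k * P := by
        rw [hP]; push_cast; ring
      apply bern_flip
      · rw [e]; exact hPpos
      · push_cast; positivity
      · rw [e]; push_cast; exact hb.le
      · exact hPpos
      · rw [e]; push_cast; ring
    refine Bern.congr ((law_add _ _).bern ((law_mul _ _).bern ((law_mul _ _).bern
      ((law_add _ _).bern ((law_add _ _).bern (b1.and ((law_sub _ _).bern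
      ((law_numF _ _ _).bern ((law_mul _ _).bern ((law_add _ _).bern
      ((law_mul _ _).bern b2))))))))))) ?_
    rw [div_mul_div_comm, div_eq_div_iff (by positivity) hG.ne', mul_comm, p.G_below_plus hw]
  · rw [whichOf_minus hw]
    have hb := p.lt_P (i := M - 1) (by have := p.two_le_M; omega)
    rw [p.cast_pred] at hb
    have e := p.G_below_minus hw
    refine (law_sub _ _).bern ((law_numF _ _ _).bern ((law_denF _ _).bern (bern_flip ?_ ?_ ?_ hG ?_)))
    · push_cast
      have : 0 < ((M : ℝ) - 1 + 1) * (M - 1 + 1 + h) :=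
        mul_pos (by linarith) (by linarith)
      linarith
    · push_cast
      exact mul_nonneg (by linarith) (by linarith)
    · push_cast
      linarith
    · push_cast
      linear_combination e

/-- The tests for `i = M` succeed with the probability given by the inverse ratio of `G` there. -/
theorem bern_testAbove (p : Params n h M k α t) (hM' : 2 * (M + 1) + h ≤ n + 1) :
    Bern (testAbove n h M k α (whichOf M k α)) (G n h M k α (M + 1) / G n h M k α M) := by
  have hk := p.k_pos
  have hM := p.M_real
  have h0 : (0 : ℝ) ≤ α := α.cast_nonneg
  have hh : (0 : ℝ) ≤ h := h.cast_nonneg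
  have hG := p.G_pos p.two_mul_M_le
  have hP0 : (0 : ℝ) ≤ ((n : ℝ) + 1 - h - 2 * M) * (n - h - 2 * M) := by
    have : 2 * ((M : ℝ) + 1) + h ≤ n + 1 := by exact_mod_cast hM'
    exact mul_nonneg (by linarith) (by linarith)
  by_cases hw : k ^ 2 * M * (M + 1) ≤ (k * M + α + 1) * (k * M + α)
  · rw [whichOf_plus hw]
    have hb := p.P_le le_rfl p.two_mul_M_le
    have e := p.G_above_plus hM' hw
    refine (law_denF _ _).bern ((law_numF _ _ _).bern (bern_flip ?_ ?_ ?_ hG ?_))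
    · push_cast; positivity
    · push_cast; linarith
    · push_cast; linarith
    · push_cast; linear_combination -e
  · rw [whichOf_minus hw]
    have hb := p.le_above
    set P := ((n : ℝ) + 1 - h - 2 * M) * (n - h - 2 * M) with hP
    have b1 : Bern (flip ((k : ℤ) * M + α) ((k : ℤ) * M)) (((k : ℝ) * M) / (k * M + α)) := by
      apply bern_flip
      · push_cast; positivity
      · push_cast; positivity
      · push_cast; linarith
      · positivity
      · push_cast; ring
    have b2 : Bern (flip (((M : ℤ) + h + 1) * (k * M + α + 1))
        ((k : ℤ) * (((n : ℤ) - h - 2 * M + 1) * (n - h - 2 * M))))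
        ((k * P) / (((M : ℝ) + h + 1) * (k * M + α + 1))) := by
      have e : (((k : ℤ) * (((n : ℤ) - h - 2 * M + 1) * (n - h - 2 * M)) : ℤ) : ℝ) =
          k * P := by
        rw [hP]; push_cast; ring
      apply bern_flip
      · push_cast; positivity
      · rw [e]; positivity
      · rw [e]; push_cast; exact hb
      · positivity
      · rw [e]; push_cast; ring
    refine Bern.congr ((law_mul _ _).bern ((law_add _ _).bern (b1.and ((law_add _ _).bern
      ((law_add _ _).bern ((law_add _ _).bern ((law_mul _ _).bern ((law_numF _ _ _).bern
      ((law_mul _ _).bern b2))))))))) ?_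
    rw [div_mul_div_comm, div_eq_div_iff (by positivity) hG.ne', p.G_above_minus hM' hw, mul_comm]

/-- A value `m` is accepted with probability `G m / G M`. -/
theorem bern_acceptM (p : Params n h M k α t) (m : ℕ) :
    Bern (acceptM n h M k α (whichOf M k α) m) (G n h M k α m / G n h M k α M) := by
  have hG := p.G_pos p.two_mul_M_le
  have h2 := p.two_le_M
  have h2M := p.two_mul_M_le
  have hk := p.k_pos
  have hMr := p.M_real
  have h0 : (0 : ℝ) ≤ α := α.cast_nonneg
  have hh : (0 : ℝ) ≤ h := h.cast_nonneg
  refine (law_mul _ _).bern ((law_sub _ _).bern ((law_add _ _).bern ((law_lt _ _).bern ?_)))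
  rcases Nat.lt_or_ge (n + 1) (2 * m + h) with hm | hm
  · rw [decide_eq_true (by omega), if_pos rfl, G_eq_zero hm, zero_div]
    exact bern_false
  rw [decide_eq_false (by omega), if_neg Bool.false_ne_true]
  refine (law_lt _ _).bern ?_
  rcases lt_trichotomy m M with hlt | rfl | hlt
  · rw [decide_eq_true (by omega), if_pos rfl]
    have b : Bern (forAll (m : ℤ) ((M : ℤ) - 2) fun i => do
        let nf ← numF n h i
        let p ← mul k nf
        let q ← denG h M k α i
        flip p q) (G n h M k α m / G n h M k α (M - 1)) := by
      unfold forAll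
      rw [show ((M : ℤ) - 2 + 1 - m).toNat = M - 1 - m by omega]
      have := bern_allFrom (test := fun i => do
        let nf ← numF n h i
        let p ← mul k nf
        let q ← denG h M k α i
        flip p q) (fun i => G n h M k α i) (M - 1 - m) m
        (fun l h1 h3 => (p.G_pos (by omega)).ne') fun l h1 h3 => ?_
      · rwa [show m + (M - 1 - m) = M - 1 by omega] at this
      · have e := p.G_succ (i := l) (by omega) (by omega) (by omega)
        have hQ := p.Q_lt (i := l) (by omega)
        have hN : (l : ℝ) + 1 ≤ (k + 1) * M + α := by
          have := p.M_lt_N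
          exact_mod_cast (by omega : l + 1 ≤ (k + 1) * M + α)
        have hQ0 : 0 < ((l : ℝ) + 1 + h) * ((k + 1) * M + α - l) :=
          mul_pos (by positivity) (by linarith)
        refine (law_numF _ _ _).bern ((law_mul _ _).bern ((law_denG _ _ _ _ _).bern
          (bern_flip ?_ ?_ ?_ (p.G_pos (by omega)) ?_)))
        · push_cast; linarith
        · push_cast; linarith
        · push_cast; linarith
        · push_cast; linear_combination e
    refine Bern.congr (p.bern_testBelow.and ((law_sub _ _).bern b)) ?_
    rw [mul_comm, div_mul_div_cancel₀ (p.G_pos (by omega)).ne']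
  · rw [decide_eq_false (by omega), if_neg Bool.false_ne_true]
    refine (law_lt _ _).bern ?_
    rw [decide_eq_false (by omega), if_neg Bool.false_ne_true, div_self hG.ne']
    exact bern_true
  · rw [decide_eq_false (by omega), if_neg Bool.false_ne_true]
    refine (law_lt _ _).bern ?_
    rw [decide_eq_true (by omega), if_pos rfl]
    have b : Bern (forAll ((M : ℤ) + 1) ((m : ℤ) - 1) fun i => do
        let p ← denG h M k α i
        let nf ← numF n h i
        let q ← mul k nf
        flip p q) (G n h M k α m / G n h M k α (M + 1)) := by
      unfold forAll
      rw [show ((m : ℤ) - 1 + 1 - ((M : ℤ) + 1)).toNat = m - (M + 1) by omega]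
      have := bern_allFrom (test := fun i => do
        let p ← denG h M k α i
        let nf ← numF n h i
        let q ← mul k nf
        flip p q) (fun i => (G n h M k α i)⁻¹) (m - (M + 1)) (M + 1)
        (fun l h1 h3 => (inv_pos.2 (p.G_pos (by omega))).ne') fun l h1 h3 => ?_
      · rw [show M + 1 + (m - (M + 1)) = m by omega, inv_div_inv] at this
        exact_mod_cast this
      · have e := p.G_succ (i := l) (by omega) (by omega) (by omega)
        have hQ := p.le_Q (i := l) (by omega) (by omega)
        have hN : (l : ℝ) + 1 ≤ (k + 1) * M + α := by
          exact_mod_cast p.N_nat_ge (by omega : 2 * (l + 1) + h ≤ n + 1)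
        have hQ0 : 0 < ((l : ℝ) + 1 + h) * ((k + 1) * M + α - l) :=
          mul_pos (by positivity) (by linarith)
        have hP0 : (0 : ℝ) ≤ ((n : ℝ) + 1 - h - 2 * l) * (n - h - 2 * l) := by
          have : 2 * ((l : ℝ) + 1) + h ≤ n + 1 := by
            exact_mod_cast (by omega : 2 * (l + 1) + h ≤ n + 1)
          exact mul_nonneg (by linarith) (by linarith)
        have hP1 := mul_nonneg (show (0 : ℝ) ≤ k by linarith) hP0
        rw [inv_div_inv]
        refine (law_denG _ _ _ _ _).bern ((law_numF _ _ _).bern ((law_mul _ _).bern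
          (bern_flip ?_ ?_ ?_ (p.G_pos (by omega)) ?_)))
        · push_cast; linarith
        · push_cast; linarith
        · push_cast; linarith
        · push_cast; linear_combination -e
    refine Bern.congr ((p.bern_testAbove (by omega)).and ((law_add _ _).bern
      ((law_sub _ _).bern b))) ?_
    rw [mul_comm, div_mul_div_cancel₀ (p.G_pos (by omega)).ne']

theorem F_div_Bbar (n h M k α m : ℕ) :
    F n h m / Bbar n h M k α m = G n h M k α m / G n h M k α M := by
  unfold Bbar G
  rw [div_div_div_eq, ← mul_div_assoc, div_div_eq_mul_div]

/-! ### The law of the accepted value -/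

theorem law_computeM (p : Params n h M k α t) : Returns (computeM n h) (M : ℤ) := by
  refine law_loop_search M (fun i hi => ?_) ?_
  · refine (law_numF _ _ _).bind ((law_denF _ _).bind ((law_le _ _).bind ?_))
    have h1 := p.lt_P hi
    have h2 : ((i : ℤ) + 1) * (i + 1 + h) < ((n : ℤ) + 1 - h - 2 * i) * (n - h - 2 * i) := by
      exact_mod_cast h1
    rw [decide_eq_false (by rw [not_le]; linarith), if_neg Bool.false_ne_true]
    exact (law_add _ _).bind (law_pure _)
  · refine (law_numF _ _ _).bind ((law_denF _ _).bind ((law_le _ _).bind ?_))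
    have h1 := p.P_le le_rfl p.two_mul_M_le
    have h2 : ((n : ℤ) + 1 - h - 2 * M) * (n - h - 2 * M) ≤ ((M : ℤ) + 1) * (M + 1 + h) := by
      exact_mod_cast h1
    rw [decide_eq_true (by linarith), if_pos rfl]
    exact law_pure _

theorem law_computeTilde (n h : ℕ) : Returns (computeTilde n h) (mTilde n h) := by
  refine Returns.congr ((law_rofInt _).bind ((law_rofInt _).bind ((law_rmul _ _).bind
    ((law_rmul _ _).bind ((law_rmul _ _).bind ((law_rmul _ _).bind ((law_rmul _ _).bind
    ((law_radd _ _).bind ((law_radd _ _).bind ((law_rsub _ _).bind ((law_rsqrt _).bind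
    ((law_radd _ _).bind ((law_rsub _ _).bind ((law_rsub _ _).bind
    (law_rdiv _ _)))))))))))))) ) ?_
  unfold mTilde
  push_cast
  congr 3
  ring_nf

theorem law_computeK (n h : ℕ) : Returns (computeK n h (mTilde n h)) (parK n h) :=
  Returns.congr ((law_rofInt _).bind ((law_rofInt _).bind ((law_radd _ _).bind
    ((law_rsub _ _).bind ((law_rmul _ _).bind ((law_rdiv _ _).bind ((law_rceil _).bind
    (law_sub _ _)))))))) (by unfold parK; push_cast; rfl)

theorem law_computeAlpha (n h M k : ℕ) (hM : argM n h = M) (hk : (k : ℤ) = parK n h) :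
    Returns (computeAlpha M k (mTilde n h)) (parAlpha n h) := by
  refine Returns.congr ((law_rofInt _).bind ((law_rofInt _).bind ((law_rsub _ _).bind
    ((law_rmul _ _).bind ((law_rceil _).bind ((law_sub _ _).bind ((law_sub _ _).bind
    ((law_le _ _).bind (law_pure _))))))))) ?_
  unfold parAlpha
  rw [hM, ← hk]
  have e : ⌊((k : ℤ) : ℝ) - ((k : ℤ) : ℝ) * (M - mTilde n h)⌋ =
      (k : ℤ) - ⌈(k : ℝ) * (M - mTilde n h)⌉ := by
    rw [sub_eq_add_neg, Int.floor_intCast_add, Int.floor_neg]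
    push_cast
    ring
  rw [e]
  push_cast
  by_cases hc : (k : ℤ) - ⌈(k : ℝ) * (M - mTilde n h)⌉ ≤ k - 1
  · simp only [hc, decide_true, if_true]
    exact (min_eq_right hc).symm
  · simp only [hc, decide_false, Bool.false_eq_true, if_false]
    exact (min_eq_left (not_le.1 hc).le).symm

theorem law_computeWhich (M k α : ℤ) : Returns (computeWhich M k α) (whichOf M k α) := by
  refine Returns.congr ((law_mul _ _).bind ((law_add _ _).bind ((law_add _ _).bind
    ((law_mul _ _).bind ((law_add _ _).bind ((law_mul _ _).bind ((law_mul _ _).bind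
    ((law_le _ _).bind (law_pure _))))))))) ?_
  unfold whichOf
  rw [show k * M * (k * (M + 1)) = k ^ 2 * M * (M + 1) by ring]
  simp

end Params

/-- One iteration of the main loop: draw `m` and test it. -/
noncomputable def mainBody (n h M k α : ℤ) (which : Which) : RAM (Unit ⊕ ℤ) := do
  let m ← extendedBin M k α which
  let b ← acceptM n h M k α which m
  pure (if b then .inr m else .inl ())

theorem chooseM_eq (n h : ℤ) : chooseM n h = (do
    let M ← computeM n h
    let t ← computeTilde n h
    let k ← computeK n h t
    let α ← computeAlpha M k t
    let which ← computeWhich M k α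
    loop (fun _ => mainBody n h M k α which) ()) := rfl

namespace Params

variable {n h M k α : ℕ} {t : ℝ}

/-- The probability that one iteration of the main loop returns a value. -/
noncomputable def accProb (n h M k α : ℕ) : ℝ := Ftot n h * B M k α M / (F n h M * Btot M k α)

theorem Ftot_eq (p : Params n h M k α t) :
    Ftot n h = ∑ m ∈ Finset.range ((k + 1) * M + α + 1), F n h m := by
  unfold Ftot
  have h2 := p.two_mul_M_le
  have hlow : (n + 1 - h) / 2 + 1 ≤ (k + 1) * M + α + 1 := by
    have := p.N_nat_ge (m := (n + 1 - h) / 2) (by omega)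
    omega
  refine Finset.sum_subset (Finset.range_subset_range.2 hlow) fun m _ hm => F_eq_zero ?_
  rw [Finset.mem_range] at hm
  omega

theorem Ftot_pos (p : Params n h M k α t) : 0 < Ftot n h := by
  rw [p.Ftot_eq]
  refine Finset.sum_pos' (fun m _ => F_nonneg n h m) ⟨0, by simp, F_pos p.h_pos ?_⟩
  have := p.two_mul_M_le
  omega

theorem accProb_pos (p : Params n h M k α t) : 0 < accProb n h M k α :=
  div_pos (mul_pos p.Ftot_pos (p.B_pos (by have := p.M_lt_N; omega)))
    (mul_pos (F_pos p.h_pos p.two_mul_M_le) p.Btot_pos)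

/-- Drawing `m` with the weight `B m` and accepting it with probability `G m / G M` yields `m` with a
probability proportional to `F n h m`. -/
theorem law_mainBody (p : Params n h M k α t) :
    Law (mainBody n h M k α (whichOf M k α)) fun f =>
      ENNReal.ofReal (1 - accProb n h M k α) * f (.inl ()) +
      ∑ m ∈ Finset.range ((k + 1) * M + α + 1),
        ENNReal.ofReal (accProb n h M k α * (F n h m / Ftot n h)) * f (.inr m) := by
  have hFt := p.Ftot_pos
  have hBt := p.Btot_pos
  have hFM := F_pos p.h_pos p.two_mul_M_le
  have hBM : 0 < B M k α M := p.B_pos (by have := p.M_lt_N; omega)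
  have hG := p.G_pos p.two_mul_M_le
  unfold mainBody
  have hinner : ∀ m : ℕ, Law ((acceptM n h M k α (whichOf M k α) m >>= fun b =>
      (pure (if b then .inr (m : ℤ) else .inl ()) : RAM (Unit ⊕ ℤ)))) fun f =>
      ENNReal.ofReal (G n h M k α m / G n h M k α M) * f (.inr m) +
      ENNReal.ofReal (1 - G n h M k α m / G n h M k α M) * f (.inl ()) := by
    intro m
    have hpure : ∀ b : Bool, Law (pure (if b then .inr (m : ℤ) else .inl ()) : RAM (Unit ⊕ ℤ))
        fun f => f (if b then .inr (m : ℤ) else .inl ()) := fun b => law_pure _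
    exact ((p.bern_acceptM m).law.bind hpure).congr fun f => by simp
  refine (p.law_extendedBin.bind_sum fun m _ => hinner m).congr fun f => ?_
  simp only [mul_add]
  rw [Finset.sum_add_distrib, add_comm]
  congr 1
  · simp_rw [← mul_assoc]
    rw [← Finset.sum_mul]
    congr 1
    rw [Finset.sum_congr rfl fun m hm => (ENNReal.ofReal_mul (div_nonneg (p.B_pos
      (Nat.lt_succ_iff.1 (Finset.mem_range.1 hm))).le hBt.le)).symm, ← ENNReal.ofReal_sum_of_nonneg]
    · congr 1
      have e : ∀ m ∈ Finset.range ((k + 1) * M + α + 1), B M k α m / Btot M k α *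
          (1 - G n h M k α m / G n h M k α M) =
          B M k α m / Btot M k α - F n h m * (B M k α M / (F n h M * Btot M k α)) := by
        intro m hm
        have hb := p.B_pos (Nat.lt_succ_iff.1 (Finset.mem_range.1 hm))
        unfold G
        field_simp
      rw [Finset.sum_congr rfl e, Finset.sum_sub_distrib, ← Finset.sum_mul, ← p.Ftot_eq,
        ← Finset.sum_div, ← Btot, div_self hBt.ne', accProb, mul_div_assoc]
    · intro m hm
      have hb := p.B_pos (Nat.lt_succ_iff.1 (Finset.mem_range.1 hm))
      exact mul_nonneg (by positivity) (sub_nonneg.2 (p.bern_acceptM m).le_one)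
  · refine Finset.sum_congr rfl fun m hm => ?_
    have hb := p.B_pos (Nat.lt_succ_iff.1 (Finset.mem_range.1 hm))
    rw [← mul_assoc, ← ENNReal.ofReal_mul (by positivity)]
    congr 2
    unfold accProb G
    field_simp

theorem accProb_le_one (p : Params n h M k α t) : accProb n h M k α ≤ 1 := by
  have hBt := p.Btot_pos
  have hFM := F_pos p.h_pos p.two_mul_M_le
  have hBM : 0 < B M k α M := p.B_pos (by have := p.M_lt_N; omega)
  rw [accProb, div_le_one (by positivity), p.Ftot_eq, Btot, Finset.sum_mul, Finset.mul_sum]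
  refine Finset.sum_le_sum fun m hm => ?_
  have hb := p.B_pos (Nat.lt_succ_iff.1 (Finset.mem_range.1 hm))
  have := (p.bern_acceptM m).le_one
  rw [div_le_one (p.G_pos p.two_mul_M_le)] at this
  unfold G at this
  rw [div_le_div_iff₀ hb hBM] at this
  exact this

theorem one_sub_mainBody (p : Params n h M k α t) :
    1 - ENNReal.ofReal (1 - accProb n h M k α) = ENNReal.ofReal (accProb n h M k α) := by
  rw [← ENNReal.ofReal_one, ← ENNReal.ofReal_sub _ (sub_nonneg.2 p.accProb_le_one)]
  congr 1
  ring

theorem Ftot_range (p : Params n h M k α t) (f : ℕ → ℝ≥0∞) :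
    ∑ m ∈ Finset.range ((k + 1) * M + α + 1), ENNReal.ofReal (F n h m / Ftot n h) * f m =
      ∑ m ∈ Finset.range ((n + 1 - h) / 2 + 1), ENNReal.ofReal (F n h m / Ftot n h) * f m := by
  have h2 := p.two_mul_M_le
  have hlow : (n + 1 - h) / 2 + 1 ≤ (k + 1) * M + α + 1 := by
    have := p.N_nat_ge (m := (n + 1 - h) / 2) (by omega)
    omega
  refine (Finset.sum_subset (Finset.range_subset_range.2 hlow) fun m _ hm => ?_).symm
  rw [Finset.mem_range] at hm
  rw [F_eq_zero (by omega)]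
  simp

theorem law_chooseM (p : Params n h M k α (mTilde n h)) (hk : (k : ℤ) = parK n h)
    (hα : (α : ℤ) = parAlpha n h) :
    Law (chooseM n h) fun f => ∑ m ∈ Finset.range ((n + 1 - h) / 2 + 1),
      ENNReal.ofReal (F n h m / Ftot n h) * f m := by
  rw [chooseM_eq]
  refine p.law_computeM.bind ((law_computeTilde n h).bind ((law_computeK n h).bind ?_))
  rw [← hk]
  refine (law_computeAlpha n h M k p.argM_eq hk).bind ?_
  rw [← hα]
  refine (law_computeWhich M k α).bind ((law_loop (Y := fun f =>
    ∑ m ∈ Finset.range ((k + 1) * M + α + 1),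
        ENNReal.ofReal (accProb n h M k α * (F n h m / Ftot n h)) * f (m : ℤ))
      p.law_mainBody).congr fun f => ?_)
  have hq := p.accProb_pos
  have hFt := p.Ftot_pos
  rw [p.one_sub_mainBody, ← ENNReal.ofReal_inv_of_pos hq, Finset.mul_sum,
    ← p.Ftot_range fun m => f m]
  refine Finset.sum_congr rfl fun m _ => ?_
  rw [← mul_assoc, ← ENNReal.ofReal_mul (by positivity)]
  congr 2
  field_simp

theorem prob_chooseM (p : Params n h M k α (mTilde n h)) (hk : (k : ℤ) = parK n h)
    (hα : (α : ℤ) = parAlpha n h) (m : ℕ) :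
    prob (chooseM n h) (m : ℤ) = ENNReal.ofReal (F n h m / Ftot n h) := by
  rw [(p.law_chooseM hk hα).prob_eq]
  simp only [Nat.cast_inj, mul_ite, mul_one, mul_zero, Finset.sum_ite_eq', Finset.mem_range]
  split_ifs with hm
  · rfl
  · have := p.two_mul_M_le
    rw [F_eq_zero (by omega)]
    simp

theorem haltProb_chooseM (p : Params n h M k α (mTilde n h)) (hk : (k : ℤ) = parK n h)
    (hα : (α : ℤ) = parAlpha n h) : haltProb (chooseM n h) = 1 := by
  have hFt := p.Ftot_pos
  rw [(p.law_chooseM hk hα).haltProb_eq]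
  simp only [mul_one]
  rw [← ENNReal.ofReal_sum_of_nonneg fun m _ => div_nonneg (F_nonneg n h m) hFt.le,
    ← Finset.sum_div, ← Ftot, div_self hFt.ne', ENNReal.ofReal_one]

end Params

/-! ### Random words with given numbers of letters -/

instance : Fintype Step := ⟨{.up, .down, .level}, fun s => by cases s <;> simp⟩

theorem sum_step {R : Type} [AddCommMonoid R] (f : Step → R) :
    ∑ s, f s = f .up + (f .down + f .level) := by
  show ∑ s ∈ ({.up, .down, .level} : Finset Step), f s = _
  rw [Finset.sum_insert (by decide), Finset.sum_insert (by decide), Finset.sum_singleton]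

/-- The words of length `L`. -/
def wordsOfLength : ℕ → Finset (List Step)
  | 0 => {[]}
  | L + 1 => (Finset.univ ×ˢ wordsOfLength L).image fun p => p.1 :: p.2

theorem mem_wordsOfLength {L : ℕ} {w : List Step} : w ∈ wordsOfLength L ↔ w.length = L := by
  induction L generalizing w with
  | zero => simp [wordsOfLength, List.length_eq_zero_iff]
  | succ L ih =>
    cases w with
    | nil => simp [wordsOfLength]
    | cons s w => simp [wordsOfLength, ih]

theorem sum_wordsOfLength_succ {R : Type} [AddCommMonoid R] (L : ℕ) (f : List Step → R) :
    ∑ w ∈ wordsOfLength (L + 1), f w = ∑ s, ∑ w ∈ wordsOfLength L, f (s :: w) := by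
  rw [wordsOfLength, Finset.sum_image, Finset.sum_product]
  rintro ⟨s, w⟩ _ ⟨s', w'⟩ _ h
  simpa using h

/-- The words with `a` letters `up`, `b` letters `down` and `c` letters `level`. -/
def words (a b c : ℕ) : Finset (List Step) :=
  {w ∈ wordsOfLength (a + b + c) | w.count .up = a ∧ w.count .down = b ∧ w.count .level = c}

theorem length_eq_counts (w : List Step) :
    w.length = w.count .up + w.count .down + w.count .level := by
  induction w with
  | nil => rfl
  | cons s w ih => cases s <;> simp [ih] <;> omega

theorem mem_words {a b c : ℕ} {w : List Step} : w ∈ words a b c ↔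
    w.count .up = a ∧ w.count .down = b ∧ w.count .level = c := by
  rw [words, Finset.mem_filter, mem_wordsOfLength, length_eq_counts]
  omega

/-- Summation over the words with given numbers of letters according to the first letter. -/
theorem sum_words_succ {R : Type} [AddCommMonoid R] {a b c L : ℕ} (hL : a + b + c = L + 1)
    (f : List Step → R) :
    ∑ w ∈ words a b c, f w =
      (if a = 0 then 0 else ∑ w ∈ words (a - 1) b c, f (.up :: w)) +
      ((if b = 0 then 0 else ∑ w ∈ words a (b - 1) c, f (.down :: w)) +
      (if c = 0 then 0 else ∑ w ∈ words a b (c - 1), f (.level :: w))) := by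
  rw [words, hL, Finset.sum_filter, sum_wordsOfLength_succ, sum_step]
  congr 1
  · split_ifs with h
    · refine Finset.sum_eq_zero fun w _ => if_neg ?_
      simp; omega
    · rw [words, show a - 1 + b + c = L by omega, Finset.sum_filter]
      refine Finset.sum_congr rfl fun w _ => if_congr ?_ rfl rfl
      simp; omega
  congr 1
  · split_ifs with h
    · refine Finset.sum_eq_zero fun w _ => if_neg ?_
      simp; omega
    · rw [words, show a + (b - 1) + c = L by omega, Finset.sum_filter]
      refine Finset.sum_congr rfl fun w _ => if_congr ?_ rfl rfl
      simp; omega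
  · split_ifs with h
    · refine Finset.sum_eq_zero fun w _ => if_neg ?_
      simp; omega
    · rw [words, show a + b + (c - 1) = L by omega, Finset.sum_filter]
      refine Finset.sum_congr rfl fun w _ => if_congr ?_ rfl rfl
      simp; omega

theorem words_zero : words 0 0 0 = {[]} := by
  ext w
  rw [mem_words, Finset.mem_singleton]
  constructor
  · rintro ⟨h1, h2, h3⟩
    rw [← List.length_eq_zero_iff, length_eq_counts]
    omega
  · rintro rfl
    simp

theorem card_words : ∀ (L a b c : ℕ), a + b + c = L →
    (words a b c).card * (a.factorial * b.factorial * c.factorial) = L.factorial := by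
  intro L
  induction L with
  | zero =>
    intro a b c h
    obtain ⟨rfl, rfl, rfl⟩ : a = 0 ∧ b = 0 ∧ c = 0 := by omega
    simp [words_zero]
  | succ L ih =>
    intro a b c h
    rw [Finset.card_eq_sum_ones, sum_words_succ h, Nat.factorial_succ, add_mul, add_mul, ← h,
      add_mul, add_mul, add_assoc]
    simp only [← Finset.card_eq_sum_ones]
    congr 1
    · rcases a with _ | a
      · simp
      · rw [if_neg (Nat.succ_ne_zero a), Nat.add_sub_cancel, ← ih a b c (by omega),
          Nat.factorial_succ]
        ring
    congr 1
    · rcases b with _ | b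
      · simp
      · rw [if_neg (Nat.succ_ne_zero b), Nat.add_sub_cancel, ← ih a b c (by omega),
          Nat.factorial_succ]
        ring
    · rcases c with _ | c
      · simp
      · rw [if_neg (Nat.succ_ne_zero c), Nat.add_sub_cancel, ← ih a b c (by omega),
          Nat.factorial_succ]
        ring

/-- The loop body of `mix`. -/
noncomputable def mixBody (s : List Step × ℤ × ℤ × ℤ) : RAM (List Step × ℤ × ℤ × ℤ) := do
  let ab ← add s.2.1 s.2.2.1
  let abc ← add ab s.2.2.2
  let v ← random abc
  let isUp ← lt v s.2.1
  if isUp then do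
    let w ← push s.1 .up
    let a' ← sub s.2.1 1
    pure (w, a', s.2.2.1, s.2.2.2)
  else do
    let isDown ← lt v ab
    if isDown then do
      let w ← push s.1 .down
      let b' ← sub s.2.2.1 1
      pure (w, s.2.1, b', s.2.2.2)
    else do
      let w ← push s.1 .level
      let c' ← sub s.2.2.2 1
      pure (w, s.2.1, s.2.2.1, c')

theorem mix_eq (a b c : ℤ) : mix a b c = (do
    let ab ← add a b
    let L ← add ab c
    let r ← forLoop 1 L (([] : List Step), a, b, c) fun _ s => mixBody s
    pure r.1) := rfl

theorem law_mixBody (w : List Step) (a b c : ℕ) :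
    Law (mixBody (w, a, b, c)) fun f => ((a + b + c : ℕ) : ℝ≥0∞)⁻¹ *
      (a * f (w ++ [.up], (a : ℤ) - 1, (b : ℤ), (c : ℤ)) +
        (b * f (w ++ [.down], (a : ℤ), (b : ℤ) - 1, (c : ℤ)) +
        c * f (w ++ [.level], (a : ℤ), (b : ℤ), (c : ℤ) - 1))) := by
  refine (law_add _ _).bind ((law_add _ _).bind ?_)
  rw [show ((a : ℤ) + b + c) = ((a + b + c : ℕ) : ℤ) by push_cast; ring]
  refine ((law_random (a + b + c)).bind (Y := fun v f =>
    if v < (a : ℤ) then f (w ++ [.up], (a : ℤ) - 1, (b : ℤ), (c : ℤ)) else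
    if v < (a : ℤ) + b then f (w ++ [.down], (a : ℤ), (b : ℤ) - 1, (c : ℤ)) else
      f (w ++ [.level], (a : ℤ), (b : ℤ), (c : ℤ) - 1)) fun v => ?_).congr fun f => ?_
  · refine (law_lt _ _).bind ?_
    by_cases h1 : v < (a : ℤ)
    · simp only [h1, decide_true, if_true]
      exact (law_push _ _).bind ((law_sub _ _).bind (law_pure _))
    · simp only [h1, decide_false, if_false, Bool.false_eq_true]
      refine (law_lt _ _).bind ?_
      by_cases h2 : v < (a : ℤ) + b
      · simp only [h2, decide_true, if_true]
        exact (law_push _ _).bind ((law_sub _ _).bind (law_pure _))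
      · simp only [h2, decide_false, if_false, Bool.false_eq_true]
        exact (law_push _ _).bind ((law_sub _ _).bind (law_pure _))
  · congr 1
    rw [Finset.sum_range_add, Finset.sum_range_add, add_assoc]
    congr 1
    · rw [Finset.sum_congr rfl fun x hx => if_pos (by exact_mod_cast Finset.mem_range.1 hx)]
      simp
    congr 1
    · rw [Finset.sum_congr rfl (g := fun _ => f (w ++ [.down], (a : ℤ), (b : ℤ) - 1, (c : ℤ)))
        fun x hx => by
          beta_reduce
          rw [if_neg (by push_cast; omega),
            if_pos (by have := Finset.mem_range.1 hx; push_cast; omega)]]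
      simp
    · rw [Finset.sum_congr rfl (g := fun _ => f (w ++ [.level], (a : ℤ), (b : ℤ), (c : ℤ) - 1))
        fun x hx => by
          beta_reduce
          rw [if_neg (by push_cast; omega), if_neg (by push_cast; omega)]]
      simp

/-- How many letters `s` are left. -/
def letterCount (a b c : ℕ) : Step → ℕ
  | .up => a
  | .down => b
  | .level => c

/-- The numbers of letters that are left after drawing `s`. -/
def nextCounts (a b c : ℕ) : Step → ℤ × ℤ × ℤ
  | .up => ((a : ℤ) - 1, (b : ℤ), (c : ℤ))
  | .down => ((a : ℤ), (b : ℤ) - 1, (c : ℤ))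
  | .level => ((a : ℤ), (b : ℤ), (c : ℤ) - 1)

/-- `mix` produces a uniform random word with the given numbers of letters: the partial word
`w` is completed to each `w ++ v` with the same probability. -/
theorem law_mixLoop : ∀ (L a b c : ℕ), a + b + c = L → ∀ (i : ℤ) (w : List Step),
    Law (forFrom (fun _ s => mixBody s) L i (w, (a : ℤ), (b : ℤ), (c : ℤ))) fun f =>
      ((a.factorial * b.factorial * c.factorial : ℕ) : ℝ≥0∞) * (L.factorial : ℝ≥0∞)⁻¹ *
        ∑ v ∈ words a b c, f (w ++ v, 0, 0, 0) := by
  intro L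
  induction L with
  | zero =>
    intro a b c h i w
    obtain ⟨rfl, rfl, rfl⟩ : a = 0 ∧ b = 0 ∧ c = 0 := by omega
    exact Law.congr (law_unitOp _) fun f => by simp [words_zero]
  | succ L ih =>
    intro a b c h i w
    -- only letters that are not used up are drawn
    have hbody : Law (mixBody (w, (a : ℤ), (b : ℤ), (c : ℤ))) fun f =>
        ∑ s with letterCount a b c s ≠ 0, ((L + 1 : ℕ) : ℝ≥0∞)⁻¹ * letterCount a b c s *
          f (w ++ [s], nextCounts a b c s) := by
      refine (law_mixBody w a b c).congr fun f => ?_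
      have e : ∀ s, (if letterCount a b c s ≠ 0 then ((L + 1 : ℕ) : ℝ≥0∞)⁻¹ *
          letterCount a b c s * f (w ++ [s], nextCounts a b c s) else 0) =
          ((L + 1 : ℕ) : ℝ≥0∞)⁻¹ * letterCount a b c s *
            f (w ++ [s], nextCounts a b c s) := by
        intro s
        by_cases h0 : letterCount a b c s = 0 <;> simp [h0]
      rw [Finset.sum_filter, Finset.sum_congr rfl fun s _ => e s, sum_step, h]
      simp only [letterCount, nextCounts]
      ring
    have hnext : ∀ s ∈ ({s | letterCount a b c s ≠ 0} : Finset Step),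
        Law (forFrom (fun _ s => mixBody s) L (i + 1) (w ++ [s], nextCounts a b c s)) fun f =>
        (((letterCount a b c s : ℝ≥0∞))⁻¹ *
          ((a.factorial * b.factorial * c.factorial : ℕ) : ℝ≥0∞)) * (L.factorial : ℝ≥0∞)⁻¹ *
          ∑ v ∈ words (if s = .up then a - 1 else a) (if s = .down then b - 1 else b)
            (if s = .level then c - 1 else c), f (w ++ s :: v, 0, 0, 0) := by
      intro s hs
      have hcancel : ∀ x y : ℕ, x ≠ 0 → (x : ℝ≥0∞)⁻¹ * ((x * y : ℕ) : ℝ≥0∞) = y := by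
        intro x y hx
        rw [Nat.cast_mul, ← mul_assoc, ENNReal.inv_mul_cancel (by exact_mod_cast hx)
          (ENNReal.natCast_ne_top x), one_mul]
      have hs' : letterCount a b c s ≠ 0 := (Finset.mem_filter.1 hs).2
      cases s
      · obtain ⟨a, rfl⟩ := Nat.exists_eq_succ_of_ne_zero hs'
        show Law (forFrom _ L (i + 1) (w ++ [.up], ((a + 1 : ℕ) : ℤ) - 1, (b : ℤ), (c : ℤ))) _
        rw [show ((a + 1 : ℕ) : ℤ) - 1 = a by push_cast; ring]
        refine (ih a b c (by omega) (i + 1) (w ++ [.up])).congr fun f => ?_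
        simp only [letterCount, if_true, reduceCtorEq, if_false, List.append_assoc,
          List.cons_append, List.nil_append]
        rw [Nat.factorial_succ, mul_assoc (a + 1), mul_assoc (a + 1),
          hcancel _ _ (Nat.succ_ne_zero a)]
        rfl
      · obtain ⟨b, rfl⟩ := Nat.exists_eq_succ_of_ne_zero hs'
        show Law (forFrom _ L (i + 1) (w ++ [.down], (a : ℤ), ((b + 1 : ℕ) : ℤ) - 1, (c : ℤ))) _
        rw [show ((b + 1 : ℕ) : ℤ) - 1 = b by push_cast; ring]
        refine (ih a b c (by omega) (i + 1) (w ++ [.down])).congr fun f => ?_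
        simp only [letterCount, if_true, reduceCtorEq, if_false, List.append_assoc,
          List.cons_append, List.nil_append]
        rw [Nat.factorial_succ, mul_left_comm, mul_assoc (b + 1),
          hcancel _ _ (Nat.succ_ne_zero b)]
        rfl
      · obtain ⟨c, rfl⟩ := Nat.exists_eq_succ_of_ne_zero hs'
        show Law (forFrom _ L (i + 1) (w ++ [.level], (a : ℤ), (b : ℤ), ((c + 1 : ℕ) : ℤ) - 1)) _
        rw [show ((c + 1 : ℕ) : ℤ) - 1 = c by push_cast; ring]
        refine (ih a b c (by omega) (i + 1) (w ++ [.level])).congr fun f => ?_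
        simp only [letterCount, if_true, reduceCtorEq, if_false, List.append_assoc,
          List.cons_append, List.nil_append]
        rw [Nat.factorial_succ, mul_left_comm,
          hcancel _ _ (Nat.succ_ne_zero c)]
        rfl
    refine ((law_unitOp ()).bind (hbody.bind_sum fun s hs =>
      (law_add i 1).bind (hnext s hs))).congr fun f => ?_
    have hterm : ∀ s ∈ ({s | letterCount a b c s ≠ 0} : Finset Step),
        ((L + 1 : ℕ) : ℝ≥0∞)⁻¹ * letterCount a b c s * ((((letterCount a b c s : ℝ≥0∞))⁻¹ *
          ((a.factorial * b.factorial * c.factorial : ℕ) : ℝ≥0∞)) * (L.factorial : ℝ≥0∞)⁻¹ *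
          ∑ v ∈ words (if s = .up then a - 1 else a) (if s = .down then b - 1 else b)
            (if s = .level then c - 1 else c), f (w ++ s :: v, 0, 0, 0)) =
        ((a.factorial * b.factorial * c.factorial : ℕ) : ℝ≥0∞) *
          ((L + 1).factorial : ℝ≥0∞)⁻¹ *
          ∑ v ∈ words (if s = .up then a - 1 else a) (if s = .down then b - 1 else b)
            (if s = .level then c - 1 else c), f (w ++ s :: v, 0, 0, 0) := by
      intro s hs
      have hs' : (letterCount a b c s : ℝ≥0∞) ≠ 0 := by
        exact_mod_cast (Finset.mem_filter.1 hs).2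
      have e1 := ENNReal.mul_inv_cancel hs' (ENNReal.natCast_ne_top _)
      have e2 : ((L + 1).factorial : ℝ≥0∞)⁻¹ =
          ((L + 1 : ℕ) : ℝ≥0∞)⁻¹ * (L.factorial : ℝ≥0∞)⁻¹ := by
        rw [Nat.factorial_succ, Nat.cast_mul, ENNReal.mul_inv (Or.inr (ENNReal.natCast_ne_top _))
          (Or.inl (ENNReal.natCast_ne_top _))]
      rw [e2]
      set z := (letterCount a b c s : ℝ≥0∞)
      set S := ∑ v ∈ words (if s = .up then a - 1 else a) (if s = .down then b - 1 else b)
            (if s = .level then c - 1 else c), f (w ++ s :: v, 0, 0, 0)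
      calc _ = (z * z⁻¹) * (((a.factorial * b.factorial * c.factorial : ℕ) : ℝ≥0∞) *
            (((L + 1 : ℕ) : ℝ≥0∞)⁻¹ * (L.factorial : ℝ≥0∞)⁻¹) * S) := by ring
        _ = _ := by rw [e1, one_mul]
    rw [Finset.sum_congr rfl hterm, ← Finset.mul_sum, Finset.sum_filter, sum_step,
      sum_words_succ h]
    simp [letterCount]

theorem law_mix (a b c : ℕ) :
    Law (mix a b c) fun f => ∑ w ∈ words a b c, ((words a b c).card : ℝ≥0∞)⁻¹ * f w := by
  rw [mix_eq]
  refine (law_add _ _).bind ((law_add _ _).bind ?_)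
  unfold forLoop
  rw [show ((a : ℤ) + b + c + 1 - 1).toNat = a + b + c by omega]
  refine ((law_mixLoop (a + b + c) a b c rfl 1 []).bind fun r => law_pure r.1).congr fun f => ?_
  rw [Finset.mul_sum]
  refine Finset.sum_congr rfl fun w _ => ?_
  congr 1
  have e := card_words (a + b + c) a b c rfl
  have h0 : ((a.factorial * b.factorial * c.factorial : ℕ) : ℝ≥0∞) ≠ 0 := by
    exact_mod_cast (by positivity : a.factorial * b.factorial * c.factorial ≠ 0)
  rw [← e, Nat.cast_mul (words a b c).card, ENNReal.mul_inv (Or.inr (ENNReal.natCast_ne_top _))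
    (Or.inl (ENNReal.natCast_ne_top _)), mul_left_comm,
    ENNReal.mul_inv_cancel h0 (ENNReal.natCast_ne_top _), mul_one]

/-! ### Heights of a path and the cycle lemma -/

/-- The height after `i` letters. -/
def heightAt (w : List Step) (i : ℕ) : ℤ := height (w.take i)

@[simp] theorem heightAt_zero (w : List Step) : heightAt w 0 = 0 := by simp [heightAt, height]

theorem height_append (u v : List Step) : height (u ++ v) = height u + height v := by
  simp [height]

theorem heightAt_succ {w : List Step} {i : ℕ} (hi : i < w.length) :
    heightAt w (i + 1) = heightAt w i + w[i].rise := by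
  rw [heightAt, heightAt, List.take_succ_eq_append_getElem hi, height_append]
  simp [height]

theorem heightAt_succ_le {w : List Step} {i : ℕ} (hi : i < w.length) :
    heightAt w (i + 1) ≤ heightAt w i + 1 := by
  rw [heightAt_succ hi]
  cases w[i] <;> simp [Step.rise]

theorem heightAt_length (w : List Step) : heightAt w w.length = height w := by
  simp [heightAt]

/-- The smallest height reached within the first `i` letters. -/
def lowest (w : List Step) : ℕ → ℤ
  | 0 => 0
  | i + 1 => min (lowest w i) (heightAt w (i + 1))

theorem lowest_le (w : List Step) {i q : ℕ} (hq : q ≤ i) : lowest w i ≤ heightAt w q := by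
  induction i with
  | zero => obtain rfl : q = 0 := by omega
            simp [lowest]
  | succ i ih =>
    rcases Nat.lt_or_ge i q with h | h
    · obtain rfl : q = i + 1 := by omega
      exact min_le_right _ _
    · exact (min_le_left _ _).trans (ih h)

theorem exists_lowest (w : List Step) (i : ℕ) : ∃ q ≤ i, lowest w i = heightAt w q := by
  induction i with
  | zero => exact ⟨0, le_rfl, by simp [lowest]⟩
  | succ i ih =>
    rcases min_choice (lowest w i) (heightAt w (i + 1)) with h | h
    · obtain ⟨q, hq, e⟩ := ih
      exact ⟨q, by omega, by rw [lowest, h, e]⟩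
    · exact ⟨i + 1, le_rfl, by rw [lowest, h]⟩

/-- The last of the positions `1, …, i` where the height is `e`, and `0` if there is none. -/
def lastAt (w : List Step) (e : ℤ) : ℕ → ℕ
  | 0 => 0
  | i + 1 => if heightAt w (i + 1) = e then i + 1 else lastAt w e i

theorem lastAt_eq {w : List Step} {e : ℤ} {p i : ℕ} (hp : p ≤ i) (he : heightAt w p = e)
    (h : ∀ q, p < q → q ≤ i → heightAt w q ≠ e) : lastAt w e i = p := by
  induction i with
  | zero => simp [lastAt]; omega
  | succ i ih =>
    rcases Nat.lt_or_ge i p with h1 | h1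
    · obtain rfl : p = i + 1 := by omega
      simp [lastAt, he]
    · rw [lastAt, if_neg (h _ (by omega) le_rfl)]
      exact ih h1 fun q h2 h3 => h q h2 (by omega)

/-- All nonempty prefixes have positive height. -/
def IsPositive (w : List Step) : Prop := ∀ i, 0 < i → i ≤ w.length → 0 < heightAt w i

theorem heightAt_rotate_low {w : List Step} {p i : ℕ} (h : p + i ≤ w.length) :
    heightAt (w.rotate p) i = heightAt w (p + i) - heightAt w p := by
  have e : w.take (p + i) = w.take p ++ (w.rotate p).take i := by
    rw [List.rotate_eq_drop_append_take (by omega),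
      List.take_append_of_le_length (by simp; omega), ← List.take_add]
  unfold heightAt
  rw [e, height_append]
  ring

theorem heightAt_rotate_high {w : List Step} {p q : ℕ} (hp : p ≤ w.length) (hq : q ≤ p) :
    heightAt (w.rotate p) (w.length - p + q) = height w - heightAt w p + heightAt w q := by
  have e : (w.rotate p).take (w.length - p + q) = w.drop p ++ w.take q := by
    rw [List.rotate_eq_drop_append_take hp, List.take_append, List.length_drop,
      Nat.add_sub_cancel_left, List.take_of_length_le (by simp), List.take_take, min_eq_left hq]
  have e2 : height w = height (w.take p) + height (w.drop p) := by
    rw [← height_append, List.take_append_drop]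
  unfold heightAt
  rw [e, height_append, e2]
  ring

/-- For a word of positive height, the rotation at `p` is positive iff `p` is the last position of its
height and lies less than the final height above the lowest point. -/
theorem isPositive_rotate_iff {w : List Step} {p : ℕ} (hp : p < w.length) :
    IsPositive (w.rotate p) ↔ (∀ q, p < q → q ≤ w.length → heightAt w p < heightAt w q) ∧
      ∀ q ≤ p, heightAt w p < height w + heightAt w q := by
  unfold IsPositive
  rw [List.length_rotate]
  constructor
  · intro h
    constructor
    · intro q h1 h2
      have := h (q - p) (by omega) (by omega)
      rw [heightAt_rotate_low (by omega), show p + (q - p) = q by omega] at this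
      linarith
    · intro q hq
      have := h (w.length - p + q) (by omega) (by omega)
      rw [heightAt_rotate_high hp.le hq] at this
      linarith
  · rintro ⟨h1, h2⟩ i hi hi'
    rcases le_total (p + i) w.length with h | h
    · rw [heightAt_rotate_low h]
      have := h1 (p + i) (by omega) h
      linarith
    · obtain ⟨q, rfl⟩ : ∃ q, i = w.length - p + q := ⟨i - (w.length - p), by omega⟩
      rw [heightAt_rotate_high hp.le (by omega)]
      have := h2 q (by omega)
      linarith

/-- The last position where the path has the height `e` is well defined and followed by larger
heights only, if `e` lies between the smallest height and the final height. -/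
theorem exists_last {w : List Step} {e : ℤ} (h1 : lowest w w.length ≤ e) (h2 : e < height w) :
    ∃ p < w.length, heightAt w p = e ∧ ∀ q, p < q → q ≤ w.length → e < heightAt w q := by
  classical
  obtain ⟨q0, hq0, hlow⟩ := exists_lowest w w.length
  set p := Nat.findGreatest (fun i => heightAt w i ≤ e) w.length with hp
  have hpe : heightAt w p ≤ e :=
    Nat.findGreatest_spec (P := fun i => heightAt w i ≤ e) hq0 (hlow ▸ h1)
  have hple : p ≤ w.length := Nat.findGreatest_le _
  have hgt : ∀ q, p < q → q ≤ w.length → e < heightAt w q := fun q a b =>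
    not_le.1 (Nat.findGreatest_is_greatest a b)
  have hlt : p < w.length := by
    rcases eq_or_lt_of_le hple with h | h
    · rw [h, heightAt_length] at hpe
      omega
    · exact h
  refine ⟨p, hlt, ?_, hgt⟩
  have := hgt (p + 1) (by omega) hlt
  have := heightAt_succ_le hlt
  omega

theorem isPositive_rotate_lastAt {w : List Step} {j : ℕ} (hj : (j : ℤ) < height w) :
    let p := lastAt w (lowest w w.length + j) w.length
    p < w.length ∧ heightAt w p = lowest w w.length + j ∧ IsPositive (w.rotate p) := by
  have hlow : lowest w w.length ≤ 0 := by simpa using lowest_le w (Nat.zero_le w.length)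
  obtain ⟨p, h1, h2, h3⟩ := exists_last (w := w) (e := lowest w w.length + j) (by omega) (by omega)
  have e := lastAt_eq h1.le h2 fun q a b => (h3 q a b).ne'
  simp only [e]
  refine ⟨h1, h2, (isPositive_rotate_iff h1).2 ⟨fun q a b => h2 ▸ h3 q a b, fun q hq => ?_⟩⟩
  have := lowest_le w (show q ≤ w.length by omega)
  omega

theorem lastAt_of_isPositive_rotate {w : List Step} {p : ℕ} (hp : p < w.length)
    (h : IsPositive (w.rotate p)) :
    lastAt w (heightAt w p) w.length = p ∧ heightAt w p < lowest w w.length + height w := by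
  obtain ⟨h1, h2⟩ := (isPositive_rotate_iff hp).1 h
  refine ⟨lastAt_eq hp.le rfl fun q a b => (h1 q a b).ne', ?_⟩
  obtain ⟨q, hq, e⟩ := exists_lowest w w.length
  rcases Nat.lt_or_ge p q with h3 | h3
  · have := h1 q h3 hq
    have := lowest_le w hp.le
    omega
  · have := h2 q h3
    omega

theorem height_eq_counts (w : List Step) : height w = w.count .up - w.count .down := by
  induction w with
  | nil => rfl
  | cons s w ih =>
    have : height (s :: w) = s.rise + height w := by simp [height]
    rw [this, ih]
    cases s <;> simp [Step.rise] <;> ring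

theorem rotate_mem_words {a b c p : ℕ} {w : List Step} (h : w ∈ words a b c) :
    w.rotate p ∈ words a b c := by
  rw [mem_words] at h ⊢
  simpa only [(List.rotate_perm w p).count_eq] using h

open Classical in
/-- The positive words with given numbers of letters. -/
noncomputable def posWords (a b c : ℕ) : Finset (List Step) := {w ∈ words a b c | IsPositive w}

theorem mem_posWords {a b c : ℕ} {w : List Step} :
    w ∈ posWords a b c ↔ w ∈ words a b c ∧ IsPositive w := by
  classical exact Finset.mem_filter

/-- The cycle lemma: rotating at the last visits of the heights `low, …, low + h - 1`, where `h` is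
the final height, maps the pairs of a word and one of these heights bijectively to the pairs of a
positive word and a position. -/
theorem sum_cycle {a b c h L : ℕ} (hab : a = b + h) (hL : a + b + c = L)
    (f : List Step → ℝ≥0∞) :
    ∑ w ∈ words a b c, ∑ j ∈ Finset.range h, f (w.rotate (lastAt w (lowest w L + j) L)) =
      L * ∑ v ∈ posWords a b c, f v := by
  have hlen : ∀ w ∈ words a b c, w.length = L := by
    intro w hw
    rw [mem_words] at hw
    rw [length_eq_counts, hw.1, hw.2.1, hw.2.2, hL]
  have hht : ∀ w ∈ words a b c, height w = h := by
    intro w hw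
    rw [mem_words] at hw
    rw [height_eq_counts, hw.1, hw.2.1, hab]
    push_cast
    ring
  have hR : (L : ℝ≥0∞) * ∑ v ∈ posWords a b c, f v =
      ∑ x ∈ posWords a b c ×ˢ Finset.range L, f x.1 := by
    rw [Finset.sum_product, Finset.mul_sum]
    simp
  rw [hR, ← Finset.sum_product']
  have inv : ∀ v : List Step, v.length = L → ∀ p ≤ L, (v.rotate (L - p)).rotate p = v := by
    intro v hv p hp
    rw [List.rotate_rotate, Nat.sub_add_cancel hp, ← hv, List.rotate_length]
  have inv' : ∀ v : List Step, v.length = L → ∀ p ≤ L, (v.rotate p).rotate (L - p) = v := by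
    intro v hv p hp
    rw [List.rotate_rotate, Nat.add_sub_cancel' hp, ← hv, List.rotate_length]
  refine Finset.sum_nbij'
    (fun x => (x.1.rotate (lastAt x.1 (lowest x.1 L + x.2) L), lastAt x.1 (lowest x.1 L + x.2) L))
    (fun y => (y.1.rotate (L - y.2),
      (heightAt (y.1.rotate (L - y.2)) y.2 - lowest (y.1.rotate (L - y.2)) L).toNat))
    ?_ ?_ ?_ ?_ ?_
  · rintro ⟨w, j⟩ hx
    obtain ⟨hw, hj⟩ := Finset.mem_product.1 hx
    have hl := hlen w hw
    have := isPositive_rotate_lastAt (w := w) (j := j)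
      (by rw [hht w hw]; exact_mod_cast Finset.mem_range.1 hj)
    rw [hl] at this
    exact Finset.mem_product.2 ⟨mem_posWords.2 ⟨rotate_mem_words hw, this.2.2⟩,
      Finset.mem_range.2 this.1⟩
  · rintro ⟨v, p⟩ hy
    obtain ⟨hv, hp⟩ := Finset.mem_product.1 hy
    dsimp only at hv hp
    obtain ⟨hv, hpos⟩ := mem_posWords.1 hv
    have hp := Finset.mem_range.1 hp
    have hl := hlen v hv
    have hw := rotate_mem_words (p := L - p) hv
    have hl' := hlen _ hw
    rw [← inv v hl p hp.le] at hpos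
    have h1 := lastAt_of_isPositive_rotate (by omega) hpos
    rw [hl', hht _ hw] at h1
    have h2 := lowest_le (v.rotate (L - p)) hp.le
    refine Finset.mem_product.2 ⟨hw, Finset.mem_range.2 ?_⟩
    dsimp only
    omega
  · rintro ⟨w, j⟩ hx
    obtain ⟨hw, hj⟩ := Finset.mem_product.1 hx
    have hl := hlen w hw
    have := isPositive_rotate_lastAt (w := w) (j := j)
      (by rw [hht w hw]; exact_mod_cast Finset.mem_range.1 hj)
    rw [hl] at this
    simp only [inv' w hl _ this.1.le, this.2.1]
    simp
  · rintro ⟨v, p⟩ hy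
    obtain ⟨hv, hp⟩ := Finset.mem_product.1 hy
    dsimp only at hv hp
    obtain ⟨hv, hpos⟩ := mem_posWords.1 hv
    have hp := Finset.mem_range.1 hp
    have hl := hlen v hv
    have hw := rotate_mem_words (p := L - p) hv
    have hl' := hlen _ hw
    rw [← inv v hl p hp.le] at hpos
    have h1 := lastAt_of_isPositive_rotate (by omega) hpos
    rw [hl', hht _ hw] at h1
    have h2 := lowest_le (v.rotate (L - p)) hp.le
    have h3 : lowest (v.rotate (L - p)) L +
        ((heightAt (v.rotate (L - p)) p - lowest (v.rotate (L - p)) L).toNat : ℤ) =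
        heightAt (v.rotate (L - p)) p := by omega
    simp only [h3, h1.1, inv v hl p hp.le]
  · rintro ⟨w, j⟩ _
    rfl

/-! ### Motzkin left factors -/

open Classical in
/-- The Motzkin left factors with given numbers of letters. -/
noncomputable def leftFactors (a b c : ℕ) : Finset (List Step) :=
  {w ∈ words a b c | ∀ p : List Step, p <+: w → 0 ≤ height p}

theorem mem_leftFactors {a b c : ℕ} {w : List Step} :
    w ∈ leftFactors a b c ↔ w ∈ words a b c ∧ ∀ p : List Step, p <+: w → 0 ≤ height p := by
  classical exact Finset.mem_filter

theorem isPositive_cons_iff (s : Step) (w : List Step) :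
    IsPositive (s :: w) ↔ s = .up ∧ ∀ p : List Step, p <+: w → 0 ≤ height p := by
  have hh : ∀ i, heightAt (s :: w) (i + 1) = s.rise + heightAt w i := by
    intro i
    simp [heightAt, height]
  constructor
  · intro h
    have h1 := h 1 one_pos (by simp)
    rw [hh 0, heightAt_zero] at h1
    have hs : s = .up := by cases s <;> simp_all [Step.rise]
    refine ⟨hs, fun p hp => ?_⟩
    have h2 := h (p.length + 1) (by omega) (by have := hp.length_le; simp; omega)
    rw [hh, heightAt, ← List.prefix_iff_eq_take.1 hp, hs] at h2
    simp only [Step.rise] at h2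
    omega
  · rintro ⟨rfl, h⟩ i hi _
    obtain ⟨i, rfl⟩ := Nat.exists_eq_succ_of_ne_zero hi.ne'
    rw [Nat.succ_eq_add_one, hh]
    have := h _ (List.take_prefix i w)
    simp only [Step.rise, heightAt]
    omega

theorem sum_posWords {a b c : ℕ} (f : List Step → ℝ≥0∞) :
    ∑ v ∈ posWords (a + 1) b c, f v.tail = ∑ x ∈ leftFactors a b c, f x := by
  refine Finset.sum_nbij' List.tail (fun x => .up :: x) ?_ ?_ ?_ ?_ ?_
  · intro v hv
    obtain ⟨h1, h2⟩ := mem_posWords.1 hv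
    rw [mem_words] at h1
    cases v with
    | nil => simp at h1
    | cons s w =>
      obtain ⟨rfl, h3⟩ := (isPositive_cons_iff s w).1 h2
      refine mem_leftFactors.2 ⟨mem_words.2 ?_, h3⟩
      simpa using h1
  · intro x hx
    obtain ⟨h1, h2⟩ := mem_leftFactors.1 hx
    rw [mem_words] at h1
    refine mem_posWords.2 ⟨mem_words.2 ?_, (isPositive_cons_iff _ _).2 ⟨rfl, h2⟩⟩
    simpa using h1
  · intro v hv
    obtain ⟨h1, h2⟩ := mem_posWords.1 hv
    rw [mem_words] at h1
    cases v with
    | nil => simp at h1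
    | cons s w =>
      obtain ⟨rfl, h3⟩ := (isPositive_cons_iff s w).1 h2
      rfl
  · intro x _
    rfl
  · intro v _
    rfl

/-- Rotating a random word gives a sum over left factors. -/
theorem sum_rotate {b c h L : ℕ} (hL : b + (h + 1) + b + c = L) (f : List Step → ℝ≥0∞) :
    ∑ w ∈ words (b + (h + 1)) b c, ∑ j ∈ Finset.range (h + 1),
      f (w.rotate (lastAt w (lowest w L + j) L)).tail = L * ∑ x ∈ leftFactors (b + h) b c, f x := by
  rw [sum_cycle (h := h + 1) rfl hL fun v => f v.tail]
  congr 1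
  exact sum_posWords f

theorem card_leftFactors {b c h L : ℕ} (hL : b + (h + 1) + b + c = L) :
    (words (b + (h + 1)) b c).card * (h + 1) = L * (leftFactors (b + h) b c).card := by
  have := sum_rotate hL fun _ => 1
  simp only [Finset.sum_const, Finset.card_range, nsmul_eq_mul, mul_one] at this
  exact_mod_cast this

theorem F_eq_card {n h m : ℕ} (hh : 1 ≤ h) (hm : 2 * m + h ≤ n + 1) :
    ((leftFactors (m + (h - 1)) m (n + 1 - h - 2 * m)).card : ℝ) = F n h m := by
  obtain ⟨h, rfl⟩ := Nat.exists_eq_succ_of_ne_zero (by omega : h ≠ 0)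
  simp only [Nat.succ_eq_add_one, Nat.add_sub_cancel] at hm ⊢
  obtain ⟨c, hc⟩ : ∃ c, m + (h + 1) + m + c = n + 1 := ⟨n + 1 - (h + 1) - 2 * m, by omega⟩
  rw [show n + 1 - (h + 1) - 2 * m = c by omega]
  have e1 := card_leftFactors hc
  have e2 := card_words _ _ _ _ hc
  have e3 := Nat.choose_mul_factorial_mul_factorial (show m ≤ n + 1 by omega)
  have e4 := Nat.choose_mul_factorial_mul_factorial (show m + (h + 1) ≤ n + 1 - m by omega)
  rw [show n + 1 - m - (m + (h + 1)) = c by omega] at e4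
  have e5 : (words (m + (h + 1)) m c).card =
      (n + 1).choose m * (n + 1 - m).choose (m + (h + 1)) := by
    have hpos : 0 < (m + (h + 1)).factorial * m.factorial * c.factorial := by positivity
    apply Nat.eq_of_mul_eq_mul_right hpos
    rw [e2, ← e3, ← e4]
    ring
  rw [e5] at e1
  unfold F
  rw [div_mul_eq_mul_div, eq_div_iff (by positivity)]
  have e6 := congrArg (Nat.cast : ℕ → ℝ) e1
  push_cast at e6 ⊢
  linarith

theorem mem_leftFactors_iff {n h m : ℕ} (hh : 1 ≤ h) (hm : 2 * m + h ≤ n + 1) (w : List Step) :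
    w ∈ leftFactors (m + (h - 1)) m (n + 1 - h - 2 * m) ↔
      IsMotzkinLeftFactor n ((h : ℤ) - 1) w ∧ w.count .down = m := by
  rw [mem_leftFactors, mem_words, IsMotzkinLeftFactor, height_eq_counts,
    length_eq_counts]
  constructor
  · rintro ⟨⟨h1, h2, h3⟩, h4⟩
    exact ⟨⟨by omega, h4, by omega⟩, h2⟩
  · rintro ⟨⟨h1, h4, h5⟩, h2⟩
    exact ⟨⟨by omega, h2, by omega⟩, h4⟩

theorem two_mul_count_le {n h : ℕ} {w : List Step}
    (hw : IsMotzkinLeftFactor n ((h : ℤ) - 1) w) : 2 * w.count .down + h ≤ n + 1 := by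
  obtain ⟨h1, -, h2⟩ := hw
  rw [height_eq_counts] at h2
  rw [length_eq_counts] at h1
  omega

theorem ncard_leftFactors {n h : ℕ} (hh : 1 ≤ h) (m : ℕ) :
    (Set.ncard {w | IsMotzkinLeftFactor n ((h : ℤ) - 1) w ∧ w.count Step.down = m} : ℝ) =
      F n h m := by
  rcases Nat.lt_or_ge (n + 1) (2 * m + h) with hm | hm
  · rw [F_eq_zero hm, show {w | IsMotzkinLeftFactor n ((h : ℤ) - 1) w ∧ w.count Step.down = m} = ∅
      from ?_]
    · simp
    · ext w
      simp only [Set.mem_ofPred_eq, Set.mem_empty_iff_false, iff_false]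
      rintro ⟨h1, rfl⟩
      have := two_mul_count_le h1
      omega
  · rw [← F_eq_card hh hm, ← Set.ncard_coe_finset]
    congr 2
    ext w
    rw [Finset.mem_coe, mem_leftFactors_iff hh hm]
    rfl

theorem ncard_total {n h : ℕ} (hh : 1 ≤ h) :
    (Set.ncard {w | IsMotzkinLeftFactor n ((h : ℤ) - 1) w} : ℝ) = Ftot n h := by
  classical
  by_cases hhn : h ≤ n + 1
  · have e : {w | IsMotzkinLeftFactor n ((h : ℤ) - 1) w} =
        ((Finset.range ((n + 1 - h) / 2 + 1)).biUnion fun m =>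
          leftFactors (m + (h - 1)) m (n + 1 - h - 2 * m) : Finset (List Step)) := by
      ext w
      simp only [Set.mem_ofPred_eq, Finset.coe_biUnion, Set.mem_iUnion, Finset.mem_coe,
        Finset.mem_range, exists_prop]
      constructor
      · intro hw
        have h1 := two_mul_count_le hw
        obtain ⟨m, hm⟩ : ∃ m, w.count Step.down = m := ⟨_, rfl⟩
        rw [hm] at h1
        exact ⟨m, by omega, (mem_leftFactors_iff hh h1 w).2 ⟨hw, hm⟩⟩
      · rintro ⟨m, hm, hw⟩
        have h1 : 2 * m + h ≤ n + 1 := by omega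
        exact ((mem_leftFactors_iff hh h1 w).1 hw).1
    rw [e, Set.ncard_coe_finset, Finset.card_biUnion, Ftot]
    · push_cast
      refine Finset.sum_congr rfl fun m hm => ?_
      have h1 := Finset.mem_range.1 hm
      have h2 : 2 * m + h ≤ n + 1 := by omega
      exact F_eq_card hh h2
    · intro i hi j hj hij
      rw [Finset.mem_coe, Finset.mem_range] at hi hj
      rw [Function.onFun, Finset.disjoint_left]
      intro w h1 h2
      have h1 := ((mem_leftFactors_iff hh (by omega) w).1 h1).2
      have h2 := ((mem_leftFactors_iff hh (by omega) w).1 h2).2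
      omega
  · rw [show {w | IsMotzkinLeftFactor n ((h : ℤ) - 1) w} = ∅ from ?_]
    · unfold Ftot
      rw [Finset.sum_eq_zero fun m _ => F_eq_zero (by omega)]
      simp
    · ext w
      simp only [Set.mem_ofPred_eq, Set.mem_empty_iff_false, iff_false]
      intro hw
      have := two_mul_count_le hw
      omega

/-! ### The law of the output -/

theorem law_move (y : ℤ) (s : Step) : Returns (move y s) (y + s.rise) := by
  cases s
  · exact law_add y 1
  · exact law_sub y 1
  · exact (law_pure y).congr (by simp [Step.rise])

theorem law_minHeight {n : ℕ} {w : List Step} (hw : w.length = n + 1) :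
    Returns (minHeight n w) (lowest w (n + 1)) := by
  have h1 : Returns (forLoop 0 (n : ℤ) ((0 : ℤ), (0 : ℤ)) (fun i s => do
      let x ← readAt w i
      let y ← move s.1 x
      let b ← lt y s.2
      pure (y, if b then y else s.2))) (heightAt w (n + 1), lowest w (n + 1)) := by
    have := law_forFrom (body := fun i s => do
      let x ← readAt w i
      let y ← move s.1 x
      let b ← lt y s.2
      pure (y, if b then y else s.2)) (fun i => (heightAt w i, lowest w i)) (n + 1) 0
      fun l _ h2 => ?_
    · simp only [heightAt_zero, zero_add] at this
      unfold forLoop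
      rw [show ((n : ℤ) + 1 - 0).toNat = n + 1 by omega]
      exact this
    · have hl : l < w.length := by omega
      refine (law_readAt w l hl).bind ((law_move _ _).bind ((law_lt _ _).bind
        ((law_pure _).congr ?_)))
      rw [heightAt_succ hl, lowest, heightAt_succ hl]
      dsimp only
      congr 1
      by_cases h : heightAt w l + w[l].rise < lowest w l
      · simp [h, min_eq_right h.le]
      · simp [h, min_eq_left (not_lt.1 h)]
  exact h1.bind (law_pure _)

theorem law_lastVisit {n : ℕ} {w : List Step} (e : ℤ) (hw : w.length = n + 1) :
    Returns (lastVisit n w e) (lastAt w e (n + 1) : ℤ) := by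
  have h1 : Returns (forLoop 0 (n : ℤ) ((0 : ℤ), (0 : ℤ)) (fun i s => do
      let x ← readAt w i
      let y ← move s.1 x
      let b ← eq y e
      let i' ← add i 1
      pure (y, if b then i' else s.2))) (heightAt w (n + 1), (lastAt w e (n + 1) : ℤ)) := by
    have := law_forFrom (body := fun i s => do
      let x ← readAt w i
      let y ← move s.1 x
      let b ← eq y e
      let i' ← add i 1
      pure (y, if b then i' else s.2)) (fun i => (heightAt w i, (lastAt w e i : ℤ))) (n + 1) 0
      fun l _ h2 => ?_
    · simp only [heightAt_zero, zero_add] at this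
      unfold forLoop
      rw [show ((n : ℤ) + 1 - 0).toNat = n + 1 by omega]
      exact this
    · have hl : l < w.length := by omega
      refine (law_readAt w l hl).bind ((law_move _ _).bind ((law_eq _ _).bind ((law_add _ _).bind
        ((law_pure _).congr ?_))))
      rw [heightAt_succ hl, lastAt, heightAt_succ hl]
      dsimp only
      congr 1
      by_cases h : heightAt w l + w[l].rise = e
      · simp [h]
      · simp [h]
  exact h1.bind (law_pure _)

theorem law_cyclicTail {n p : ℕ} {w : List Step} (hw : w.length = n + 1) (hp : p < n + 1) :
    Returns (cyclicTail n w p) (w.rotate p).tail := by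
  have hlen : (w.rotate p).tail.length = n := by simp [hw]
  have := law_forFrom (body := fun i out => do
    let j ← add (p : ℤ) i
    let inside ← le j (n : ℤ)
    if inside then do
      let x ← readAt w j
      push out x
    else do
      let n1 ← add (n : ℤ) 1
      let j' ← sub j n1
      let x ← readAt w j'
      push out x) (fun i => (w.rotate p).tail.take (i - 1)) n 1 fun l h1 h2 => ?_
  · unfold cyclicTail forLoop
    rw [show ((n : ℤ) + 1 - 1).toNat = n by omega]
    rw [Nat.add_sub_cancel_left, List.take_of_length_le hlen.le] at this
    exact this
  · have hl : l - 1 < (w.rotate p).tail.length := by omega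
    have e1 : (w.rotate p).tail[l - 1] = w[(l + p) % w.length]'(Nat.mod_lt _ (by omega)) := by
      rw [List.getElem_tail, List.getElem_rotate]
      congr 2
      omega
    have e2 : (w.rotate p).tail.take (l + 1 - 1) =
        (w.rotate p).tail.take (l - 1) ++ [w[(l + p) % w.length]'(Nat.mod_lt _ (by omega))] := by
      rw [← e1, ← List.take_succ_eq_append_getElem hl]
      congr 1
      omega
    rw [e2]
    refine (law_add _ _).bind ((law_le _ _).bind ?_)
    by_cases h3 : p + l ≤ n
    · rw [decide_eq_true (by omega), if_pos rfl]
      have := law_readAt w (p + l) (by omega)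
      push_cast at this
      refine this.bind ((law_push _ _).congr ?_)
      congr 3
      rw [Nat.mod_eq_of_lt (by omega)]
      omega
    · rw [decide_eq_false (by omega), if_neg Bool.false_ne_true]
      have := law_readAt w (p + l - (n + 1)) (by omega)
      rw [show ((p + l - (n + 1) : ℕ) : ℤ) = p + l - (n + 1) by omega] at this
      refine (law_add _ _).bind ((law_sub _ _).bind (this.bind ((law_push _ _).congr ?_)))
      congr 3
      rw [hw, Nat.mod_eq_sub_mod (by omega), Nat.mod_eq_of_lt (by omega)]
      omega

/-- The path that is made from `m` is uniform among the left factors with `m` letters `down`. -/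
theorem law_finish {n h m : ℕ} (hh : 1 ≤ h) (hm : 2 * m + h ≤ n + 1) :
    Law (finish n h m) fun f => ((leftFactors (m + (h - 1)) m (n + 1 - h - 2 * m)).card : ℝ≥0∞)⁻¹ *
      ∑ x ∈ leftFactors (m + (h - 1)) m (n + 1 - h - 2 * m), f x := by
  obtain ⟨h, rfl⟩ := Nat.exists_eq_succ_of_ne_zero (by omega : h ≠ 0)
  simp only [Nat.succ_eq_add_one, Nat.add_sub_cancel] at hm ⊢
  obtain ⟨c, hc⟩ : ∃ c, m + (h + 1) + m + c = n + 1 := ⟨n + 1 - (h + 1) - 2 * m, by omega⟩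
  rw [show n + 1 - (h + 1) - 2 * m = c by omega]
  refine (law_add _ _).bind ((law_add _ _).bind ((law_add _ _).bind ((law_sub _ _).bind ?_)))
  rw [show (m : ℤ) + ((h + 1 : ℕ) : ℤ) = ((m + (h + 1) : ℕ) : ℤ) by push_cast; ring,
    show (n : ℤ) + 1 - (((m + (h + 1) : ℕ) : ℤ) + m) = (c : ℤ) by omega]
  have hcont : ∀ w ∈ words (m + (h + 1)) m c, Law (do
      let low ← minHeight n w
      let j ← random ((h + 1 : ℕ) : ℤ)
      let e ← add low j
      let p ← lastVisit n w e
      cyclicTail n w p) fun f => ∑ j ∈ Finset.range (h + 1), ((h + 1 : ℕ) : ℝ≥0∞)⁻¹ *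
        f (w.rotate (lastAt w (lowest w (n + 1) + j) (n + 1))).tail := by
    intro w hw
    have hw' := mem_words.1 hw
    have hlen : w.length = n + 1 := by
      rw [length_eq_counts, hw'.1, hw'.2.1, hw'.2.2, hc]
    have hht : height w = (h + 1 : ℕ) := by
      rw [height_eq_counts, hw'.1, hw'.2.1]
      push_cast
      ring
    have hrand : Law (random ((h + 1 : ℕ) : ℤ)) fun f =>
        ∑ j ∈ Finset.range (h + 1), ((h + 1 : ℕ) : ℝ≥0∞)⁻¹ * f (j : ℤ) :=
      (law_random (h + 1)).congr fun f => by rw [Finset.mul_sum]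
    refine (law_minHeight hlen).bind (hrand.bind_sum fun j hj => (law_add _ _).bind
      ((law_lastVisit _ hlen).bind (law_cyclicTail hlen ?_)))
    have := (isPositive_rotate_lastAt (w := w) (j := j)
      (by rw [hht]; exact_mod_cast Finset.mem_range.1 hj)).1
    rwa [hlen] at this
  refine ((law_mix (m + (h + 1)) m c).bind_sum hcont).congr fun f => ?_
  simp only [← Finset.mul_sum]
  rw [sum_rotate hc f]
  have e1 := card_leftFactors hc
  have hW : (words (m + (h + 1)) m c).card ≠ 0 := by
    intro h0
    have := card_words _ _ _ _ hc
    rw [h0, zero_mul] at this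
    exact (Nat.factorial_ne_zero _ this.symm)
  have hF : (leftFactors (m + h) m c).card ≠ 0 := by
    intro h0
    rw [h0, mul_zero] at e1
    simp [hW] at e1
  have e2 : ((words (m + (h + 1)) m c).card : ℝ≥0∞) * ((h + 1 : ℕ) : ℝ≥0∞) =
      ((n + 1 : ℕ) : ℝ≥0∞) * ((leftFactors (m + h) m c).card : ℝ≥0∞) := by exact_mod_cast e1
  rw [← mul_assoc, ← mul_assoc]
  congr 1
  have t : ∀ x : ℕ, (x : ℝ≥0∞) ≠ ⊤ := ENNReal.natCast_ne_top
  rw [← ENNReal.mul_inv (Or.inr (t _)) (Or.inl (t _)), e2,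
    ENNReal.mul_inv (Or.inr (t _)) (Or.inl (t _)), mul_right_comm,
    ENNReal.inv_mul_cancel (by exact_mod_cast Nat.succ_ne_zero n) (t _), one_mul]

theorem law_tooBig {n h : ℕ} (hyp : (h : ℝ) < n - 1 / 2 - √(8 * n + 9) / 2) :
    Returns (tooBig n h) false := by
  refine Returns.congr ((law_rofInt _).bind ((law_rofInt _).bind ((law_rmul _ _).bind
    ((law_radd _ _).bind ((law_rsqrt _).bind ((law_rdiv _ _).bind ((law_rdiv _ _).bind
    ((law_rsub _ _).bind ((law_rsub _ _).bind (law_rle _ _)))))))))) ?_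
  refine decide_eq_false ?_
  push_cast
  exact not_le.2 hyp

namespace Params

variable {n h k α : ℕ}

theorem law_motzkin (p : Params n h (argM n h) k α (mTilde n h)) (hk : (k : ℤ) = parK n h)
    (hα : (α : ℤ) = parAlpha n h) (hyp : (h : ℝ) < n - 1 / 2 - √(8 * n + 9) / 2) :
    Law (motzkin n h) fun f => ∑ m ∈ Finset.range ((n + 1 - h) / 2 + 1),
      ENNReal.ofReal (Ftot n h)⁻¹ *
        ∑ x ∈ leftFactors (m + (h - 1)) m (n + 1 - h - 2 * m), f (some x) := by
  have hhn : h ≤ n + 1 := by have := p.two_mul_M_le; omega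
  refine (law_tooBig hyp).bind ?_
  rw [if_neg Bool.false_ne_true]
  refine ((p.law_chooseM hk hα).bind_sum fun m hm => (law_finish p.h_pos
    (by have := Finset.mem_range.1 hm; omega)).bind fun w => law_pure (some w)).congr fun f => ?_
  refine Finset.sum_congr rfl fun m hm => ?_
  have hm' : 2 * m + h ≤ n + 1 := by have := Finset.mem_range.1 hm; omega
  have hF := F_pos p.h_pos hm'
  have hFt := p.Ftot_pos
  rw [← mul_assoc]
  congr 1
  rw [← ENNReal.ofReal_natCast, F_eq_card p.h_pos hm', ← ENNReal.ofReal_inv_of_pos hF,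
    ← ENNReal.ofReal_mul (by positivity)]
  congr 1
  field_simp

theorem prob_motzkin (p : Params n h (argM n h) k α (mTilde n h)) (hk : (k : ℤ) = parK n h)
    (hα : (α : ℤ) = parAlpha n h) (hyp : (h : ℝ) < n - 1 / 2 - √(8 * n + 9) / 2)
    {w : List Step} (hw : IsMotzkinLeftFactor n ((h : ℤ) - 1) w) :
    prob (motzkin n h) (some w) =
      (Set.ncard {u | IsMotzkinLeftFactor n ((h : ℤ) - 1) u} : ℝ≥0∞)⁻¹ := by
  classical
  obtain ⟨m, hm⟩ : ∃ m, w.count Step.down = m := ⟨_, rfl⟩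
  have h1 := two_mul_count_le hw
  rw [hm] at h1
  rw [(p.law_motzkin hk hα hyp).prob_eq, ← ENNReal.ofReal_natCast, ncard_total p.h_pos,
    ← ENNReal.ofReal_inv_of_pos p.Ftot_pos, Finset.sum_eq_single_of_mem m]
  · simp only [Option.some.injEq, Finset.sum_ite_eq']
    rw [if_pos ((mem_leftFactors_iff p.h_pos h1 w).2 ⟨hw, hm⟩), mul_one]
  · rw [Finset.mem_range]
    omega
  · intro j hj hne
    have h2 : 2 * j + h ≤ n + 1 := by
      have := Finset.mem_range.1 hj
      omega
    simp only [Option.some.injEq, Finset.sum_ite_eq']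
    rw [if_neg, mul_zero]
    intro hc
    exact hne (((mem_leftFactors_iff p.h_pos h2 w).1 hc).2.symm.trans hm)

theorem haltProb_motzkin (p : Params n h (argM n h) k α (mTilde n h)) (hk : (k : ℤ) = parK n h)
    (hα : (α : ℤ) = parAlpha n h) (hyp : (h : ℝ) < n - 1 / 2 - √(8 * n + 9) / 2) :
    haltProb (motzkin n h) = 1 := by
  have hhn : h ≤ n + 1 := by have := p.two_mul_M_le; omega
  rw [(p.law_motzkin hk hα hyp).haltProb_eq]
  have e : ∀ m ∈ Finset.range ((n + 1 - h) / 2 + 1),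
      ENNReal.ofReal (Ftot n h)⁻¹ *
        ∑ x ∈ leftFactors (m + (h - 1)) m (n + 1 - h - 2 * m), (1 : ℝ≥0∞) =
      ENNReal.ofReal ((Ftot n h)⁻¹ * F n h m) := by
    intro m hm
    have hm' : 2 * m + h ≤ n + 1 := by have := Finset.mem_range.1 hm; omega
    have hFt := p.Ftot_pos
    rw [ENNReal.ofReal_mul (by positivity), ← F_eq_card p.h_pos hm', ENNReal.ofReal_natCast]
    simp
  have hFt := p.Ftot_pos
  rw [Finset.sum_congr rfl e, ← ENNReal.ofReal_sum_of_nonneg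
    fun m _ => mul_nonneg (by positivity) (F_nonneg n h m), ← Finset.mul_sum, ← Ftot,
    inv_mul_cancel₀ hFt.ne', ENNReal.ofReal_one]

end Params

/-! ### A lower bound for the acceptance probability -/

namespace Params

variable {n h M k α : ℕ} {t : ℝ}

/-- `M` is the mode of the binomial distribution. -/
theorem Bund_le (p : Params n h M k α t) (m : ℕ) : Bund M k α m ≤ Bund M k α M := by
  have hk := p.k_pos
  have hα := p.α_real
  have h0 : (0 : ℝ) ≤ α := α.cast_nonneg
  have hN := p.M_lt_N
  rcases le_total m M with hm | hm
  · refine Nat.decreasingInduction (motive := fun i _ => Bund M k α i ≤ Bund M k α M)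
      (fun i hi ih => le_trans ?_ ih) le_rfl hm
    have e := Bund_succ (M := M) (k := k) (α := α) (m := i) (by omega)
    have hi' : (i : ℝ) + 1 ≤ M := by exact_mod_cast hi
    have h1 : (k : ℝ) * (i + 1) ≤ (k + 1) * M + α - i := by nlinarith
    have h2 := mul_le_mul_of_nonneg_left h1 (Bund_nonneg M k α i)
    rw [← e] at h2
    exact le_of_mul_le_mul_right h2 (by positivity)
  · refine Nat.le_induction (m := M) (P := fun i _ => Bund M k α i ≤ Bund M k α M) le_rfl
      (fun i hi ih => le_trans ?_ ih) m hm
    rcases Nat.lt_or_ge ((k + 1) * M + α) i with h1 | h1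
    · rw [Bund, Nat.choose_eq_zero_of_lt (by omega)]
      simpa using Bund_nonneg M k α i
    · have e := Bund_succ (M := M) (k := k) (α := α) (m := i) h1
      have hi' : (M : ℝ) ≤ i := by exact_mod_cast hi
      have h1 : ((k : ℝ) + 1) * M + α - i ≤ k * (i + 1) := by nlinarith
      have h2 := mul_le_mul_of_nonneg_left h1 (Bund_nonneg M k α i)
      rw [← e] at h2
      exact le_of_mul_le_mul_right h2 (by positivity)

/-- The variance of the binomial distribution. -/
theorem sum_sq_Bund (M k α : ℕ) :
    ∑ m ∈ Finset.range ((k + 1) * M + α + 1),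
      (((((k + 1) * M + α : ℕ) : ℝ) / (k + 1)) - m) ^ 2 * Bund M k α m =
      ((k : ℝ) + 1) ^ ((k + 1) * M + α) * ((((k + 1) * M + α : ℕ) : ℝ) * k / (k + 1) ^ 2) := by
  set N := (k + 1) * M + α with hN
  have hk : (0 : ℝ) < (k : ℝ) + 1 := by positivity
  have e := congrArg (Polynomial.eval (1 / ((k : ℝ) + 1))) (bernsteinPolynomial.variance ℝ N)
  simp only [Polynomial.eval_finsetSum, bernsteinPolynomial, Polynomial.eval_mul,
    Polynomial.eval_pow, Polynomial.eval_sub, Polynomial.eval_X,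
    Polynomial.eval_natCast, Polynomial.eval_one, nsmul_eq_mul] at e
  have e2 : (N : ℝ) * k / ((k : ℝ) + 1) ^ 2 = N * (1 / (k + 1)) * (1 - 1 / ((k : ℝ) + 1)) := by
    field_simp
    ring
  rw [e2, ← e, Finset.mul_sum]
  refine Finset.sum_congr rfl fun m hm => ?_
  have hmN : m ≤ N := Nat.lt_succ_iff.1 (Finset.mem_range.1 hm)
  have e3 : (1 : ℝ) - 1 / (k + 1) = k / (k + 1) := by field_simp; ring
  have e4 : ((k : ℝ) + 1) ^ N = (k + 1) ^ m * (k + 1) ^ (N - m) := by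
    rw [← pow_add, Nat.add_sub_cancel' hmN]
  unfold Bund
  rw [e3, e4, div_pow, div_pow, one_pow, ← hN]
  field_simp

/-- By Chebyshev's inequality, the mode of the binomial distribution has a mass of order at least
`1 / √M`. -/
theorem pow_le_Bund (p : Params n h M k α t) {s : ℕ} (hs : M + 1 < (s + 1) ^ 2) :
    3 / 4 * ((k : ℝ) + 1) ^ ((k + 1) * M + α) ≤ (4 * s + 5) * Bund M k α M := by
  have hk := p.k_pos
  have hα := p.α_real
  have h0 : (0 : ℝ) ≤ α := α.cast_nonneg
  have hM := p.M_real
  have hs' : (M : ℝ) + 1 < (s + 1) ^ 2 := by exact_mod_cast hs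
  set K := ((k : ℝ) + 1) ^ ((k + 1) * M + α) with hK
  have hKpos : 0 < K := by positivity
  set μ := (((k + 1) * M + α : ℕ) : ℝ) / (k + 1) with hμ
  have hμe : μ = M + α / (k + 1) := by
    rw [hμ]; push_cast; field_simp
  have hμ1 : (M : ℝ) ≤ μ := by rw [hμe]; have : (0 : ℝ) ≤ α / (k + 1) := by positivity
                               linarith
  have hμ2 : μ < M + 1 := by
    rw [hμe]
    have : (α : ℝ) / (k + 1) < 1 := by rw [div_lt_one (by positivity)]; linarith
    linarith
  set r := 2 * (s + 1) with hr
  have hr2 : 4 * ((M : ℝ) + 1) ≤ (r : ℝ) ^ 2 := by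
    rw [hr]; push_cast; nlinarith
  have hr0 : (0 : ℝ) < (r : ℝ) ^ 2 := by rw [hr]; positivity
  -- the weight `1 - (m - μ)² / r²` is at most `1`, and negative outside of the window
  have hup : ∑ m ∈ Finset.range ((k + 1) * M + α + 1), (1 - (μ - m) ^ 2 / r ^ 2) * Bund M k α m ≤
      ∑ m ∈ Finset.Icc (M - r) (M + r), Bund M k α M := by
    have h1 : ∀ m, (1 - (μ - m) ^ 2 / (r : ℝ) ^ 2) * Bund M k α m ≤
        if m ∈ Finset.Icc (M - r) (M + r) then Bund M k α M else 0 := by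
      intro m
      split_ifs with hm
      · refine le_trans ?_ (p.Bund_le m)
        refine mul_le_of_le_one_left (Bund_nonneg _ _ _ _) ?_
        have : 0 ≤ (μ - m) ^ 2 / (r : ℝ) ^ 2 := by positivity
        linarith
      · refine mul_nonpos_of_nonpos_of_nonneg ?_ (Bund_nonneg _ _ _ _)
        rw [Finset.mem_Icc, not_and_or, not_le, not_le] at hm
        have hdist : (r : ℝ) ^ 2 ≤ (μ - m) ^ 2 := by
          rcases hm with hm | hm
          · have : (m : ℝ) + r + 1 ≤ M := by exact_mod_cast (by omega : m + r + 1 ≤ M)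
            have : (0 : ℝ) ≤ r := r.cast_nonneg
            exact pow_le_pow_left₀ this (by linarith) 2
          · have : (M : ℝ) + r + 1 ≤ m := by exact_mod_cast hm
            rw [show (μ - m) ^ 2 = (m - μ) ^ 2 by ring]
            have : (0 : ℝ) ≤ r := r.cast_nonneg
            exact pow_le_pow_left₀ this (by linarith) 2
        have : 1 ≤ (μ - m) ^ 2 / (r : ℝ) ^ 2 := (one_le_div hr0).2 hdist
        linarith
    calc _ ≤ ∑ m ∈ Finset.range ((k + 1) * M + α + 1),
          if m ∈ Finset.Icc (M - r) (M + r) then Bund M k α M else 0 :=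
        Finset.sum_le_sum fun m _ => h1 m
      _ ≤ _ := by
        rw [← Finset.sum_filter]
        refine Finset.sum_le_sum_of_subset_of_nonneg (fun m hm => (Finset.mem_filter.1 hm).2)
          fun _ _ _ => Bund_nonneg _ _ _ _
  have hlow : ∑ m ∈ Finset.range ((k + 1) * M + α + 1), (1 - (μ - m) ^ 2 / r ^ 2) * Bund M k α m =
      K - K * ((((k + 1) * M + α : ℕ) : ℝ) * k / (k + 1) ^ 2) / r ^ 2 := by
    rw [← sum_sq_Bund, hK, ← sum_Bund, Finset.sum_div, ← Finset.sum_sub_distrib]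
    refine Finset.sum_congr rfl fun m _ => ?_
    ring
  have hvar : (((k + 1) * M + α : ℕ) : ℝ) * k / (k + 1) ^ 2 ≤ M + 1 := by
    have : (((k + 1) * M + α : ℕ) : ℝ) * k / (k + 1) ^ 2 = μ * (k / (k + 1)) := by
      rw [hμ]; field_simp
    rw [this]
    have h1 : (k : ℝ) / (k + 1) ≤ 1 := by rw [div_le_one (by positivity)]; linarith
    have : 0 ≤ μ := by linarith
    nlinarith
  have hvar2 : K * ((((k + 1) * M + α : ℕ) : ℝ) * k / (k + 1) ^ 2) / r ^ 2 ≤ K * (1 / 4) := by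
    rw [mul_div_assoc]
    refine mul_le_mul_of_nonneg_left ?_ hKpos.le
    rw [div_le_iff₀ hr0]
    linarith
  have hcard : ∑ m ∈ Finset.Icc (M - r) (M + r), Bund M k α M ≤ (4 * s + 5) * Bund M k α M := by
    rw [Finset.sum_const, nsmul_eq_mul]
    refine mul_le_mul_of_nonneg_right ?_ (Bund_nonneg _ _ _ _)
    rw [Nat.card_Icc]
    exact_mod_cast (by omega : M + r + 1 - (M - r) ≤ 4 * s + 5)
  linarith

/-- One step of the descent of `F` to the left of its maximum. -/
theorem F_pred_ge (p : Params n h M k α t) {j : ℕ} (hj : j < M) (hj' : 3 * j + 4 ≤ M + 1) :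
    (1 - (3 * j + 4) / ((M : ℝ) + 1)) ^ 2 * F n h (M - j) ≤ F n h (M - (j + 1)) := by
  have h2M := p.two_mul_M_le
  have hh : (0 : ℝ) ≤ h := h.cast_nonneg
  have hM := p.M_real
  have hjM : (j : ℝ) + 1 ≤ M := by exact_mod_cast hj
  have hj3 : 3 * (j : ℝ) + 4 ≤ M + 1 := by exact_mod_cast hj'
  have e := F_succ (n := n) (h := h) (m := M - (j + 1)) p.h_pos (by omega)
  rw [show M - (j + 1) + 1 = M - j by omega, Nat.cast_sub (show j + 1 ≤ M by omega)] at e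
  push_cast at e
  set v := (n : ℝ) + 1 - h - 2 * M with hv
  have hv0 : 0 ≤ v := by
    have : 2 * (M : ℝ) + h ≤ n + 1 := by exact_mod_cast h2M
    rw [hv]; linarith
  set X := √(((M : ℝ) + 1) * (M + 1 + h)) with hX
  have hX2 : X ^ 2 = ((M : ℝ) + 1) * (M + 1 + h) := Real.sq_sqrt (by positivity)
  have hX0 : 0 ≤ X := Real.sqrt_nonneg _
  have hXM : (M : ℝ) + 1 ≤ X := Real.le_sqrt_of_sq_le (by nlinarith)
  have hvX : v ≤ X + 1 := by
    have := p.P_le le_rfl h2M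
    rw [← hX2] at this
    by_contra! hc
    nlinarith
  set q := (M : ℝ) + 1 with hq
  have hq0 : 0 < q := by positivity
  set a := (3 * (j : ℝ) + 4) / q with ha
  have hqa : q * a = 3 * j + 4 := by rw [ha]; field_simp
  have ha1 : 0 ≤ 1 - a := by
    rw [sub_nonneg, ha, div_le_one hq0]
    exact hj3
  -- `(M - j) X / (M + 1) ≥ (1 - a) (X + 2 j + 3)`
  have hroot : (1 - a) * (X + 2 * j + 3) * q ≤ (M - j) * X := by
    have h1 : (q * a) * (X + 2 * j + 3) = (3 * j + 4) * (X + 2 * j + 3) := by rw [hqa]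
    have h2 : (2 * (j : ℝ) + 3) * q ≤ (2 * j + 3) * X :=
      mul_le_mul_of_nonneg_left hXM (by positivity)
    have h3 : (0 : ℝ) ≤ (3 * j + 4) * (2 * j + 3) := by positivity
    have h4 : ((M : ℝ) - j) * X = q * X - (j + 1) * X := by rw [hq]; ring
    have h5 : (1 - a) * (X + 2 * j + 3) * q = q * (X + 2 * j + 3) - q * a * (X + 2 * j + 3) := by
      ring
    rw [h5, h1, h4]
    linarith
  have hP : (v + 2 * j + 2) * (v + 2 * j + 1) ≤ (X + 2 * j + 3) ^ 2 := by
    rw [sq]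
    apply mul_le_mul <;> linarith [(Nat.cast_nonneg j : (0 : ℝ) ≤ j)]
  have hlow : ((M - j) * X) ^ 2 ≤ q ^ 2 * ((M - j) * (M - j + h)) := by
    rw [mul_pow, hX2]
    have : ((M : ℝ) - j) * (M + 1 + h) ≤ q * (M - j + h) := by
      rw [hq]; nlinarith [(Nat.cast_nonneg j : (0 : ℝ) ≤ j)]
    have h5 : 0 ≤ ((M : ℝ) - j) * q := mul_nonneg (by linarith) hq0.le
    have h6 := mul_le_mul_of_nonneg_left this h5
    calc ((M : ℝ) - j) ^ 2 * (q * (M + 1 + h)) = (M - j) * q * ((M - j) * (M + 1 + h)) := by ring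
      _ ≤ (M - j) * q * (q * (M - j + h)) := h6
      _ = _ := by ring
  have hprod : (1 - a) ^ 2 * ((v + 2 * j + 2) * (v + 2 * j + 1)) ≤
      (M - j) * ((M : ℝ) - j + h) := by
    have h1 : ((1 - a) * (X + 2 * j + 3) * q) ^ 2 ≤ ((M - j) * X) ^ 2 :=
      pow_le_pow_left₀ (by positivity) hroot 2
    have h2 : (1 - a) ^ 2 * ((v + 2 * j + 2) * (v + 2 * j + 1)) ≤
        (1 - a) ^ 2 * (X + 2 * j + 3) ^ 2 := mul_le_mul_of_nonneg_left hP (by positivity)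
    have h3 : q ^ 2 * ((1 - a) ^ 2 * (X + 2 * j + 3) ^ 2) ≤
        q ^ 2 * ((M - j) * (M - j + h)) := by
      refine le_trans (le_of_eq ?_) (h1.trans hlow)
      ring
    exact h2.trans (le_of_mul_le_mul_left h3 (by positivity))
  have hF := F_nonneg n h (M - j)
  have hpos : (0 : ℝ) < (v + 2 * j + 2) * (v + 2 * j + 1) := by positivity
  have h6 := mul_le_mul_of_nonneg_left hprod hF
  have h7 : F n h (M - j) * ((M - j) * (M - j + h)) =
      F n h (M - (j + 1)) * ((v + 2 * j + 2) * (v + 2 * j + 1)) := by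
    rw [hv]
    linear_combination e
  rw [h7, ← mul_assoc] at h6
  have := le_of_mul_le_mul_right h6 hpos
  linarith

/-- `F` is at least a quarter of its maximum on an interval of length of order `√M`. -/
theorem quarter_le_F (p : Params n h M k α t) (j : ℕ) (hj : 3 * j ^ 2 + 5 * j ≤ M + 1) :
    1 / 4 * F n h M ≤ F n h (M - j) := by
  have hM := p.M_real
  have key : ∀ i ≤ j, (1 - (3 * (i : ℝ) ^ 2 + 5 * i) / (2 * (M + 1))) ^ 2 * F n h M ≤
      F n h (M - i) := by
    intro i
    induction i with
    | zero => intro _; simp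
    | succ i ih =>
      intro hi
      have hi1 : 3 * (i + 1) ^ 2 + 5 * (i + 1) ≤ M + 1 :=
        le_trans (by gcongr) hj
      have hi2 : 3 * ((i : ℝ) + 1) ^ 2 + 5 * (i + 1) ≤ M + 1 := by exact_mod_cast hi1
      have h1 := ih (by omega)
      have h2 := p.F_pred_ge (j := i) (by nlinarith) (by nlinarith)
      refine le_trans ?_ h2
      have hi0 : (0 : ℝ) ≤ i := i.cast_nonneg
      set a := (3 * (i : ℝ) + 4) / (M + 1) with ha
      set A := (3 * (i : ℝ) ^ 2 + 5 * i) / (2 * (M + 1)) with hA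
      have hA' : (3 * ((i + 1 : ℕ) : ℝ) ^ 2 + 5 * ((i + 1 : ℕ) : ℝ)) / (2 * (M + 1)) = A + a := by
        rw [ha, hA]; push_cast; field_simp; ring
      have hAa : A + a ≤ 1 := by
        rw [← hA', div_le_one (by positivity)]
        push_cast
        linarith
      have hA0 : 0 ≤ A := by positivity
      have ha0 : 0 ≤ a := by positivity
      rw [hA']
      have h3 : (1 - (A + a)) ^ 2 ≤ ((1 - a) * (1 - A)) ^ 2 :=
        pow_le_pow_left₀ (by linarith) (by nlinarith) 2
      calc (1 - (A + a)) ^ 2 * F n h M ≤ ((1 - a) * (1 - A)) ^ 2 * F n h M :=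
            mul_le_mul_of_nonneg_right h3 (F_nonneg _ _ _)
        _ = (1 - a) ^ 2 * ((1 - A) ^ 2 * F n h M) := by ring
        _ ≤ _ := mul_le_mul_of_nonneg_left h1 (by positivity)
  refine le_trans ?_ (key j le_rfl)
  refine mul_le_mul_of_nonneg_right ?_ (F_nonneg _ _ _)
  have hj' : 3 * (j : ℝ) ^ 2 + 5 * j ≤ M + 1 := by exact_mod_cast hj
  have : (3 * (j : ℝ) ^ 2 + 5 * j) / (2 * (M + 1)) ≤ 1 / 2 := by
    rw [div_le_iff₀ (by positivity)]
    linarith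
  nlinarith

/-- The total of `F` is at least of order `√M` times its maximum. -/
theorem F_le_Ftot (p : Params n h M k α t) {s : ℕ} (hs : s ^ 2 ≤ M + 1) :
    (s + 1) / 12 * F n h M ≤ Ftot n h := by
  set J := s / 3 with hJ
  have h3J : 3 * J ≤ s := by omega
  have hJ2 : 3 * J ^ 2 + 5 * J ≤ M + 1 := by
    have : J ≤ J ^ 2 := Nat.le_self_pow two_ne_zero J
    nlinarith
  have hJM : J ≤ M := by
    have := p.two_le_M
    nlinarith
  have h1 : ∑ m ∈ Finset.Icc (M - J) M, F n h m ≤ Ftot n h := by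
    rw [p.Ftot_eq]
    refine Finset.sum_le_sum_of_subset_of_nonneg (fun m hm => ?_) fun m _ _ => F_nonneg n h m
    have := p.M_lt_N
    rw [Finset.mem_Icc] at hm
    rw [Finset.mem_range]
    omega
  have h2 : ∑ m ∈ Finset.Icc (M - J) M, 1 / 4 * F n h M ≤ ∑ m ∈ Finset.Icc (M - J) M, F n h m := by
    refine Finset.sum_le_sum fun m hm => ?_
    rw [Finset.mem_Icc] at hm
    have := p.quarter_le_F (M - m) (le_trans (by gcongr <;> omega) hJ2)
    rwa [show M - (M - m) = m by omega] at this
  rw [Finset.sum_const, Nat.card_Icc, show M + 1 - (M - J) = J + 1 by omega, nsmul_eq_mul] at h2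
  have h3 : (s : ℝ) + 1 ≤ 3 * ((J + 1 : ℕ) : ℝ) := by exact_mod_cast (by omega : s + 1 ≤ 3 * (J + 1))
  have hF := F_nonneg n h M
  nlinarith

/-- One iteration of the main loop returns a value with a probability bounded away from `0`. -/
theorem accProb_ge (p : Params n h M k α t) : 1 / 120 ≤ accProb n h M k α := by
  set s := Nat.sqrt (M + 1)
  have h1 := p.F_le_Ftot (s := s) (Nat.sqrt_le' (M + 1))
  have h2 := p.pow_le_Bund (s := s) (Nat.lt_succ_sqrt' (M + 1))
  have h3 := p.B_self_ge
  have h4 := p.B_self_le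
  have h5 := p.Btot_eq
  have hFM := F_pos p.h_pos p.two_mul_M_le
  have hBt := p.Btot_pos
  have hb : 0 < Bund M k α M := Bund_pos p.one_le_k (by have := p.M_lt_N; omega)
  have hs : (0 : ℝ) ≤ s := s.cast_nonneg
  set K := ((k : ℝ) + 1) ^ ((k + 1) * M + α)
  have h6 : Btot M k α ≤ 4 / 3 * ((4 * s + 5) * Bund M k α M) := by linarith
  rw [accProb, le_div_iff₀ (by positivity)]
  calc 1 / 120 * (F n h M * Btot M k α)
      ≤ 1 / 120 * (F n h M * (4 / 3 * ((4 * s + 5) * Bund M k α M))) := by gcongr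
    _ ≤ ((s + 1) / 12 * F n h M) * (2 / 3 * Bund M k α M) := by
        have : 0 < F n h M * Bund M k α M := by positivity
        nlinarith
    _ ≤ Ftot n h * B M k α M := by
        apply mul_le_mul h1 h3 (by positivity) p.Ftot_pos.le

end Params

/-! ### Time budgets -/

section Budget

variable {β γ σ : Type} {W T S : ℕ}

theorem Spec.weaken {p : RAM β} {Q R : β → Prop} (h : Spec W p (S : ℕ) Q) (hS : S ≤ T)
    (hR : ∀ a, Q a → R a) : Spec W p (T : ℕ) R :=
  h.mono (by exact_mod_cast hS) hR

open Classical in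
/-- The result of a deterministic computation may be used as its postcondition. -/
theorem Spec.returns {p : RAM β} {a : β} {Q : β → Prop} (hp : Spec W p (T : ℕ) Q)
    (h : Returns p a) : Spec W p (T : ℕ) (· = a) where
  post := h.post (Q := (· = a)) (by simp)
  ints := hp.ints
  cost := hp.cost

theorem Spec.ret {a : β} {Q : β → Prop} (h : Q a) : Spec W (Pure.pure a : RAM β) (T : ℕ) Q :=
  (Spec.pure h).mono zero_le fun _ h => h

/-- Sequential composition, with the time `T` that is left as a budget. -/
theorem Spec.seq {p : RAM β} {g : β → RAM γ} {Q : β → Prop} {R : γ → Prop}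
    (hp : Spec W p (S : ℕ) Q) (hS : S ≤ T)
    (hg : ∀ a, Q a → Spec W (g a) ((T - S : ℕ) : ℝ≥0∞) R) : Spec W (p >>= g) (T : ℕ) R :=
  (hp.bind hg).mono (le_of_eq (by exact_mod_cast Nat.add_sub_cancel' hS)) fun _ h => h

theorem Spec.unit_seq {a : β} {g : β → RAM γ} {R : γ → Prop} (hT : 1 ≤ T)
    (hg : Spec W (g a) ((T - 1 : ℕ) : ℝ≥0∞) R) :
    Spec W (MotzkinGen.unitOp a >>= g) (T : ℕ) R := by
  refine Spec.seq (S := 1) ((Spec.unitOp a).mono (by simp) fun _ h => h) hT ?_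
  rintro _ rfl
  exact hg

theorem Spec.int_seq {z : ℤ} {g : ℤ → RAM γ} {R : γ → Prop} (hT : 1 ≤ T) (hz : |z| ≤ W)
    (hg : Spec W (g z) ((T - 1 : ℕ) : ℝ≥0∞) R) :
    Spec W (MotzkinGen.intOp z >>= g) (T : ℕ) R := by
  refine Spec.seq (S := 1) ((Spec.intOp hz).mono (by simp) fun _ h => h) hT ?_
  rintro _ rfl
  exact hg

theorem Spec.unit_last {a : β} {R : β → Prop} (hT : 1 ≤ T) (h : R a) :
    Spec W (MotzkinGen.unitOp a) (T : ℕ) R := by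
  refine (Spec.unitOp a).mono (by exact_mod_cast hT) ?_
  rintro _ rfl
  exact h

theorem Spec.int_last {z : ℤ} {R : ℤ → Prop} (hT : 1 ≤ T) (hz : |z| ≤ W) (h : R z) :
    Spec W (MotzkinGen.intOp z) (T : ℕ) R := by
  refine (Spec.intOp hz).mono (by exact_mod_cast hT) ?_
  rintro _ rfl
  exact h

theorem Spec.random_seq {k : ℤ} {g : ℤ → RAM γ} {R : γ → Prop} (hT : 1 ≤ T) (hk : |k| ≤ W)
    (hg : ∀ v, 0 ≤ v → v < k → Spec W (g v) ((T - 1 : ℕ) : ℝ≥0∞) R) :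
    Spec W (MotzkinGen.random k >>= g) (T : ℕ) R :=
  Spec.seq (S := 1) ((Spec.random hk).mono (by simp) fun _ h => h) hT fun v hv => hg v hv.1 hv.2

theorem Spec.readAt_seq {w : List Step} {i : ℤ} {g : Step → RAM γ} {R : γ → Prop} (hT : 1 ≤ T)
    (hg : ∀ v, Spec W (g v) ((T - 1 : ℕ) : ℝ≥0∞) R) :
    Spec W (MotzkinGen.readAt w i >>= g) (T : ℕ) R :=
  Spec.seq (S := 1) ((Spec.readAt w i).mono (by simp) fun _ h => h) hT fun v _ => hg v

theorem Spec.forLoop {body : ℤ → σ → RAM σ} (I : ℤ → σ → Prop) {lo hi : ℤ} {s : σ} (j : ℕ)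
    (hj : hi + 1 - lo ≤ j) (hlo : lo ≤ hi + 1) (hs : I lo s)
    (hb : ∀ l s, lo ≤ l → l ≤ hi → I l s → Spec W (body l s) (S : ℕ) (I (l + 1)))
    (hW : ∀ l, lo < l → l ≤ hi + 1 → |l| ≤ W) (hT : j * (S + 2) + 1 ≤ T) :
    Spec W (MotzkinGen.forLoop lo hi s body) (T : ℕ) (I (hi + 1)) := by
  have h1 : ((hi + 1 - lo).toNat : ℤ) = hi + 1 - lo := Int.toNat_of_nonneg (by omega)
  have := Spec.forFrom (W := W) (T := (S : ℕ)) I (hi + 1 - lo).toNat lo s hs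
    (fun l s hl hl' => hb l s hl (by omega)) (fun l hl hl' => hW l hl (by omega))
  rw [h1, show lo + (hi + 1 - lo) = hi + 1 by ring] at this
  refine this.mono ?_ fun _ h => h
  have h2 : (hi + 1 - lo).toNat ≤ j := by omega
  have h3 : (hi + 1 - lo).toNat * (S + 2) + 1 ≤ T :=
    (Nat.add_le_add_right (Nat.mul_le_mul_right _ h2) 1).trans hT
  exact_mod_cast h3

theorem Spec.forAll {test : ℤ → RAM Bool} {R : Bool → Prop} {lo hi : ℤ} (j : ℕ)
    (hj : hi + 1 - lo ≤ j)
    (hb : ∀ l, lo ≤ l → l ≤ hi → Spec W (test l) (S : ℕ) fun _ => True)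
    (hW : ∀ l, lo < l → l ≤ hi + 1 → |l| ≤ W) (hT : j * (S + 2) + 1 ≤ T) (hR : ∀ b, R b) :
    Spec W (MotzkinGen.forAll lo hi test) (T : ℕ) R := by
  have := Spec.allFrom (W := W) (T := (S : ℕ)) (test := test) (hi + 1 - lo).toNat lo
    (fun l hl hl' => hb l hl (by omega)) (fun l hl hl' => hW l hl (by omega))
  refine this.mono ?_ fun b _ => hR b
  have h2 : (hi + 1 - lo).toNat ≤ j := by omega
  have h3 : (hi + 1 - lo).toNat * (S + 2) + 1 ≤ T :=
    (Nat.add_le_add_right (Nat.mul_le_mul_right _ h2) 1).trans hT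
  exact_mod_cast h3

/-- A loop that runs through the states `i, i + 1, …` until `j`. -/
theorem Spec.loop_search {body : ℤ → RAM (ℤ ⊕ ℤ)} (j : ℕ)
    (hstep : ∀ i : ℕ, i < j → Spec W (body i) (S : ℕ) (· = .inl ((i : ℤ) + 1)))
    (hend : Spec W (body j) (S : ℕ) (· = .inr (j : ℤ))) (hT : (j + 1) * (S + 1) ≤ T) :
    Spec W (MotzkinGen.loop body 0) (T : ℕ) (· = (j : ℤ)) := by
  have key : ∀ N l i : ℕ, i + l = j →
      Spec W (loopN body N i) (((l + 1) * (S + 1) : ℕ) : ℝ≥0∞) (· = (j : ℤ)) := by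
    intro N
    induction N with
    | zero => exact fun l i _ => (Spec.crash (Q := (· = (j : ℤ)))).mono zero_le fun _ h => h
    | succ N ih =>
      intro l i hi
      rw [loopN]
      cases l with
      | zero =>
        obtain rfl : i = j := by omega
        refine Spec.unit_seq (by omega) (Spec.seq hend (by omega) ?_)
        rintro _ rfl
        exact Spec.ret rfl
      | succ l =>
        refine Spec.unit_seq (by nlinarith) (Spec.seq (hstep i (by omega)) ?_ ?_)
        · rw [add_mul _ 1]
          omega
        · rintro _ rfl
          have := ih l (i + 1) (by omega)
          rw [Nat.cast_succ] at this
          refine Spec.weaken this ?_ fun _ h => h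
          rw [add_mul (l + 1) 1]
          omega
  have key' := fun N => key N j 0 (by omega)
  simp only [Nat.cast_zero] at key'
  refine Spec.weaken (S := (j + 1) * (S + 1)) ⟨fun c o ho => ?_, fun c o ho => ?_, fun c x => ?_⟩
    hT fun _ h => h
  · obtain ⟨N, hN⟩ := exists_of_loop_ne_zero ho
    exact (key' N).post c o hN
  · obtain ⟨N, hN⟩ := exists_of_loop_ne_zero ho
    exact (key' N).ints c o hN
  · rw [ev_loop]
    exact iSup_le fun N => (key' N).cost c x

end Budget

/-! ### Size of the integers -/

/-- The bound `W` dominates `n (n-1)`, the largest numerator `k P 0` of the acceptance tests, and the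
product that decides between the cases `+` and `-`. All other integers that are computed are at most
one of these in absolute value. -/
structure Fits (n h M k W : ℕ) : Prop where
  sq : (n : ℝ) * (n - 1) ≤ W
  num : (k : ℝ) * ((n + 1 - h) * (n - h)) ≤ W
  which : (k : ℝ) * M * (k * (M + 1)) ≤ W

/-- Integer inequalities between the parameters and the bound `W`: linear ones in the atoms `n`, `h`,
`M`, `k`, `α` and `k * M`, which bound all linear expressions by `5 n`, and the quadratic ones of
`Fits`. -/
structure IntFacts (n h M k α W : ℤ) : Prop where
  six_le : 6 ≤ n
  h_pos : 1 ≤ h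
  two_le : 2 ≤ M
  k_pos : 1 ≤ k
  α_nonneg : 0 ≤ α
  α_lt : α + 1 ≤ k
  le_n : 2 * M + h + 1 ≤ n
  kM_ge : 2 * k ≤ k * M
  kM_le : k * M + α + h ≤ n
  five : 5 * n ≤ W
  sq : n * (n - 1) ≤ W
  num : k * ((n + 1 - h) * (n - h)) ≤ W
  which : k * M * (k * (M + 1)) ≤ W

namespace Params

variable {n h M k α W : ℕ} {t : ℝ}

theorem kM_add_α_le (p : Params n h M k α t) : k * M + α + h ≤ n := by
  have h1 := p.upper
  have h2 := p.k_lt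
  have h3 := p.one_lt
  have hk := p.k_pos
  -- `kM + α ≤ k t + k`, where both summands are less than `(n + 1 - h) / 2`
  have h4 : (k : ℝ) * 1 ≤ k * t := mul_le_mul_of_nonneg_left h3.le (by linarith)
  have h5 : (k : ℝ) * M + α + h < n + 1 := by linarith
  exact Nat.lt_succ_iff.1 (by exact_mod_cast h5)

theorem intFacts (p : Params n h M k α t) (w : Fits n h M k W) : IntFacts n h M k α W := by
  have h6 : 6 ≤ n := by
    have := p.three_lt
    have := p.one_lt
    have : (1 : ℝ) ≤ h := by exact_mod_cast p.h_pos
    have : (5 : ℝ) < n := by linarith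
    exact_mod_cast this
  have h7 : (2 * M + h + 1 : ℕ) ≤ n := by
    have := p.three_lt
    have := p.M_lt
    have : (2 : ℝ) * M + h < n := by linarith
    exact_mod_cast this
  have hM := p.two_le_M
  have hsq : (n : ℤ) * (n - 1) ≤ W := by exact_mod_cast w.sq
  exact
    { six_le := by exact_mod_cast h6
      h_pos := by exact_mod_cast p.h_pos
      two_le := by exact_mod_cast hM
      k_pos := by exact_mod_cast p.one_le_k
      α_nonneg := Int.natCast_nonneg _
      α_lt := by exact_mod_cast p.α_lt
      le_n := by exact_mod_cast h7
      kM_ge := by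
        have := Nat.mul_le_mul_left k hM
        rw [mul_comm 2]
        exact_mod_cast this
      kM_le := by exact_mod_cast p.kM_add_α_le
      five := by
        have : (6 : ℤ) ≤ n := by exact_mod_cast h6
        nlinarith
      sq := hsq
      num := by exact_mod_cast w.num
      which := by exact_mod_cast w.which }

end Params

namespace IntFacts

variable {n h M k α : ℤ} {W : ℕ}

/-- `P i` lies between `0` and `P 0`. -/
theorem numF_mem (f : IntFacts n h M k α W) {i : ℤ} (h0 : 0 ≤ i) (h1 : 2 * i + h ≤ n + 1) :
    0 ≤ (n - h - 2 * i + 1) * (n - h - 2 * i) ∧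
      (n - h - 2 * i + 1) * (n - h - 2 * i) ≤ (n + 1 - h) * (n - h) := by
  constructor
  · rcases h1.eq_or_lt with h2 | h2
    · rw [show n - h - 2 * i + 1 = 0 by linarith, zero_mul]
    · exact mul_nonneg (by omega) (by omega)
  · nlinarith [mul_nonneg h0 (by linarith [f.six_le, f.le_n, f.two_le] : 0 ≤ 2 * (n - h) - 2 * i + 1)]

theorem sq_le (f : IntFacts n h M k α W) : (n + 1 - h) * (n - h) ≤ n * (n - 1) := by
  have := f.h_pos
  have := f.le_n
  have := f.two_le
  exact mul_le_mul (by omega) (by omega) (by omega) (by omega)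

theorem spec_numF (f : IntFacts n h M k α W) {i : ℤ} (h0 : 0 ≤ i) (h1 : 2 * i + h ≤ n + 1) :
    Spec W (numF n h i) (5 : ℕ) (· = (n - h - 2 * i + 1) * (n - h - 2 * i)) := by
  obtain ⟨_, _, _, _, _, _, _, _, _, _, _, _, _⟩ := id f
  have h2 := f.numF_mem h0 h1
  have h3 := f.sq_le
  refine Spec.int_seq (by omega) (abs_le.2 ⟨by omega, by omega⟩) ?_
  refine Spec.int_seq (by omega) (abs_le.2 ⟨by omega, by omega⟩) ?_
  refine Spec.int_seq (by omega) (abs_le.2 ⟨by omega, by omega⟩) ?_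
  refine Spec.int_seq (by omega) (abs_le.2 ⟨by omega, by omega⟩) ?_
  exact Spec.int_last (by omega) (abs_le.2 ⟨by linarith, by linarith⟩) rfl

theorem num_mem (f : IntFacts n h M k α W) {i : ℤ} (h0 : 0 ≤ i) (h1 : 2 * i + h ≤ n + 1) :
    |k * ((n - h - 2 * i + 1) * (n - h - 2 * i))| ≤ W := by
  have h2 := f.numF_mem h0 h1
  have h3 := f.k_pos
  have h4 := mul_le_mul_of_nonneg_left h2.2 (by omega : 0 ≤ k)
  have h5 := mul_nonneg (by omega : 0 ≤ k) h2.1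
  exact abs_le.2 ⟨by linarith, h4.trans f.num⟩

theorem numF_abs (f : IntFacts n h M k α W) {i : ℤ} (h0 : 0 ≤ i) (h1 : 2 * i + h ≤ n + 1) :
    |(n - h - 2 * i + 1) * (n - h - 2 * i)| ≤ W := by
  have h2 := f.numF_mem h0 h1
  have h3 := f.sq_le.trans f.sq
  exact abs_le.2 ⟨by linarith, by linarith⟩

/-- For `i ≤ M < (n + 1 - h) / 2`, the product `(i+1) (i+1+h)` is at most of order `n² / 4`. -/
theorem denF_abs (f : IntFacts n h M k α W) {i : ℤ} (h0 : 0 ≤ i) (h1 : i ≤ M) :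
    |(i + 1) * (i + 1 + h)| ≤ W := by
  obtain ⟨_, _, _, _, _, _, _, _, _, _, _, _, _⟩ := id f
  have h2 : (i + 1) * (i + 1 + h) ≤ (M + 1) * (M + 1 + h) :=
    mul_le_mul (by omega) (by omega) (by omega) (by omega)
  have h3 : 0 ≤ (i + 1) * (i + 1 + h) := mul_nonneg (by omega) (by omega)
  have h4 : (2 * (M + 1)) * (2 * (M + 1 + h)) ≤ (n + 1) * (n + 1) := by
    nlinarith
  have h5 : (n + 1) * (n + 1) ≤ 4 * (n * (n - 1)) := by nlinarith
  exact abs_le.2 ⟨by linarith, by linarith⟩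

theorem spec_denF (f : IntFacts n h M k α W) {i : ℤ} (h0 : 0 ≤ i) (h1 : i ≤ M) :
    Spec W (denF h i) (3 : ℕ) (· = (i + 1) * (i + 1 + h)) := by
  have h2 := f.denF_abs h0 h1
  obtain ⟨_, _, _, _, _, _, _, _, _, _, _, _, _⟩ := id f
  refine Spec.int_seq (by omega) (abs_le.2 ⟨by omega, by omega⟩) ?_
  refine Spec.int_seq (by omega) (abs_le.2 ⟨by omega, by omega⟩) ?_
  exact Spec.int_last (by omega) h2 rfl

theorem spec_denG (f : IntFacts n h M k α W) {i : ℤ} (h0 : 0 ≤ i) (h1 : 2 * i + h ≤ n + 1)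
    (h2 : |(i + 1 + h) * ((k + 1) * M + α - i)| ≤ W) :
    Spec W (denG h M k α i) (7 : ℕ) (· = (i + 1 + h) * ((k + 1) * M + α - i)) := by
  obtain ⟨_, _, _, _, _, _, _, _, _, _, _, _, _⟩ := id f
  have h3 : (k + 1) * M = k * M + M := by ring
  refine Spec.int_seq (by omega) (abs_le.2 ⟨by omega, by omega⟩) ?_
  refine Spec.int_seq (by omega) (abs_le.2 ⟨by omega, by omega⟩) ?_
  refine Spec.int_seq (by omega) (abs_le.2 ⟨by omega, by omega⟩) ?_
  refine Spec.int_seq (by omega) (abs_le.2 ⟨by omega, by omega⟩) ?_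
  refine Spec.int_seq (by omega) (abs_le.2 ⟨by omega, by omega⟩) ?_
  refine Spec.int_seq (by omega) (abs_le.2 ⟨by omega, by omega⟩) ?_
  exact Spec.int_last (by omega) h2 rfl

theorem spec_flip {P Q : ℤ} (hP : |P| ≤ W) : Spec W (flip P Q) (2 : ℕ) fun _ => True :=
  Spec.random_seq (by omega) hP fun _ _ _ => Spec.unit_last (by omega) trivial

end IntFacts

namespace Params

variable {n h M k α W : ℕ} {t : ℝ}

theorem spec_testBelow (p : Params n h M k α t) (w : Fits n h M k W) (c : Which) :
    Spec W (testBelow n h M k α c) (20 : ℕ) fun _ => True := by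
  have f := p.intFacts w
  have h1 : ((M : ℤ) + h) * (k * M + α) < k * ((n - h - 2 * (M - 1) + 1) * (n - h - 2 * (M - 1))) := by
    have := p.below_lt
    have h2 : ((M : ℤ) + h) * (k * M + α) <
        k * ((n + 1 - h - 2 * (M - 1)) * (n - h - 2 * (M - 1))) := by exact_mod_cast this
    linarith
  obtain ⟨_, _, _, _, _, _, _, _, _, _, _, _, _⟩ := id f
  have h3 := (abs_le.1 (f.num_mem (i := M - 1) (by omega) (by omega))).2
  have h4 : 0 ≤ ((M : ℤ) + h) * (k * M + α) := by positivity
  have h5 : (k : ℤ) * (M + 1) = k * M + k := by ring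
  cases c
  · refine Spec.int_seq (by omega) (abs_le.2 ⟨by omega, by omega⟩) ?_
    refine Spec.int_seq (by omega) (abs_le.2 ⟨by omega, by omega⟩) ?_
    refine Spec.int_seq (by omega) (abs_le.2 ⟨by omega, by omega⟩) ?_
    refine Spec.int_seq (by omega) (abs_le.2 ⟨by omega, by omega⟩) ?_
    refine Spec.int_seq (by omega) (abs_le.2 ⟨by omega, by omega⟩) ?_
    refine Spec.seq (IntFacts.spec_flip (abs_le.2 ⟨by omega, by omega⟩)) (by omega) fun b _ => ?_
    cases b
    · exact Spec.ret trivial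
    refine Spec.int_seq (by omega) (abs_le.2 ⟨by omega, by omega⟩) ?_
    refine Spec.seq (f.spec_numF (by omega) (by omega)) (by omega) ?_
    rintro _ rfl
    refine Spec.int_seq (by omega) (f.num_mem (by omega) (by omega)) ?_
    refine Spec.int_seq (by omega) (abs_le.2 ⟨by omega, by omega⟩) ?_
    refine Spec.int_seq (by omega) (abs_le.2 ⟨by omega, by omega⟩) ?_
    exact Spec.weaken (IntFacts.spec_flip (f.num_mem (by omega) (by omega))) (by omega)
      fun _ h => h
  · refine Spec.int_seq (by omega) (abs_le.2 ⟨by omega, by omega⟩) ?_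
    refine Spec.seq (f.spec_numF (by omega) (by omega)) (by omega) ?_
    rintro _ rfl
    refine Spec.seq (f.spec_denF (by omega) (by omega)) (by omega) ?_
    rintro _ rfl
    exact Spec.weaken (IntFacts.spec_flip (f.numF_abs (by omega) (by omega))) (by omega)
      fun _ h => h

theorem spec_testAbove (p : Params n h M k α t) (w : Fits n h M k W) (c : Which) :
    Spec W (testAbove n h M k α c) (20 : ℕ) fun _ => True := by
  have f := p.intFacts w
  obtain ⟨_, _, _, _, _, _, _, _, _, _, _, _, _⟩ := id f
  have h1 : |((M : ℤ) + h + 1) * (k * M + α + 1)| ≤ W := by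
    have h2 : 0 ≤ ((M : ℤ) + h + 1) * (k * M + α + 1) := by positivity
    have h3 : (2 * ((M : ℤ) + h + 1)) * (k * M + α + 1) ≤ (n + 1 + h) * (n + 1 - h) :=
      mul_le_mul (by omega) (by omega) (by positivity) (by positivity)
    have h4 : ((n : ℤ) + 1 + h) * (n + 1 - h) ≤ 2 * (n * (n - 1)) := by nlinarith
    exact abs_le.2 ⟨by linarith, by linarith⟩
  cases c
  · refine Spec.seq (f.spec_denF (by omega) (by omega)) (by omega) ?_
    rintro _ rfl
    refine Spec.seq (f.spec_numF (by omega) (by omega)) (by omega) ?_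
    rintro _ rfl
    exact Spec.weaken (IntFacts.spec_flip (f.denF_abs (by omega) (by omega))) (by omega)
      fun _ h => h
  · refine Spec.int_seq (by omega) (abs_le.2 ⟨by omega, by omega⟩) ?_
    refine Spec.int_seq (by omega) (abs_le.2 ⟨by omega, by omega⟩) ?_
    refine Spec.seq (IntFacts.spec_flip (abs_le.2 ⟨by omega, by omega⟩)) (by omega) fun b _ => ?_
    cases b
    · exact Spec.ret trivial
    refine Spec.int_seq (by omega) (abs_le.2 ⟨by omega, by omega⟩) ?_
    refine Spec.int_seq (by omega) (abs_le.2 ⟨by omega, by omega⟩) ?_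
    refine Spec.int_seq (by omega) (abs_le.2 ⟨by omega, by omega⟩) ?_
    refine Spec.int_seq (by omega) h1 ?_
    refine Spec.seq (f.spec_numF (by omega) (by omega)) (by omega) ?_
    rintro _ rfl
    refine Spec.int_seq (by omega) (f.num_mem (by omega) (by omega)) ?_
    exact Spec.weaken (IntFacts.spec_flip h1) (by omega) fun _ h => h

theorem spec_acceptM (p : Params n h M k α t) (w : Fits n h M k W) (c : Which) {m : ℤ}
    (h0 : 0 ≤ m) (hN : m ≤ (k + 1) * M + α) :
    Spec W (acceptM n h M k α c m) (19 * n + 30 : ℕ) fun b => b = true → 2 * m + h ≤ n + 1 := by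
  have f := p.intFacts w
  obtain ⟨_, _, _, _, _, _, _, _, _, _, _, _, _⟩ := id f
  have hkM : ((k : ℤ) + 1) * M = k * M + M := by ring
  refine Spec.int_seq (by omega) (abs_le.2 ⟨by omega, by omega⟩) ?_
  refine Spec.int_seq (by omega) (abs_le.2 ⟨by omega, by omega⟩) ?_
  refine Spec.int_seq (by omega) (abs_le.2 ⟨by omega, by omega⟩) ?_
  refine Spec.unit_seq (by omega) ?_
  by_cases h1 : (n : ℤ) - h + 1 < 2 * m
  · rw [if_pos (decide_eq_true h1)]
    exact Spec.ret fun h => absurd h Bool.false_ne_true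
  rw [if_neg (by simpa using h1)]
  have h2 : 2 * m + h ≤ n + 1 := by omega
  refine Spec.unit_seq (by omega) ?_
  by_cases h3 : m < M
  · rw [if_pos (decide_eq_true h3)]
    refine Spec.seq (p.spec_testBelow w c) (by omega) fun b _ => ?_
    cases b
    · exact Spec.ret fun _ => h2
    refine Spec.int_seq (by omega) (abs_le.2 ⟨by omega, by omega⟩) ?_
    refine Spec.forAll (S := 15) n (by omega) (fun i hi hi' => ?_)
      (fun l hl hl' => abs_le.2 ⟨by omega, by omega⟩) (by omega) fun _ _ => h2
    have h4 : |(i + 1 + h) * (((k : ℤ) + 1) * M + α - i)| ≤ W := by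
      have h5 : (i + 1 + h) * (((k : ℤ) + 1) * M + α - i) <
          k * ((n - h - 2 * i + 1) * (n - h - 2 * i)) := by
        obtain ⟨j, rfl⟩ := Int.eq_ofNat_of_zero_le (h0.trans hi)
        have h6 : ((j : ℤ) + 1 + h) * ((k + 1) * M + α - j) <
            k * ((n + 1 - h - 2 * j) * (n - h - 2 * j)) := by
          exact_mod_cast p.Q_lt (i := j) (by omega)
        linarith
      have h6 := (abs_le.1 (f.num_mem (i := i) (by omega) (by omega))).2
      have h7 : 0 ≤ (i + 1 + h) * (((k : ℤ) + 1) * M + α - i) := mul_nonneg (by omega) (by omega)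
      exact abs_le.2 ⟨by linarith, by linarith⟩
    refine Spec.seq (f.spec_numF (by omega) (by omega)) (by omega) ?_
    rintro _ rfl
    refine Spec.int_seq (by omega) (f.num_mem (by omega) (by omega)) ?_
    refine Spec.seq (f.spec_denG (by omega) (by omega) h4) (by omega) ?_
    rintro _ rfl
    exact Spec.weaken (IntFacts.spec_flip (f.num_mem (by omega) (by omega))) (by omega)
      fun _ h => h
  rw [if_neg (by simpa using h3)]
  refine Spec.unit_seq (by omega) ?_
  by_cases h4 : (M : ℤ) < m
  · rw [if_pos (decide_eq_true h4)]
    refine Spec.seq (p.spec_testAbove w c) (by omega) fun b _ => ?_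
    cases b
    · exact Spec.ret fun _ => h2
    refine Spec.int_seq (by omega) (abs_le.2 ⟨by omega, by omega⟩) ?_
    refine Spec.int_seq (by omega) (abs_le.2 ⟨by omega, by omega⟩) ?_
    refine Spec.forAll (S := 15) n (by omega) (fun i hi hi' => ?_)
      (fun l hl hl' => abs_le.2 ⟨by omega, by omega⟩) (by omega) fun _ _ => h2
    have h5 : |(i + 1 + h) * (((k : ℤ) + 1) * M + α - i)| ≤ W := by
      have h6 : 0 ≤ (i + 1 + h) * (((k : ℤ) + 1) * M + α - i) := mul_nonneg (by omega) (by omega)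
      have h7 : (2 * (i + 1 + h)) * (((k : ℤ) + 1) * M + α - i) ≤ (n + 1 + h) * (n - 1 - h) :=
        mul_le_mul (by omega) (by omega) (by omega) (by omega)
      have h8 : ((n : ℤ) + 1 + h) * (n - 1 - h) ≤ 2 * (n * (n - 1)) := by nlinarith
      exact abs_le.2 ⟨by linarith, by linarith⟩
    refine Spec.seq (f.spec_denG (by omega) (by omega) h5) (by omega) ?_
    rintro _ rfl
    refine Spec.seq (f.spec_numF (by omega) (by omega)) (by omega) ?_
    rintro _ rfl
    refine Spec.int_seq (by omega) (f.num_mem (by omega) (by omega)) ?_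
    exact Spec.weaken (IntFacts.spec_flip h5) (by omega) fun _ h => h
  rw [if_neg (by simpa using h4)]
  exact Spec.ret fun _ => h2

end Params

/-! ### Expected time of the choice of `m` -/

/-- A loop that stops with probability at least `1 / K` in each iteration costs at most `K` times its
body. -/
theorem mul_inv_one_sub_le {T a : ℝ≥0∞} {r : ℝ} (K : ℕ) (ha : 1 - a = ENNReal.ofReal r)
    (hr : 1 ≤ K * r) : T * (1 - a)⁻¹ ≤ T * K := by
  rw [ha]
  refine mul_le_mul_right ?_ T
  have hr' : 0 < r := by
    by_contra! h
    have : (K : ℝ) * r ≤ 0 := mul_nonpos_of_nonneg_of_nonpos K.cast_nonneg h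
    linarith
  rw [← ENNReal.ofReal_inv_of_pos hr', ← ENNReal.ofReal_natCast]
  refine ENNReal.ofReal_le_ofReal ?_
  rw [inv_le_iff_one_le_mul₀ hr']
  exact hr

namespace Params

variable {n h M k α W : ℕ} {t : ℝ}

theorem spec_genBody (p : Params n h M k α t) (w : Fits n h M k W) (c : Which) :
    Spec W (genBody M k α (k + 1) ((k + 1 : ℤ) * M + α) c) (10 * n + 20 : ℕ)
      fun r => ∀ m : ℤ, r = .inr m → 0 ≤ m ∧ m ≤ (k + 1) * M + α := by
  obtain ⟨_, _, _, _, _, _, _, _, _, _, _, _, _⟩ := p.intFacts w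
  have hkM : ((k : ℤ) + 1) * M = k * M + M := by ring
  have hkM1 : (k : ℤ) * (M + 1) = k * M + k := by ring
  refine Spec.seq (S := 10 * n + 1) (Spec.forLoop (S := 3) (fun l m => 0 ≤ m ∧ m ≤ l - 1) (2 * n)
    (by push_cast; omega) (by omega) (by omega) (fun l m hl hl' hm => ?_)
    (fun l hl hl' => abs_le.2 ⟨by omega, by omega⟩) (by omega)) (by omega) fun m hm => ?_
  · refine Spec.random_seq (by omega) (abs_le.2 ⟨by omega, by omega⟩) fun v _ _ => ?_
    refine Spec.unit_seq (by omega) ?_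
    split_ifs
    · exact Spec.int_last (by omega) (abs_le.2 ⟨by omega, by omega⟩) (by omega)
    · exact Spec.ret (by omega)
  have hm' : 0 ≤ m ∧ m ≤ (k + 1) * M + α := by omega
  refine Spec.unit_seq (by omega) ?_
  have hout : ∀ b : Bool, ∀ m' : ℤ,
      (if b = true then (.inl () : Unit ⊕ ℤ) else .inr m) = .inr m' →
        0 ≤ m' ∧ m' ≤ (k + 1) * M + α := by
    rintro (_ | _) m' h
    · rwa [← Sum.inr_injective h]
    · exact absurd h Sum.inl_ne_inr
  split_ifs
  · cases c
    · refine Spec.int_seq (by omega) (abs_le.2 ⟨by omega, by omega⟩) ?_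
      refine Spec.int_seq (by omega) (abs_le.2 ⟨by omega, by omega⟩) ?_
      refine Spec.random_seq (by omega) (abs_le.2 ⟨by omega, by omega⟩) fun v _ _ => ?_
      refine Spec.int_seq (by omega) (abs_le.2 ⟨by omega, by omega⟩) ?_
      refine Spec.int_seq (by omega) (abs_le.2 ⟨by omega, by omega⟩) ?_
      exact Spec.unit_seq (by omega) (Spec.ret (hout _))
    · refine Spec.int_seq (by omega) (abs_le.2 ⟨by omega, by omega⟩) ?_
      refine Spec.int_seq (by omega) (abs_le.2 ⟨by omega, by omega⟩) ?_
      refine Spec.int_seq (by omega) (abs_le.2 ⟨by omega, by omega⟩) ?_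
      refine Spec.random_seq (by omega) (abs_le.2 ⟨by omega, by omega⟩) fun v _ _ => ?_
      exact Spec.unit_seq (by omega) (Spec.ret (hout _))
  · refine Spec.ret fun m' h => ?_
    rwa [← Sum.inr_injective h]

theorem spec_extendedBin (p : Params n h M k α t) (w : Fits n h M k W) :
    Spec W (extendedBin M k α (whichOf M k α)) (20 * n + 45 : ℕ)
      fun m => 0 ≤ m ∧ m ≤ (k + 1) * M + α := by
  obtain ⟨_, _, _, _, _, _, _, _, _, _, _, _, _⟩ := p.intFacts w
  have hkM : ((k : ℤ) + 1) * M = k * M + M := by ring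
  rw [extendedBin_eq]
  refine Spec.int_seq (by omega) (abs_le.2 ⟨by omega, by omega⟩) ?_
  refine Spec.int_seq (by omega) (abs_le.2 ⟨by omega, by omega⟩) ?_
  refine Spec.int_seq (by omega) (abs_le.2 ⟨by omega, by omega⟩) ?_
  refine (Spec.loop (Y := fun f : ℤ → ℝ≥0∞ => ∑ m ∈ Finset.range ((k + 1) * M + α + 1),
    ENNReal.ofReal (B M k α m / ((k : ℝ) + 1) ^ ((k + 1) * M + α)) * f m)
    p.law_genBody (p.spec_genBody w _)).mono ?_ fun _ h => h
  refine (mul_inv_one_sub_le 2 p.one_sub_genBody ?_).trans ?_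
  · -- the weight removed at `M` is at most a third of the total weight
    have h1 := p.B_self_ge
    have h2 := p.Btot_eq
    have h3 : Bund M k α M ≤ ((k : ℝ) + 1) ^ ((k + 1) * M + α) := by
      rw [← sum_Bund]
      exact Finset.single_le_sum (f := Bund M k α) (fun m _ => Bund_nonneg M k α m)
        (Finset.mem_range.2 (by have := p.M_lt_N; omega))
    have h4 : (0 : ℝ) < ((k : ℝ) + 1) ^ ((k + 1) * M + α) := by positivity
    rw [← mul_div_assoc, one_le_div h4, h2]
    push_cast
    linarith
  · have : (10 * n + 20 + 1) * 2 ≤ 20 * n + 45 - 1 - 1 - 1 := by omega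
    exact_mod_cast this

theorem spec_mainLoop (p : Params n h M k α t) (w : Fits n h M k W) :
    Spec W (loop (fun _ => mainBody n h M k α (whichOf M k α)) ()) (4680 * n + 9120 : ℕ)
      fun m => 0 ≤ m ∧ 2 * m + h ≤ n + 1 := by
  refine (Spec.loop (Y := fun f : ℤ → ℝ≥0∞ => ∑ m ∈ Finset.range ((k + 1) * M + α + 1),
    ENNReal.ofReal (accProb n h M k α * (F n h m / Ftot n h)) * f m) (T := (39 * n + 75 : ℕ))
    (Q := fun m : ℤ => 0 ≤ m ∧ 2 * m + h ≤ n + 1) p.law_mainBody ?_).mono ?_ fun _ h => h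
  · refine Spec.seq (p.spec_extendedBin w) (by omega) fun m hm => ?_
    refine Spec.seq (p.spec_acceptM w _ hm.1 hm.2) (by omega) fun b hb => ?_
    refine Spec.ret fun m' h => ?_
    cases b
    · exact absurd h Sum.inl_ne_inr
    · rw [← Sum.inr_injective h]
      exact ⟨hm.1, hb rfl⟩
  · refine (mul_inv_one_sub_le 120 p.one_sub_mainBody ?_).trans ?_
    · have := p.accProb_ge
      push_cast
      linarith
    · have : (39 * n + 75 + 1) * 120 ≤ 4680 * n + 9120 := by omega
      exact_mod_cast this

theorem spec_computeM (p : Params n h M k α t) (w : Fits n h M k W) :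
    Spec W (computeM n h) (11 * n + 11 : ℕ) (· = (M : ℤ)) := by
  have f := p.intFacts w
  obtain ⟨_, _, _, _, _, _, _, _, _, _, _, _, _⟩ := id f
  refine Spec.loop_search (S := 10) M (fun i hi => ?_) ?_ (by omega)
  · refine Spec.seq (f.spec_numF (by omega) (by omega)) (by omega) ?_
    rintro _ rfl
    refine Spec.seq (f.spec_denF (by omega) (by omega)) (by omega) ?_
    rintro _ rfl
    refine Spec.unit_seq (by omega) ?_
    have h2 : ((i : ℤ) + 1) * (i + 1 + h) < ((n : ℤ) + 1 - h - 2 * i) * (n - h - 2 * i) := by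
      exact_mod_cast p.lt_P hi
    rw [decide_eq_false (by rw [not_le]; linarith), if_neg Bool.false_ne_true]
    exact Spec.int_seq (by omega) (abs_le.2 ⟨by omega, by omega⟩) (Spec.ret rfl)
  · refine Spec.seq (f.spec_numF (by omega) (by omega)) (by omega) ?_
    rintro _ rfl
    refine Spec.seq (f.spec_denF (by omega) (by omega)) (by omega) ?_
    rintro _ rfl
    refine Spec.unit_seq (by omega) ?_
    have h2 : ((n : ℤ) + 1 - h - 2 * M) * (n - h - 2 * M) ≤ ((M : ℤ) + 1) * (M + 1 + h) := by
      exact_mod_cast p.P_le le_rfl p.two_mul_M_le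
    rw [decide_eq_true (by linarith), if_pos rfl]
    exact Spec.ret rfl

theorem spec_computeWhich (p : Params n h M k α t) (w : Fits n h M k W) :
    Spec W (computeWhich M k α) (8 : ℕ) (· = whichOf M k α) := by
  have f := p.intFacts w
  obtain ⟨_, _, _, _, _, _, _, _, _, _, _, _, _⟩ := id f
  have hkM1 : (k : ℤ) * (M + 1) = k * M + k := by ring
  have h1 : ((k : ℤ) * M + α + 1) * (k * M + α) ≤ n * (n - 1) :=
    mul_le_mul (by omega) (by omega) (by positivity) (by omega)
  have h2 : 0 ≤ ((k : ℤ) * M + α + 1) * (k * M + α) := by positivity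
  have h3 : 0 ≤ (k : ℤ) * M * (k * (M + 1)) := by positivity
  refine Spec.returns (Q := fun _ => True) ?_ (law_computeWhich M k α)
  refine Spec.int_seq (by omega) (abs_le.2 ⟨by omega, by omega⟩) ?_
  refine Spec.int_seq (by omega) (abs_le.2 ⟨by omega, by omega⟩) ?_
  refine Spec.int_seq (by omega) (abs_le.2 ⟨by omega, by omega⟩) ?_
  refine Spec.int_seq (by omega) (abs_le.2 ⟨by linarith, by linarith⟩) ?_
  refine Spec.int_seq (by omega) (abs_le.2 ⟨by omega, by omega⟩) ?_
  refine Spec.int_seq (by omega) (abs_le.2 ⟨by omega, by omega⟩) ?_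
  refine Spec.int_seq (by omega) (abs_le.2 ⟨by linarith, by linarith⟩) ?_
  exact Spec.unit_seq (by omega) (Spec.ret trivial)

theorem spec_computeTilde (n h : ℕ) :
    Spec W (computeTilde n h) (15 : ℕ) (· = mTilde n h) := by
  refine Spec.returns (Q := fun _ => True) ?_ (law_computeTilde n h)
  iterate 14 refine Spec.unit_seq (by omega) ?_
  exact Spec.unit_last (by omega) trivial

theorem spec_computeK (p : Params n h M k α t) (w : Fits n h M k W) (hk : (k : ℤ) = parK n h) :
    Spec W (computeK n h (mTilde n h)) (8 : ℕ) (· = (k : ℤ)) := by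
  obtain ⟨_, _, _, _, _, _, _, _, _, _, _, _, _⟩ := p.intFacts w
  rw [hk]
  refine Spec.returns (Q := fun _ => True) ?_ (law_computeK n h)
  have hc : ⌈(((n : ℤ) : ℝ) + 1 - ((h : ℤ) : ℝ)) / (2 * mTilde n h)⌉ = k + 1 := by
    rw [hk, parK]
    push_cast
    ring
  iterate 6 refine Spec.unit_seq (by omega) ?_
  refine Spec.int_seq (by omega) (by rw [hc]; exact abs_le.2 ⟨by omega, by omega⟩) ?_
  exact Spec.int_last (by omega) (by rw [hc]; exact abs_le.2 ⟨by omega, by omega⟩) trivial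

theorem spec_computeAlpha (p : Params n h M k α (mTilde n h)) (w : Fits n h M k W)
    (hk : (k : ℤ) = parK n h) (hα : (α : ℤ) = parAlpha n h) :
    Spec W (computeAlpha M k (mTilde n h)) (8 : ℕ) (· = (α : ℤ)) := by
  obtain ⟨_, _, _, _, _, _, _, _, _, _, _, _, _⟩ := p.intFacts w
  rw [hα]
  refine Spec.returns (Q := fun _ => True) ?_ (law_computeAlpha n h M k p.argM_eq hk)
  set c := ⌈((k : ℤ) : ℝ) * (((M : ℤ) : ℝ) - mTilde n h)⌉ with hc
  have hk0 : (0 : ℝ) ≤ k := k.cast_nonneg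
  have h1 : 0 ≤ c := by
    refine Int.ceil_nonneg ?_
    push_cast
    exact mul_nonneg hk0 (sub_nonneg.2 p.le_M)
  have h2 : c ≤ k := by
    refine Int.ceil_le.2 ?_
    push_cast
    have := p.M_lt
    nlinarith
  iterate 4 refine Spec.unit_seq (by omega) ?_
  refine Spec.int_seq (by omega) (abs_le.2 ⟨by omega, by omega⟩) ?_
  refine Spec.int_seq (by omega) (abs_le.2 ⟨by omega, by omega⟩) ?_
  refine Spec.int_seq (by omega) (abs_le.2 ⟨by omega, by omega⟩) ?_
  exact Spec.unit_seq (by omega) (Spec.ret trivial)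

theorem spec_chooseM (p : Params n h M k α (mTilde n h)) (w : Fits n h M k W)
    (hk : (k : ℤ) = parK n h) (hα : (α : ℤ) = parAlpha n h) :
    Spec W (chooseM n h) (4691 * n + 9200 : ℕ) fun m => 0 ≤ m ∧ 2 * m + h ≤ n + 1 := by
  rw [chooseM_eq]
  refine Spec.seq (p.spec_computeM w) (by omega) ?_
  rintro _ rfl
  refine Spec.seq (spec_computeTilde n h) (by omega) ?_
  rintro _ rfl
  refine Spec.seq (p.spec_computeK w hk) (by omega) ?_
  rintro _ rfl
  refine Spec.seq (p.spec_computeAlpha w hk hα) (by omega) ?_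
  rintro _ rfl
  refine Spec.seq (p.spec_computeWhich w) (by omega) ?_
  rintro _ rfl
  exact Spec.weaken (p.spec_mainLoop w) (by omega) fun _ h => h

end Params

/-! ### Time and integers of the construction of the path -/

section Path

variable {W : ℕ}

theorem spec_mix {a b c : ℤ} {L : ℕ} (ha : 0 ≤ a) (hb : 0 ≤ b) (hc : 0 ≤ c) (hL : a + b + c = L)
    (hW : 3 * L + 1 ≤ W) : Spec W (mix a b c) (9 * L + 3 : ℕ) fun _ => True := by
  refine Spec.int_seq (by omega) (abs_le.2 ⟨by omega, by omega⟩) ?_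
  refine Spec.int_seq (by omega) (abs_le.2 ⟨by omega, by omega⟩) ?_
  refine Spec.seq (S := 9 * L + 1) (Spec.forLoop (S := 7)
    (fun _ (s : List Step × ℤ × ℤ × ℤ) => (0 ≤ s.2.1 ∧ s.2.1 ≤ L) ∧ (0 ≤ s.2.2.1 ∧ s.2.2.1 ≤ L) ∧
      (0 ≤ s.2.2.2 ∧ s.2.2.2 ≤ L)) L (by omega) (by omega)
    (by dsimp only; omega)
    (fun l s _ _ hs => ?_) (fun l hl hl' => abs_le.2 ⟨by omega, by omega⟩) (by omega)) (by omega)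
    fun r _ => Spec.ret trivial
  obtain ⟨w, a, b, c⟩ := s
  dsimp only at hs ⊢
  refine Spec.int_seq (by omega) (abs_le.2 ⟨by omega, by omega⟩) ?_
  refine Spec.int_seq (by omega) (abs_le.2 ⟨by omega, by omega⟩) ?_
  refine Spec.random_seq (by omega) (abs_le.2 ⟨by omega, by omega⟩) fun v h0 h1 => ?_
  refine Spec.unit_seq (by omega) ?_
  by_cases h2 : v < a
  · rw [if_pos (decide_eq_true h2)]
    refine Spec.unit_seq (by omega) ?_
    refine Spec.int_seq (by omega) (abs_le.2 ⟨by omega, by omega⟩) (Spec.ret ?_)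
    dsimp only
    omega
  rw [if_neg (by simpa using h2)]
  refine Spec.unit_seq (by omega) ?_
  by_cases h3 : v < a + b
  · rw [if_pos (decide_eq_true h3)]
    refine Spec.unit_seq (by omega) ?_
    refine Spec.int_seq (by omega) (abs_le.2 ⟨by omega, by omega⟩) (Spec.ret ?_)
    dsimp only
    omega
  rw [if_neg (by simpa using h3)]
  refine Spec.unit_seq (by omega) ?_
  refine Spec.int_seq (by omega) (abs_le.2 ⟨by omega, by omega⟩) (Spec.ret ?_)
  dsimp only
  omega

theorem spec_move {y : ℤ} {l : ℤ} (h0 : -l ≤ y) (h1 : y ≤ l) (hW : l + 1 ≤ W) (s : Step) :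
    Spec W (move y s) (1 : ℕ) fun z => -(l + 1) ≤ z ∧ z ≤ l + 1 := by
  cases s
  · exact Spec.int_last le_rfl (abs_le.2 ⟨by omega, by omega⟩) (by omega)
  · exact Spec.int_last le_rfl (abs_le.2 ⟨by omega, by omega⟩) (by omega)
  · exact Spec.ret (by omega)

theorem spec_minHeight (n : ℕ) (w : List Step) (hW : n + 1 ≤ W) :
    Spec W (minHeight n w) (5 * n + 6 : ℕ) fun z => -(n + 1) ≤ z ∧ z ≤ 0 := by
  refine Spec.seq (S := 5 * n + 6) (Spec.forLoop (S := 3)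
    (fun l s => (-l ≤ s.1 ∧ s.1 ≤ l) ∧ (-l ≤ s.2 ∧ s.2 ≤ 0)) (n + 1) (by push_cast; omega)
    (by omega) (by simp) (fun l s h0 h1 hs => ?_)
    (fun l hl hl' => abs_le.2 ⟨by omega, by omega⟩) (by omega)) (by omega)
    fun r hr => Spec.ret ⟨by omega, by omega⟩
  refine Spec.readAt_seq (by omega) fun x => ?_
  refine Spec.seq (spec_move (l := l) (by omega) (by omega) (by omega) x) (by omega) fun y hy => ?_
  refine Spec.unit_seq (by omega) (Spec.ret ?_)
  dsimp only
  by_cases h : y < s.2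
  · rw [if_pos (decide_eq_true h)]
    omega
  · rw [if_neg (by simpa using h)]
    omega

theorem spec_lastVisit (n : ℕ) (w : List Step) (e : ℤ) (hW : n + 1 ≤ W) :
    Spec W (lastVisit n w e) (6 * n + 7 : ℕ) fun z => 0 ≤ z ∧ z ≤ n + 1 := by
  refine Spec.seq (S := 6 * n + 7) (Spec.forLoop (S := 4)
    (fun l s => (-l ≤ s.1 ∧ s.1 ≤ l) ∧ (0 ≤ s.2 ∧ s.2 ≤ l)) (n + 1) (by push_cast; omega)
    (by omega) (by simp) (fun l s h0 h1 hs => ?_)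
    (fun l hl hl' => abs_le.2 ⟨by omega, by omega⟩) (by omega)) (by omega)
    fun r hr => Spec.ret ⟨by omega, by omega⟩
  refine Spec.readAt_seq (by omega) fun x => ?_
  refine Spec.seq (spec_move (l := l) (by omega) (by omega) (by omega) x) (by omega) fun y hy => ?_
  refine Spec.unit_seq (by omega) ?_
  refine Spec.int_seq (by omega) (abs_le.2 ⟨by omega, by omega⟩) (Spec.ret ?_)
  dsimp only
  split_ifs <;> omega

theorem spec_cyclicTail (n : ℕ) (w : List Step) {q : ℤ} (h0 : 0 ≤ q) (h1 : q ≤ n + 1)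
    (hW : 2 * n + 1 ≤ W) : Spec W (cyclicTail n w q) (8 * n + 1 : ℕ) fun _ => True := by
  refine Spec.forLoop (S := 6) (fun _ _ => True) n (by omega) (by omega) trivial
    (fun l s h2 h3 _ => ?_) (fun l hl hl' => abs_le.2 ⟨by omega, by omega⟩) (by omega)
  refine Spec.int_seq (by omega) (abs_le.2 ⟨by omega, by omega⟩) ?_
  refine Spec.unit_seq (by omega) ?_
  split_ifs
  · exact Spec.readAt_seq (by omega) fun x => Spec.unit_last (by omega) trivial
  · refine Spec.int_seq (by omega) (abs_le.2 ⟨by omega, by omega⟩) ?_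
    refine Spec.int_seq (by omega) (abs_le.2 ⟨by omega, by omega⟩) ?_
    exact Spec.readAt_seq (by omega) fun x => Spec.unit_last (by omega) trivial

theorem spec_finish {n h : ℕ} {m : ℤ} (h0 : 0 ≤ m) (h1 : 2 * m + h ≤ n + 1)
    (hW : 3 * n + 4 ≤ W) : Spec W (finish n h m) (28 * n + 60 : ℕ) fun _ => True := by
  refine Spec.int_seq (by omega) (abs_le.2 ⟨by omega, by omega⟩) ?_
  refine Spec.int_seq (by omega) (abs_le.2 ⟨by omega, by omega⟩) ?_
  refine Spec.int_seq (by omega) (abs_le.2 ⟨by omega, by omega⟩) ?_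
  refine Spec.int_seq (by omega) (abs_le.2 ⟨by omega, by omega⟩) ?_
  refine Spec.seq (spec_mix (L := n + 1) (by omega) (by omega) (by omega) (by push_cast; ring)
    (by omega)) (by omega) fun w _ => ?_
  refine Spec.seq (spec_minHeight n w (by omega)) (by omega) fun low hlow => ?_
  refine Spec.random_seq (by omega) (abs_le.2 ⟨by omega, by omega⟩) fun j h2 h3 => ?_
  refine Spec.int_seq (by omega) (abs_le.2 ⟨by omega, by omega⟩) ?_
  refine Spec.seq (spec_lastVisit n w _ (by omega)) (by omega) fun q hq => ?_
  exact Spec.weaken (spec_cyclicTail n w hq.1 hq.2 (by omega)) (by omega) fun _ h => h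

theorem spec_tooBig (n h : ℤ) : Spec W (tooBig n h) (10 : ℕ) fun _ => True := by
  iterate 9 refine Spec.unit_seq (by omega) ?_
  exact Spec.unit_last (by omega) trivial

end Path

namespace Params

variable {n h M k α W : ℕ}

theorem spec_motzkin (p : Params n h M k α (mTilde n h)) (w : Fits n h M k W)
    (hk : (k : ℤ) = parK n h) (hα : (α : ℤ) = parAlpha n h) :
    Spec W (motzkin n h) (7000 * n : ℕ) fun _ => True := by
  obtain ⟨_, _, _, _, _, _, _, _, _, _, _, _, _⟩ := p.intFacts w
  refine Spec.seq (spec_tooBig _ _) (by omega) fun b _ => ?_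
  cases b
  · refine Spec.seq (p.spec_chooseM w hk hα) (by omega) fun m hm => ?_
    refine Spec.seq (spec_finish hm.1 hm.2 (by omega)) (by omega) fun u _ => ?_
    exact Spec.ret trivial
  · exact Spec.ret trivial

end Params

/-! ### The integers compared with `n ^ 2` -/

/-- The inequality behind `k P 0 ≤ 2 n ^ 2`: after the substitution `t = 1 + b`, `u = t + 2 + a` all
coefficients are nonnegative. -/
theorem quintic_bound {t u : ℝ} (ht : 1 ≤ t) (hu : t + 2 ≤ u) :
    (u + 2 * t) ^ 2 * (u + 2 * t - 1) * (t + 1) ^ 2 ≤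
      4 * t * (u ^ 2 + u * t + (t - 2) * (t + 1)) ^ 2 := by
  obtain ⟨b, rfl⟩ : ∃ b, t = 1 + b := ⟨t - 1, by ring⟩
  obtain ⟨a, rfl⟩ : ∃ a, u = 1 + b + 2 + a := ⟨u - (1 + b + 2), by ring⟩
  have hb : 0 ≤ b := by linarith
  have ha : 0 ≤ a := by linarith
  rw [← sub_nonneg]
  ring_nf
  positivity

/-- The inequality behind `k P 0 < n ^ 2` for `k ≥ 2`, which forces `2 t < u`. -/
theorem quintic_bound_of_two_mul_lt {t u : ℝ} (ht : 1 ≤ t) (hu : 2 * t ≤ u) (hu' : 40 ≤ u) :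
    (u + 2 * t) ^ 2 * (u + 2 * t - 1) * (t + 1) ^ 2 <
      2 * t * (u ^ 2 + u * t + (t - 2) * (t + 1)) ^ 2 := by
  rcases le_total 5 t with h4 | h4
  · obtain ⟨b, rfl⟩ : ∃ b, t = 5 + b := ⟨t - 5, by ring⟩
    obtain ⟨a, rfl⟩ : ∃ a, u = 2 * (5 + b) + a := ⟨u - 2 * (5 + b), by ring⟩
    have hb : 0 ≤ b := by linarith
    have ha : 0 ≤ a := by linarith
    rw [← sub_pos]
    ring_nf
    positivity
  · have h1 : (u + 2 * t) ^ 2 * (u + 2 * t - 1) * (t + 1) ^ 2 ≤ (u + 10) ^ 2 * (u + 9) * 6 ^ 2 := by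
      gcongr <;> linarith
    have h2 : (u + 10) ^ 2 * (u + 9) * 6 ^ 2 < 2 * (u ^ 2) ^ 2 := by
      obtain ⟨a, rfl⟩ : ∃ a, u = 40 + a := ⟨u - 40, by ring⟩
      have ha : 0 ≤ a := by linarith
      rw [← sub_pos]
      ring_nf
      positivity
    have h3 : (u ^ 2) ^ 2 ≤ (u ^ 2 + u * t + (t - 2) * (t + 1)) ^ 2 := by
      have : 0 ≤ u * t + (t - 2) * (t + 1) := by nlinarith
      gcongr
      linarith
    have h4 : 1 * (u ^ 2 + u * t + (t - 2) * (t + 1)) ^ 2 ≤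
        t * (u ^ 2 + u * t + (t - 2) * (t + 1)) ^ 2 := by gcongr
    linarith

namespace Params

variable {n h M k α : ℕ} {t : ℝ}

/-- `n (t+1)` as a polynomial in `t` and `u = n + 1 - h - 2 t`. -/
theorem n_mul (p : Params n h M k α t) {u : ℝ} (hu : u = n + 1 - h - 2 * t) :
    (n : ℝ) * (t + 1) = u ^ 2 + u * t + (t - 2) * (t + 1) := by
  subst hu
  linear_combination -p.root

/-- As `h ≥ 1`, the equation of `t` gives `u (u - 1) ≥ (t + 1) (t + 2)`. -/
theorem add_two_le (p : Params n h M k α t) : t + 2 ≤ (n : ℝ) + 1 - h - 2 * t := by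
  have h1 := p.root
  have h2 := p.three_lt
  have h3 := p.one_lt
  have h4 : (1 : ℝ) ≤ h := by exact_mod_cast p.h_pos
  by_contra! h5
  nlinarith

/-- A polynomial inequality between `u` and `t` bounds the largest numerator of the acceptance
tests, as `k < (u + 2t) / (2t)`. -/
theorem num_le (p : Params n h M k α t) {u c : ℝ} (hu : u = n + 1 - h - 2 * t)
    (hc : (u + 2 * t) ^ 2 * (u + 2 * t - 1) * (t + 1) ^ 2 ≤
      2 * c * t * (u ^ 2 + u * t + (t - 2) * (t + 1)) ^ 2) :
    (k : ℝ) * ((n + 1 - h) * (n - h)) < c * n ^ 2 := by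
  have ht := p.one_lt
  have h3 := p.three_lt
  rw [← hu] at h3
  rw [← p.n_mul hu, mul_pow, ← mul_assoc] at hc
  have h1 := le_of_mul_le_mul_right hc (by positivity)
  have h2 : 2 * t * k < u + 2 * t := by have := p.k_lt; linarith
  have h4 : 0 < (u + 2 * t) * (u + 2 * t - 1) := mul_pos (by linarith) (by linarith)
  have h5 := mul_lt_mul_of_pos_right h2 h4
  rw [show (n : ℝ) + 1 - h = u + 2 * t by rw [hu]; ring,
    show (n : ℝ) - h = u + 2 * t - 1 by rw [hu]; ring]
  refine lt_of_mul_lt_mul_left (a := 2 * t) ?_ (by linarith)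
  linarith

/-- The bound `2 n ^ 2` on the integers. -/
theorem fits_two_mul_sq (p : Params n h M k α t) : Fits n h M k (2 * n ^ 2) := by
  have hk := p.k_pos
  have ht := p.one_lt
  have hn : (0 : ℝ) ≤ n := n.cast_nonneg
  refine ⟨?_, ?_, ?_⟩
  · push_cast
    nlinarith
  · push_cast
    refine (p.num_le (c := 2) rfl ?_).le
    refine (quintic_bound ht.le p.add_two_le).trans (le_of_eq (by ring))
  · have hh : (1 : ℝ) ≤ h := by exact_mod_cast p.h_pos
    have h1 := p.k_lt
    have h2 := p.M_lt
    have h3 : (k : ℝ) * M ≤ k * (t + 1) := by gcongr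
    have h4 : (k : ℝ) * 1 ≤ k * t := by gcongr
    have h5 : (k : ℝ) * M ≤ n := by linarith
    have h6 : (k : ℝ) * (M + 1) ≤ 2 * n := by linarith
    have := mul_le_mul h5 h6 (by positivity) (by positivity)
    push_cast
    linarith

/-- The bound `n ^ 2 - 1` on the integers when `n` is large. -/
theorem fits_sq_sub_one (p : Params n h M k α t) (hn : 1000 ≤ n) : Fits n h M k (n ^ 2 - 1) := by
  have hk := p.k_pos
  have ht := p.one_lt
  have hn' : (1000 : ℝ) ≤ n := by exact_mod_cast hn
  have hh : (1 : ℝ) ≤ h := by exact_mod_cast p.h_pos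
  have hW : ((n ^ 2 - 1 : ℕ) : ℝ) = (n : ℝ) ^ 2 - 1 := by
    rw [Nat.cast_sub (Nat.one_le_pow _ _ (by omega))]
    push_cast
    ring
  obtain ⟨u, hu⟩ : ∃ u, u = (n : ℝ) + 1 - h - 2 * t := ⟨_, rfl⟩
  have hnu := p.n_mul hu
  have hut := p.add_two_le
  rw [← hu] at hut
  have hu40 : 40 ≤ u := by
    by_contra! hc
    -- a small `u` bounds `t`, `h` and with them `n`
    have h1 : u * (u - 1) ≤ 40 * 39 := by nlinarith
    have h2 : ((n : ℝ) - u - t + 2) * (t + 1) = u * (u - 1) := by linear_combination hnu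
    nlinarith
  have hkt := p.k_lt
  have hMt := p.M_lt
  have hkM : (k : ℝ) * M ≤ k * (t + 1) := by gcongr
  refine ⟨?_, ?_, ?_⟩ <;> rw [hW]
  · nlinarith
  · rcases p.one_le_k.eq_or_lt with h1 | h1
    · rw [← h1, Nat.cast_one, one_mul]
      have h2 : (0 : ℝ) ≤ n - h := by linarith
      have : ((n : ℝ) + 1 - h) * (n - h) ≤ n * (n - 1) :=
        mul_le_mul (by linarith) (by linarith) h2 (by linarith)
      linarith
    · have h2 : (2 : ℝ) ≤ k := by exact_mod_cast h1
      have h3 : t * 2 ≤ t * k := by gcongr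
      have h4 := (quintic_bound_of_two_mul_lt ht.le (by linarith) hu40).le
      have h5 := p.num_le (c := 1) hu (by linarith)
      have h6 : (k : ℤ) * ((n + 1 - h) * (n - h)) < n ^ 2 := by
        rw [one_mul] at h5
        exact_mod_cast h5
      have h7 : (k : ℤ) * ((n + 1 - h) * (n - h)) ≤ n ^ 2 - 1 := by omega
      exact_mod_cast h7
  · rcases le_total 2 t with h1 | h1
    · have h4 : (k : ℝ) * 2 ≤ k * t := by gcongr
      have h5 : (k : ℝ) * M ≤ 3 / 4 * n := by linarith
      have h6 : (k : ℝ) * (M + 1) ≤ n := by linarith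
      have := mul_le_mul h5 h6 (by positivity) (by positivity)
      nlinarith
    · have h4 : (k : ℝ) * 1 ≤ k * t := by gcongr
      have h5 : (k : ℝ) * M ≤ u + 4 := by linarith
      have h6 : (k : ℝ) * (M + 1) ≤ 2 * (u + 4) := by linarith
      have h7 := mul_le_mul h5 h6 (by positivity) (by linarith)
      -- `u` is of the order of the square root of `n`
      have h8 : u ^ 2 ≤ 3 * n + 2 := by nlinarith
      nlinarith

end Params

end MotzkinGen

theorem mainTheorem3 :
    ∃ (C : ℝ≥0) (n₀ : ℕ), ∀ n h : ℕ, 1 ≤ h → (h : ℝ) < n - 1 / 2 - √(8 * n + 9) / 2 →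
      -- the parameters
      2 ≤ MotzkinGen.argM n h ∧
      (MotzkinGen.argM n h : ℤ) = ⌈MotzkinGen.mTilde n h⌉ ∧
      ∃ k α : ℕ, (k : ℤ) = MotzkinGen.parK n h ∧ (α : ℤ) = MotzkinGen.parAlpha n h ∧
      1 ≤ k ∧ α ≤ k - 1 ∧
      -- the ratio of `G` exceeds `1` iff `m < M`
      (∀ m : ℕ, 2 * m + h ≤ n + 1 →
        (1 < MotzkinGen.RG n h (MotzkinGen.argM n h) k α m ↔ m < MotzkinGen.argM n h)) ∧
      -- the extended binomial generator has the law `B`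
      (∀ m : ℕ,
        MotzkinGen.prob (MotzkinGen.extendedBin (MotzkinGen.argM n h) k α
            (MotzkinGen.whichOf (MotzkinGen.argM n h) k α)) (m : ℤ) =
          ENNReal.ofReal (MotzkinGen.B (MotzkinGen.argM n h) k α m /
            MotzkinGen.Btot (MotzkinGen.argM n h) k α)) ∧
      -- the acceptance tests accept `m` with probability `F(m) / Bbar(m)`
      (∀ m : ℕ, m ≤ (k + 1) * MotzkinGen.argM n h + α →
        MotzkinGen.prob (MotzkinGen.acceptM n h (MotzkinGen.argM n h) k α
            (MotzkinGen.whichOf (MotzkinGen.argM n h) k α) m) true =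
          ENNReal.ofReal (MotzkinGen.F n h m /
            MotzkinGen.Bbar n h (MotzkinGen.argM n h) k α m) ∧
        MotzkinGen.prob (MotzkinGen.acceptM n h (MotzkinGen.argM n h) k α
            (MotzkinGen.whichOf (MotzkinGen.argM n h) k α) m) false =
          ENNReal.ofReal (1 - MotzkinGen.F n h m /
            MotzkinGen.Bbar n h (MotzkinGen.argM n h) k α m)) ∧
      -- the loop draws `m` with probability `F(m) / ∑ F`
      (∀ m : ℕ, MotzkinGen.prob (MotzkinGen.chooseM n h) (m : ℤ) =
        ENNReal.ofReal (MotzkinGen.F n h m / MotzkinGen.Ftot n h)) ∧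
      MotzkinGen.haltProb (MotzkinGen.chooseM n h) = 1 ∧
      -- `F(m)` and `∑ F` count Motzkin left factors
      (∀ m : ℕ, (Set.ncard {w | MotzkinGen.IsMotzkinLeftFactor n ((h : ℤ) - 1) w ∧
          w.count MotzkinGen.Step.down = m} : ℝ) = MotzkinGen.F n h m) ∧
      (Set.ncard {w | MotzkinGen.IsMotzkinLeftFactor n ((h : ℤ) - 1) w} : ℝ) =
        MotzkinGen.Ftot n h ∧
      -- the algorithm halts almost surely with a uniform Motzkin left factor
      MotzkinGen.haltProb (MotzkinGen.motzkin n h) = 1 ∧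
      (∀ w : List MotzkinGen.Step, MotzkinGen.IsMotzkinLeftFactor n ((h : ℤ) - 1) w →
        MotzkinGen.prob (MotzkinGen.motzkin n h) (some w) =
          (Set.ncard {u | MotzkinGen.IsMotzkinLeftFactor n ((h : ℤ) - 1) u} : ℝ≥0∞)⁻¹) ∧
      -- linear expected time and small integers
      MotzkinGen.expTime (MotzkinGen.motzkin n h) ≤ C * n ∧
      MotzkinGen.IntsAtMost (MotzkinGen.motzkin n h) (2 * n ^ 2) ∧
      (n₀ ≤ n → MotzkinGen.IntsAtMost (MotzkinGen.motzkin n h) (n ^ 2 - 1)) := by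
  refine ⟨7000, 1000, fun n h hh hyp => ?_⟩
  obtain ⟨k, α, hk, hα, p⟩ := MotzkinGen.exists_params hh hyp
  have hceil := p.ceil_eq
  refine ⟨p.two_le_M, ?_, k, α, hk, hα, p.one_le_k, Nat.le_sub_one_of_lt p.α_lt,
    fun m hm => p.one_lt_RG_iff hm, p.prob_extendedBin, fun m _ => ?_, p.prob_chooseM hk hα,
    p.haltProb_chooseM hk hα, MotzkinGen.ncard_leftFactors hh, MotzkinGen.ncard_total hh,
    p.haltProb_motzkin hk hα hyp, fun w hw => p.prob_motzkin hk hα hyp hw, ?_, ?_, fun hn => ?_⟩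
  · exact hceil.symm
  · rw [MotzkinGen.Params.F_div_Bbar]
    exact ⟨(p.bern_acceptM m).prob_true, (p.bern_acceptM m).prob_false⟩
  · have := (p.spec_motzkin p.fits_two_mul_sq hk hα).expTime_le
    exact_mod_cast this
  · exact (p.spec_motzkin p.fits_two_mul_sq hk hα).intsAtMost
  · exact (p.spec_motzkin (p.fits_sq_sub_one hn) hk hα).intsAtMost
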